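/- Let $\mathsf{L}_\omega$ be the language of higher-order arithmetic: variables of every finite type (type $0$ is $\mathbb{N}$, $1 = 0\to 0$, $n+1 = n\to 0$), the constants $0,1,+,\times,<,=$ of type $0$, the combinators $\Pi,\Sigma$ and recursor constants; equality at higher types is pointwise. The base theory $\mathsf{RCA}_0^\omega$ is formulated in classical many-sorted predicate logic and consists of: the axioms of a (discretely) ordered commutative semi-ring for type $0$; the defining axioms of $\Pi$ and $\Sigma$; the recursor axioms $\mathbf{R}_0(f,m,0)=m$, $\mathbf{R}_0(f,m,n+1)=f(\mathbf{R}_0(f,m,n))$; the axiom of extensionality in all types; induction for quantifier-free formulas of $\mathsf{L}_\omega$; and $\mathsf{QF\text{-}AC}^{1,0}$, i.e. $(\forall x^1)(\exists y^0)A(x,y)\to(\exists Y^{1\to 0})(\forall x^1)A(x,Y(x))$ for quantifier-free $A$. Let $\mathsf{L}_2$ be the language of second-order arithmetic in its function-based form (only variables of types $0$ and $1$). Write $C$ for the set of $f^1$ with $f\le 1$ pointwise, and $\overline{f}N=\langle f(0),\dots,f(N-1)\rangle$. Consider the following sentences. * $\mathsf{WKL}$: every infinite binary tree has a path. * $(\exists^2)$: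 there is $\varphi^2\le 1$ such that for all $f^1$: $(\exists n)(f(n)=0)\leftrightarrow\varphi(f)=0$. * $\mathsf{FF}$: there is $\Phi^3$ such that for every $Y^2$ that is continuous on $\mathbb{N}^{\mathbb{N}}$ and all $f,g\in C$: $\overline{f}\Phi(Y)=\overline{g}\Phi(Y)\to Y(f)=Y(g)$. * $\mathsf{HBU_c}$: for every $G^2$ there is a finite sequence $f_1,\dots,f_k\in C$ such that for every $f\in C$ there is $i\le k$ with $\overline{f}G(f_i)=\overline{f_i}G(f_i)$. * $\mathsf{HBU}$: for every $\Psi:\mathbb{R}\to\mathbb{R}^+$ there is a finite sequence $y_1,\dots,y_k\in[0,1]$ such that every $x\in[0,1]$ lies in some interval $(y_i-\Psi(y_i),\,y_i+\Psi(y_i))$. Here reals are represented by sequences $(q_n)$ of (codes of) rationals with $|q_n-q_{n+i}|<2^{-n}$ for all $n,i$, and $\Psi$ is given by a functional of type $1\to1$ that maps representations of equal reals to representations of equal reals. **Theorem.** Let $\mathsf{X}$ be an $\mathsf{L}_2$-sentence such that $\mathsf{RCA}_0^\omega$ plus arithmetical comprehension proves $\mathsf{X}$, and $\mathsf{RCA}_0^\omega+\mathsf{X}$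 proves $\mathsf{WKL}$ (in particular, any $\mathsf{L}_2$-sentence with $\mathsf{ACA}_0\to\mathsf{X}\to\mathsf{WKL}_0$). Then $\mathsf{RCA}_0^\omega$ proves $$\mathsf{WKL}\leftrightarrow[(\exists^2)\vee\mathsf{HBU_c}]\leftrightarrow[\mathsf{X}\vee\mathsf{HBU}]\leftrightarrow[\mathsf{FF}\vee\mathsf{HBU_c}],$$ that is, it proves each of the three displayed equivalences between neighbouring members. -/

import Mathlib

namespace HOA

/-! ## The language of higher-order arithmetic -/

/-- The finite types: the type `0` of natural numbers, and closure under function types. -/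
inductive Ty : Type
  | nat : Ty
  | arr : Ty → Ty → Ty

infixr:60 " ⇒ " => Ty.arr

/-- The type `1 = 0 → 0` of functions on the natural numbers. -/
abbrev ty1 : Ty := Ty.nat ⇒ Ty.nat
/-- The type `2 = 1 → 0`. -/
abbrev ty2 : Ty := ty1 ⇒ Ty.nat
/-- The type `3 = 2 → 0`. -/
abbrev ty3 : Ty := ty2 ⇒ Ty.nat

/-- A context lists the types of the variables that may occur free, the innermost one first. -/
abbrev Ctx : Type := List Ty

/-- Typed variables in a context (de Bruijn indices). -/
inductive Var : Ctx → Ty → Type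
  | z {Γ : Ctx} {σ : Ty} : Var (σ :: Γ) σ
  | s {Γ : Ctx} {σ τ : Ty} : Var Γ σ → Var (τ :: Γ) σ

/-- Terms: variables, the arithmetical constants, the combinators `Π` (here `K`) and `Σ` (here `S`)
of all types, the recursor constants of all types, and application. -/
inductive Tm (Γ : Ctx) : Ty → Type
  | var {σ : Ty} : Var Γ σ → Tm Γ σ
  | zero : Tm Γ Ty.nat
  | one : Tm Γ Ty.nat
  | add : Tm Γ (Ty.nat ⇒ Ty.nat ⇒ Ty.nat)
  | mul : Tm Γ (Ty.nat ⇒ Ty.nat ⇒ Ty.nat)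
  | K (ρ τ : Ty) : Tm Γ (ρ ⇒ τ ⇒ ρ)
  | S (δ ρ τ : Ty) : Tm Γ ((δ ⇒ ρ ⇒ τ) ⇒ (δ ⇒ ρ) ⇒ δ ⇒ τ)
  | R (σ : Ty) : Tm Γ ((σ ⇒ σ) ⇒ σ ⇒ Ty.nat ⇒ σ)
  | app {σ τ : Ty} : Tm Γ (σ ⇒ τ) → Tm Γ σ → Tm Γ τ

infixl:90 " ⬝ " => Tm.app

/-- Formulas with free variables in `Γ`: built from equations and inequalities between terms of
type `0` by `⊥`, implication and universal quantification over any finite type. -/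
inductive Fm : Ctx → Type
  | eq {Γ : Ctx} : Tm Γ Ty.nat → Tm Γ Ty.nat → Fm Γ
  | lt {Γ : Ctx} : Tm Γ Ty.nat → Tm Γ Ty.nat → Fm Γ
  | bot {Γ : Ctx} : Fm Γ
  | imp {Γ : Ctx} : Fm Γ → Fm Γ → Fm Γ
  | all {Γ : Ctx} (σ : Ty) : Fm (σ :: Γ) → Fm Γ

/-- Sentences are the formulas without free variables. -/
abbrev Sentence : Type := Fm []

/-- A theory is a set of sentences. -/
abbrev Theory : Type := Set Sentence

/-! ### Renaming and substitution -/

abbrev Ren (Γ Δ : Ctx) : Type := ∀ σ : Ty, Var Γ σ → Var Δ σ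
abbrev Sub (Γ Δ : Ctx) : Type := ∀ σ : Ty, Var Γ σ → Tm Δ σ

def Ren.lift {Γ Δ : Ctx} (r : Ren Γ Δ) (τ : Ty) : Ren (τ :: Γ) (τ :: Δ)
  | _, Var.z => Var.z
  | _, Var.s x => Var.s (r _ x)

def Tm.rename {Γ Δ : Ctx} (r : Ren Γ Δ) : {σ : Ty} → Tm Γ σ → Tm Δ σ
  | _, Tm.var x => Tm.var (r _ x)
  | _, Tm.zero => Tm.zero
  | _, Tm.one => Tm.one
  | _, Tm.add => Tm.add
  | _, Tm.mul => Tm.mul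
  | _, Tm.K ρ τ => Tm.K ρ τ
  | _, Tm.S δ ρ τ => Tm.S δ ρ τ
  | _, Tm.R σ => Tm.R σ
  | _, Tm.app t u => Tm.app (t.rename r) (u.rename r)

def Fm.rename : {Γ Δ : Ctx} → Ren Γ Δ → Fm Γ → Fm Δ
  | _, _, r, Fm.eq t u => Fm.eq (t.rename r) (u.rename r)
  | _, _, r, Fm.lt t u => Fm.lt (t.rename r) (u.rename r)
  | _, _, _, Fm.bot => Fm.bot
  | _, _, r, Fm.imp φ ψ => Fm.imp (φ.rename r) (ψ.rename r)
  | _, _, r, Fm.all σ φ => Fm.all σ (φ.rename (r.lift σ))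

def Sub.lift {Γ Δ : Ctx} (s : Sub Γ Δ) (τ : Ty) : Sub (τ :: Γ) (τ :: Δ)
  | _, Var.z => Tm.var Var.z
  | _, Var.s x => (s _ x).rename (fun _ y => Var.s y)

def Tm.subst {Γ Δ : Ctx} (s : Sub Γ Δ) : {σ : Ty} → Tm Γ σ → Tm Δ σ
  | _, Tm.var x => s _ x
  | _, Tm.zero => Tm.zero
  | _, Tm.one => Tm.one
  | _, Tm.add => Tm.add
  | _, Tm.mul => Tm.mul
  | _, Tm.K ρ τ => Tm.K ρ τ
  | _, Tm.S δ ρ τ => Tm.S δ ρ τ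
  | _, Tm.R σ => Tm.R σ
  | _, Tm.app t u => Tm.app (t.subst s) (u.subst s)

def Fm.subst : {Γ Δ : Ctx} → Sub Γ Δ → Fm Γ → Fm Δ
  | _, _, s, Fm.eq t u => Fm.eq (t.subst s) (u.subst s)
  | _, _, s, Fm.lt t u => Fm.lt (t.subst s) (u.subst s)
  | _, _, _, Fm.bot => Fm.bot
  | _, _, s, Fm.imp φ ψ => Fm.imp (φ.subst s) (ψ.subst s)
  | _, _, s, Fm.all σ φ => Fm.all σ (φ.subst (s.lift σ))

/-- The substitution of `t` for the innermost variable. -/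
def Sub.single {Γ : Ctx} {τ : Ty} (t : Tm Γ τ) : Sub (τ :: Γ) Γ
  | _, Var.z => t
  | _, Var.s x => Tm.var x

/-- `φ.inst t` is `φ(t)`, with `t` substituted for the innermost variable. -/
def Fm.inst {Γ : Ctx} {τ : Ty} (φ : Fm (τ :: Γ)) (t : Tm Γ τ) : Fm Γ := φ.subst (Sub.single t)

/-- A formula regarded as a formula in a context with one more variable. -/
def Fm.shift {Γ : Ctx} (τ : Ty) (φ : Fm Γ) : Fm (τ :: Γ) := φ.rename (fun _ x => Var.s x)

/-- The empty context has no variables. -/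
def Ren.ofEmpty (Γ : Ctx) : Ren [] Γ := fun _ x => nomatch x

/-- A sentence regarded as a formula in any context. -/
def Fm.ofSentence (Γ : Ctx) (φ : Sentence) : Fm Γ := φ.rename (Ren.ofEmpty Γ)

/-- The universal closure. -/
def Fm.close : (Γ : Ctx) → Fm Γ → Sentence
  | [], φ => φ
  | σ :: Γ, φ => Fm.close Γ (Fm.all σ φ)

/-! ### Classical natural deduction with equality at type `0` -/

/-- The negation `φ → ⊥`. -/
def Fm.neg {Γ : Ctx} (φ : Fm Γ) : Fm Γ := Fm.imp φ Fm.bot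

/-- `Derives T H φ`: the formula `φ` is derivable in classical many-sorted predicate logic with
equality at type `0`, from the axioms `T` and the undischarged assumptions `H`. -/
inductive Derives (T : Theory) : {Γ : Ctx} → List (Fm Γ) → Fm Γ → Prop
  | ax {Γ : Ctx} {H : List (Fm Γ)} {φ : Sentence} :
      φ ∈ T → Derives T H (Fm.ofSentence Γ φ)
  | hyp {Γ : Ctx} {H : List (Fm Γ)} {φ : Fm Γ} : φ ∈ H → Derives T H φ
  | impI {Γ : Ctx} {H : List (Fm Γ)} {φ ψ : Fm Γ} :
      Derives T (φ :: H) ψ → Derives T H (Fm.imp φ ψ)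
  | impE {Γ : Ctx} {H : List (Fm Γ)} {φ ψ : Fm Γ} :
      Derives T H (Fm.imp φ ψ) → Derives T H φ → Derives T H ψ
  | raa {Γ : Ctx} {H : List (Fm Γ)} {φ : Fm Γ} :
      Derives T (φ.neg :: H) Fm.bot → Derives T H φ
  | allI {Γ : Ctx} {H : List (Fm Γ)} {σ : Ty} {φ : Fm (σ :: Γ)} :
      Derives T (H.map (Fm.shift σ)) φ → Derives T H (Fm.all σ φ)
  | allE {Γ : Ctx} {H : List (Fm Γ)} {σ : Ty} {φ : Fm (σ :: Γ)} (t : Tm Γ σ) :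
      Derives T H (Fm.all σ φ) → Derives T H (φ.inst t)
  | eqRefl {Γ : Ctx} {H : List (Fm Γ)} (t : Tm Γ Ty.nat) : Derives T H (Fm.eq t t)
  | eqSubst {Γ : Ctx} {H : List (Fm Γ)} {t u : Tm Γ Ty.nat} (φ : Fm (Ty.nat :: Γ)) :
      Derives T H (Fm.eq t u) → Derives T H (φ.inst t) → Derives T H (φ.inst u)

/-- `T` proves the sentence `φ`. -/
def Theory.Proves (T : Theory) (φ : Sentence) : Prop := Derives T [] φ

infix:25 " ⊢ₜ " => Theory.Proves

/-! ### Abbreviations for writing formulas -/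

section Connectives
variable {Γ : Ctx}

def Fm.or (φ ψ : Fm Γ) : Fm Γ := Fm.imp φ.neg ψ
def Fm.and (φ ψ : Fm Γ) : Fm Γ := (Fm.imp φ ψ.neg).neg
def Fm.iff (φ ψ : Fm Γ) : Fm Γ := Fm.and (Fm.imp φ ψ) (Fm.imp ψ φ)
def Fm.ex (σ : Ty) (φ : Fm (σ :: Γ)) : Fm Γ := (Fm.all σ φ.neg).neg

end Connectives

infix:50 " ≐ " => Fm.eq
infix:50 " ≺ " => Fm.lt
prefix:max "∼" => Fm.neg
infixr:35 " ⋏ " => Fm.and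
infixr:30 " ⋎ " => Fm.or
infixr:25 " ⟶ₘ " => Fm.imp
infix:20 " ⟷ₘ " => Fm.iff

/-- Quantifiers whose body may refer to the bound variable by a name. -/
def forallB {Γ : Ctx} (σ : Ty) (φ : Tm (σ :: Γ) σ → Fm (σ :: Γ)) : Fm Γ :=
  Fm.all σ (φ (Tm.var Var.z))
def existsB {Γ : Ctx} (σ : Ty) (φ : Tm (σ :: Γ) σ → Fm (σ :: Γ)) : Fm Γ :=
  Fm.ex σ (φ (Tm.var Var.z))

/-- `Δ` extends `Γ` by further variables; used to insert weakenings. -/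
class Ext (Γ Δ : Ctx) where
  ren : Ren Γ Δ

instance Ext.step {Γ Δ : Ctx} {σ : Ty} [e : Ext Γ Δ] : Ext Γ (σ :: Δ) :=
  ⟨fun _ x => Var.s (e.ren _ x)⟩
instance Ext.refl {Γ : Ctx} : Ext Γ Γ := ⟨fun _ x => x⟩

/-- `⌜t⌝` is the term `t` used in the scope of further quantifiers. -/
def Tm.wk {Γ Δ : Ctx} {σ : Ty} [e : Ext Γ Δ] (t : Tm Γ σ) : Tm Δ σ := t.rename e.ren

notation "⌜" t "⌝" => Tm.wk t

section Abbreviations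
variable {Γ : Ctx}

def Tm.plus (t u : Tm Γ Ty.nat) : Tm Γ Ty.nat := Tm.add ⬝ t ⬝ u
def Tm.times (t u : Tm Γ Ty.nat) : Tm Γ Ty.nat := Tm.mul ⬝ t ⬝ u
/-- The numeral of a natural number. -/
def Tm.num : ℕ → Tm Γ Ty.nat
  | 0 => Tm.zero
  | 1 => Tm.one
  | n + 2 => Tm.plus (Tm.num (n + 1)) Tm.one

infixl:65 " ⊕ₙ " => Tm.plus
infixl:70 " ⊗ₙ " => Tm.times

/-- `t ≤ u` at type `0`. -/
def Fm.le (t u : Tm Γ Ty.nat) : Fm Γ := (t ≺ u) ⋎ (t ≐ u)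

infix:50 " ≼ " => Fm.le

end Abbreviations

/-- Equality at any type: `x z₁ … z_k = y z₁ … z_k` for all `z₁, …, z_k`. -/
def eqAt : {Γ : Ctx} → (τ : Ty) → Tm Γ τ → Tm Γ τ → Fm Γ
  | _, Ty.nat, x, y => x ≐ y
  | _, Ty.arr σ τ, x, y => forallB σ fun z => eqAt τ (⌜x⌝ ⬝ z) (⌜y⌝ ⬝ z)

/-- Formulas without quantifiers (variables of all types are allowed). -/
inductive Fm.IsQF : {Γ : Ctx} → Fm Γ → Prop
  | eq {Γ : Ctx} (t u : Tm Γ Ty.nat) : Fm.IsQF (Fm.eq t u)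
  | lt {Γ : Ctx} (t u : Tm Γ Ty.nat) : Fm.IsQF (Fm.lt t u)
  | bot {Γ : Ctx} : Fm.IsQF (Fm.bot : Fm Γ)
  | imp {Γ : Ctx} {φ ψ : Fm Γ} : Fm.IsQF φ → Fm.IsQF ψ → Fm.IsQF (Fm.imp φ ψ)

/-! ### The fragment of second-order arithmetic -/

/-- Number terms of second-order arithmetic, in its function-based form: built from number
variables, `0`, `1`, `+`, `×` and the application of function variables. -/
inductive Tm.IsL2 {Γ : Ctx} : Tm Γ Ty.nat → Prop
  | var (x : Var Γ Ty.nat) : Tm.IsL2 (Tm.var x)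
  | zero : Tm.IsL2 Tm.zero
  | one : Tm.IsL2 Tm.one
  | plus {t u : Tm Γ Ty.nat} : Tm.IsL2 t → Tm.IsL2 u → Tm.IsL2 (t ⊕ₙ u)
  | times {t u : Tm Γ Ty.nat} : Tm.IsL2 t → Tm.IsL2 u → Tm.IsL2 (t ⊗ₙ u)
  | app (f : Var Γ ty1) {t : Tm Γ Ty.nat} : Tm.IsL2 t → Tm.IsL2 (Tm.var f ⬝ t)

/-- Formulas of the language of second-order arithmetic: only variables of types `0` and `1`. -/
inductive Fm.IsL2 : {Γ : Ctx} → Fm Γ → Prop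
  | eq {Γ : Ctx} {t u : Tm Γ Ty.nat} : t.IsL2 → u.IsL2 → Fm.IsL2 (Fm.eq t u)
  | lt {Γ : Ctx} {t u : Tm Γ Ty.nat} : t.IsL2 → u.IsL2 → Fm.IsL2 (Fm.lt t u)
  | bot {Γ : Ctx} : Fm.IsL2 (Fm.bot : Fm Γ)
  | imp {Γ : Ctx} {φ ψ : Fm Γ} : Fm.IsL2 φ → Fm.IsL2 ψ → Fm.IsL2 (Fm.imp φ ψ)
  | all0 {Γ : Ctx} {φ : Fm (Ty.nat :: Γ)} : Fm.IsL2 φ → Fm.IsL2 (Fm.all Ty.nat φ)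
  | all1 {Γ : Ctx} {φ : Fm (ty1 :: Γ)} : Fm.IsL2 φ → Fm.IsL2 (Fm.all ty1 φ)

/-- Arithmetical formulas: those of second-order arithmetic with number quantifiers only. -/
inductive Fm.IsArith : {Γ : Ctx} → Fm Γ → Prop
  | eq {Γ : Ctx} {t u : Tm Γ Ty.nat} : t.IsL2 → u.IsL2 → Fm.IsArith (Fm.eq t u)
  | lt {Γ : Ctx} {t u : Tm Γ Ty.nat} : t.IsL2 → u.IsL2 → Fm.IsArith (Fm.lt t u)
  | bot {Γ : Ctx} : Fm.IsArith (Fm.bot : Fm Γ)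
  | imp {Γ : Ctx} {φ ψ : Fm Γ} : Fm.IsArith φ → Fm.IsArith ψ → Fm.IsArith (Fm.imp φ ψ)
  | all0 {Γ : Ctx} {φ : Fm (Ty.nat :: Γ)} : Fm.IsArith φ → Fm.IsArith (Fm.all Ty.nat φ)

/-! ## The base theory -/

/-- The ordered semi-ring axioms for `0, 1, <, +, ×`. -/
inductive BasicAxiom : Sentence → Prop
  | add_assoc : BasicAxiom (forallB .nat fun x => forallB .nat fun y => forallB .nat fun z =>
      (⌜x⌝ ⊕ₙ ⌜y⌝) ⊕ₙ z ≐ ⌜x⌝ ⊕ₙ (⌜y⌝ ⊕ₙ z))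
  | add_comm : BasicAxiom (forallB .nat fun x => forallB .nat fun y => ⌜x⌝ ⊕ₙ y ≐ y ⊕ₙ ⌜x⌝)
  | add_zero : BasicAxiom (forallB .nat fun x => x ⊕ₙ Tm.zero ≐ x)
  | mul_assoc : BasicAxiom (forallB .nat fun x => forallB .nat fun y => forallB .nat fun z =>
      (⌜x⌝ ⊗ₙ ⌜y⌝) ⊗ₙ z ≐ ⌜x⌝ ⊗ₙ (⌜y⌝ ⊗ₙ z))
  | mul_comm : BasicAxiom (forallB .nat fun x => forallB .nat fun y => ⌜x⌝ ⊗ₙ y ≐ y ⊗ₙ ⌜x⌝)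
  | mul_zero : BasicAxiom (forallB .nat fun x => x ⊗ₙ Tm.zero ≐ Tm.zero)
  | mul_one : BasicAxiom (forallB .nat fun x => x ⊗ₙ Tm.one ≐ x)
  | mul_add : BasicAxiom (forallB .nat fun x => forallB .nat fun y => forallB .nat fun z =>
      ⌜x⌝ ⊗ₙ (⌜y⌝ ⊕ₙ z) ≐ (⌜x⌝ ⊗ₙ ⌜y⌝) ⊕ₙ (⌜x⌝ ⊗ₙ z))
  | lt_irrefl : BasicAxiom (forallB .nat fun x => ∼(x ≺ x))
  | lt_trans : BasicAxiom (forallB .nat fun x => forallB .nat fun y => forallB .nat fun z =>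
      (⌜x⌝ ≺ ⌜y⌝) ⟶ₘ (⌜y⌝ ≺ z) ⟶ₘ (⌜x⌝ ≺ z))
  | lt_total : BasicAxiom (forallB .nat fun x => forallB .nat fun y =>
      (⌜x⌝ ≺ y) ⋎ (⌜x⌝ ≐ y) ⋎ (y ≺ ⌜x⌝))
  | zero_lt_one : BasicAxiom (Tm.zero ≺ Tm.one)
  | add_lt_add : BasicAxiom (forallB .nat fun x => forallB .nat fun y => forallB .nat fun z =>
      (⌜x⌝ ≺ ⌜y⌝) ⟶ₘ (⌜x⌝ ⊕ₙ z ≺ ⌜y⌝ ⊕ₙ z))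
  | mul_lt_mul : BasicAxiom (forallB .nat fun x => forallB .nat fun y => forallB .nat fun z =>
      (⌜x⌝ ≺ ⌜y⌝) ⟶ₘ (Tm.zero ≺ z) ⟶ₘ (⌜x⌝ ⊗ₙ z ≺ ⌜y⌝ ⊗ₙ z))
  | not_lt_zero : BasicAxiom (forallB .nat fun x => ∼(x ≺ Tm.zero))
  | lt_succ : BasicAxiom (forallB .nat fun x => forallB .nat fun y =>
      (⌜x⌝ ≺ y ⊕ₙ Tm.one) ⟶ₘ (⌜x⌝ ≼ y))

/-- In `A(x, y)`, with `y` (type `τ`) innermost and `x` (type `σ`) next, the variable `y` is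
replaced by `Y x` for a fresh variable `Y` of type `σ → τ`. -/
def choiceSub (Γ : Ctx) (σ τ : Ty) : Sub (τ :: σ :: Γ) (σ :: (σ ⇒ τ) :: Γ)
  | _, Var.z => Tm.var (Var.s Var.z) ⬝ Tm.var Var.z
  | _, Var.s Var.z => Tm.var Var.z
  | _, Var.s (Var.s x) => Tm.var (Var.s (Var.s x))

/-- The sentence `(∀ x^σ ∃ y^τ A(x, y)) → ∃ Y^{σ → τ} ∀ x^σ A(x, Y(x))`, closed universally over
the parameters in `Γ`. -/
def choiceFor (Γ : Ctx) (σ τ : Ty) (A : Fm (τ :: σ :: Γ)) : Sentence :=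
  Fm.close Γ ((Fm.all σ (Fm.ex τ A)) ⟶ₘ
    Fm.ex (σ ⇒ τ) (Fm.all σ (A.subst (choiceSub Γ σ τ))))

/-- In `A(n)`, with `n` innermost, `n` is replaced by `n + 1`. -/
def succSub (Γ : Ctx) : Sub (Ty.nat :: Γ) (Ty.nat :: Γ)
  | _, Var.z => Tm.var Var.z ⊕ₙ Tm.one
  | _, Var.s x => Tm.var (Var.s x)

/-- The induction axiom for `A(n)`, closed universally over the parameters in `Γ`. -/
def inductionFor (Γ : Ctx) (A : Fm (Ty.nat :: Γ)) : Sentence :=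
  Fm.close Γ (A.inst Tm.zero ⟶ₘ
    (Fm.all Ty.nat (A ⟶ₘ A.subst (succSub Γ))) ⟶ₘ Fm.all Ty.nat A)

/-- The axioms of the base theory of higher-order Reverse Mathematics. -/
inductive RCA0omegaAxiom : Sentence → Prop
  | basic {φ : Sentence} : BasicAxiom φ → RCA0omegaAxiom φ
  | combK (ρ τ : Ty) : RCA0omegaAxiom (forallB ρ fun x => forallB τ fun y =>
      eqAt ρ (Tm.K ρ τ ⬝ ⌜x⌝ ⬝ y) ⌜x⌝)
  | combS (δ ρ τ : Ty) : RCA0omegaAxiom (forallB (δ ⇒ ρ ⇒ τ) fun x => forallB (δ ⇒ ρ) fun y =>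
      forallB δ fun z => eqAt τ (Tm.S δ ρ τ ⬝ ⌜x⌝ ⬝ ⌜y⌝ ⬝ z) (⌜x⌝ ⬝ z ⬝ (⌜y⌝ ⬝ z)))
  | rec_zero : RCA0omegaAxiom (forallB ty1 fun f => forallB .nat fun m =>
      Tm.R .nat ⬝ ⌜f⌝ ⬝ m ⬝ Tm.zero ≐ m)
  | rec_succ : RCA0omegaAxiom (forallB ty1 fun f => forallB .nat fun m => forallB .nat fun n =>
      Tm.R .nat ⬝ ⌜f⌝ ⬝ ⌜m⌝ ⬝ (n ⊕ₙ Tm.one) ≐ ⌜f⌝ ⬝ (Tm.R .nat ⬝ ⌜f⌝ ⬝ ⌜m⌝ ⬝ n))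
  | ext (ρ τ : Ty) : RCA0omegaAxiom (forallB ρ fun x => forallB ρ fun y => forallB (ρ ⇒ τ) fun F =>
      eqAt ρ ⌜x⌝ ⌜y⌝ ⟶ₘ eqAt τ (F ⬝ ⌜x⌝) (F ⬝ ⌜y⌝))
  | induction (Γ : Ctx) (A : Fm (Ty.nat :: Γ)) : A.IsQF → RCA0omegaAxiom (inductionFor Γ A)
  | choice (Γ : Ctx) (A : Fm (Ty.nat :: ty1 :: Γ)) :
      A.IsQF → RCA0omegaAxiom (choiceFor Γ ty1 Ty.nat A)

/-- The theory `RCA₀^ω`. -/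
def RCA0omega : Theory := {φ | RCA0omegaAxiom φ}

/-! ## Principles -/

section Sequences
variable {Γ : Ctx}

/-- `f ≤₁ 1`, that is, `f` is an element of Cantor space. -/
def isBinary (f : Tm Γ ty1) : Fm Γ := forallB .nat fun n => ⌜f⌝ ⬝ n ≼ Tm.one

/-- The initial segments of length `N` of `f` and `g` agree. -/
def agree (f g : Tm Γ ty1) (N : Tm Γ Ty.nat) : Fm Γ :=
  forallB .nat fun n => (n ≺ ⌜N⌝) ⟶ₘ (⌜f⌝ ⬝ n ≐ ⌜g⌝ ⬝ n)

/-- `Y` is continuous on Baire space. -/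
def isCont (Y : Tm Γ ty2) : Fm Γ :=
  forallB ty1 fun f => existsB .nat fun N => forallB ty1 fun g =>
    agree ⌜f⌝ g ⌜N⌝ ⟶ₘ (⌜Y⌝ ⬝ ⌜f⌝ ≐ ⌜Y⌝ ⬝ g)

end Sequences

/-- `(∃²)`: there is `φ ≤₂ 1` with `φ(f) = 0 ↔ ∃ n, f(n) = 0` for all `f`. -/
def existsTwo : Sentence :=
  existsB ty2 fun φ =>
    (forallB ty1 fun f => ⌜φ⌝ ⬝ f ≼ Tm.one) ⋏
    (forallB ty1 fun f => (existsB .nat fun n => ⌜f⌝ ⬝ n ≐ Tm.zero) ⟷ₘ (⌜φ⌝ ⬝ f ≐ Tm.zero))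

/-- The classical fan functional: it gives a modulus of uniform continuity on Cantor space for each
functional that is continuous on Baire space. -/
def FF : Sentence :=
  existsB ty3 fun Φ => forallB ty2 fun Y =>
    isCont Y ⟶ₘ forallB ty1 fun f => forallB ty1 fun g =>
      isBinary ⌜f⌝ ⟶ₘ isBinary g ⟶ₘ agree ⌜f⌝ g (⌜Φ⌝ ⬝ ⌜Y⌝) ⟶ₘ (⌜Y⌝ ⬝ ⌜f⌝ ≐ ⌜Y⌝ ⬝ g)

/-- Compactness of Cantor space for the canonical cover `⋃_{f ∈ C} [f̄ G(f)]`. The finite sequence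
of elements of Cantor space has length `k` and entries `F 0, …, F (k - 1)`. -/
def HBUc : Sentence :=
  forallB ty2 fun G => existsB .nat fun k => existsB (Ty.nat ⇒ ty1) fun F =>
    (forallB .nat fun i => (i ≺ ⌜k⌝) ⟶ₘ isBinary (⌜F⌝ ⬝ i)) ⋏
    (forallB ty1 fun f => isBinary f ⟶ₘ existsB .nat fun i =>
      (i ≺ ⌜k⌝) ⋏ agree ⌜f⌝ (⌜F⌝ ⬝ i) (⌜G⌝ ⬝ (⌜F⌝ ⬝ i)))

/-! ### Binary trees

The finite binary sequence `⟨b₀, …, b_{n-1}⟩` is coded by the number with binary digits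
`1 b₀ … b_{n-1}`: the empty sequence has code `1`, and appending `b` to the sequence with code `s`
gives the code `2 s + b`. Every positive number codes exactly one sequence. -/

section Trees
variable {Γ : Ctx}

/-- `s` is an element of the set with characteristic function `T`. -/
def mem (s : Tm Γ Ty.nat) (T : Tm Γ ty1) : Fm Γ := T ⬝ s ≐ Tm.one

/-- The code `2 s + b`. -/
def snoc (s b : Tm Γ Ty.nat) : Tm Γ Ty.nat := (s ⊕ₙ s) ⊕ₙ b

/-- `T` is a binary tree: if it contains a sequence extended by one digit, it contains the
sequence. -/
def isTree (T : Tm Γ ty1) : Fm Γ :=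
  forallB .nat fun s => forallB .nat fun b =>
    (Tm.zero ≺ ⌜s⌝) ⟶ₘ (b ≼ Tm.one) ⟶ₘ mem (snoc ⌜s⌝ b) ⌜T⌝ ⟶ₘ mem ⌜s⌝ ⌜T⌝

/-- `T` has infinitely many elements. -/
def isInfinite (T : Tm Γ ty1) : Fm Γ :=
  forallB .nat fun n => existsB .nat fun s => (⌜n⌝ ≺ s) ⋏ mem s ⌜T⌝

/-- `f` is a path through `T`: all `f̄ n` belong to `T`, where `h` lists the codes of the initial
segments of `f`. -/
def isPath (f T : Tm Γ ty1) : Fm Γ :=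
  isBinary f ⋏ existsB ty1 fun h =>
    (h ⬝ Tm.zero ≐ Tm.one) ⋏
    (forallB .nat fun n => ⌜h⌝ ⬝ (n ⊕ₙ Tm.one) ≐ snoc (⌜h⌝ ⬝ n) (⌜f⌝ ⬝ n)) ⋏
    (forallB .nat fun n => mem (⌜h⌝ ⬝ n) ⌜T⌝)

end Trees

/-- Weak König's lemma: every infinite binary tree has a path. -/
def WKL : Sentence :=
  forallB ty1 fun T => isTree T ⟶ₘ isInfinite T ⟶ₘ existsB ty1 fun f => isPath f ⌜T⌝

/-- Arithmetical comprehension: each arithmetical formula `A(n)`, with parameters, has a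
characteristic function. -/
inductive ACAAxiom : Sentence → Prop
  | intro (Γ : Ctx) (A : Fm (Ty.nat :: Γ)) : A.IsArith → ACAAxiom (Fm.close Γ
      (existsB ty1 fun f => isBinary f ⋏ Fm.all Ty.nat
        (mem (Tm.var Var.z) ⌜f⌝ ⟷ₘ
          A.rename (Ren.lift (fun _ x => Var.s x) Ty.nat))))

/-- The schema of arithmetical comprehension. -/
def ACA : Theory := {φ | ACAAxiom φ}

/-! ### Real numbers

A rational number is a signed quotient of natural numbers, coded by a number; a real number is
represented by a sequence `q` of codes with `|q n - q (n + i)| < 1 / 2 ^ n` for all `n` and `i`. -/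

section Reals
variable {Γ : Ctx}

/-- The number `c` is the code of the rational `(a - b) / (d + 1)`, where one of `a`, `b` is `0`:
`c` is the Cantor pair of `u` and `d`, and `u` is `2 a`, or `2 b - 1` with `b > 0`. -/
def isRat (c a b d : Tm Γ Ty.nat) : Fm Γ :=
  existsB .nat fun u =>
    (⌜c⌝ ⊕ₙ ⌜c⌝ ≐ ((u ⊕ₙ ⌜d⌝) ⊗ₙ (u ⊕ₙ ⌜d⌝ ⊕ₙ Tm.one)) ⊕ₙ (u ⊕ₙ u)) ⋏
    (((u ≐ ⌜a⌝ ⊕ₙ ⌜a⌝) ⋏ (⌜b⌝ ≐ Tm.zero)) ⋎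
      ((u ⊕ₙ Tm.one ≐ ⌜b⌝ ⊕ₙ ⌜b⌝) ⋏ (⌜a⌝ ≐ Tm.zero)))

/-- For codes `c₁, c₂, c₃` of rationals `q₁, q₂, q₃` and a number `p > 0`:
`q₁ + k / p < q₂ + q₃ + l / p`. With `qᵢ = (aᵢ - bᵢ) / Dᵢ` and `Dᵢ = dᵢ + 1`, this is
multiplied by `p D₁ D₂ D₃` and stated without subtraction. -/
def ratLt (c₁ k c₂ c₃ l p : Tm Γ Ty.nat) : Fm Γ :=
  existsB .nat fun a₁ => existsB .nat fun b₁ => existsB .nat fun d₁ =>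
  existsB .nat fun a₂ => existsB .nat fun b₂ => existsB .nat fun d₂ =>
  existsB .nat fun a₃ => existsB .nat fun b₃ => existsB .nat fun d₃ =>
    isRat ⌜c₁⌝ ⌜a₁⌝ ⌜b₁⌝ ⌜d₁⌝ ⋏ isRat ⌜c₂⌝ ⌜a₂⌝ ⌜b₂⌝ ⌜d₂⌝ ⋏ isRat ⌜c₃⌝ ⌜a₃⌝ ⌜b₃⌝ d₃ ⋏
    ((⌜p⌝ ⊗ₙ ⌜a₁⌝ ⊗ₙ (⌜d₂⌝ ⊕ₙ Tm.one) ⊗ₙ (d₃ ⊕ₙ Tm.one)) ⊕ₙ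
      (⌜p⌝ ⊗ₙ ⌜b₂⌝ ⊗ₙ (⌜d₁⌝ ⊕ₙ Tm.one) ⊗ₙ (d₃ ⊕ₙ Tm.one)) ⊕ₙ
      (⌜p⌝ ⊗ₙ ⌜b₃⌝ ⊗ₙ (⌜d₁⌝ ⊕ₙ Tm.one) ⊗ₙ (⌜d₂⌝ ⊕ₙ Tm.one)) ⊕ₙ
      (⌜k⌝ ⊗ₙ (⌜d₁⌝ ⊕ₙ Tm.one) ⊗ₙ (⌜d₂⌝ ⊕ₙ Tm.one) ⊗ₙ (d₃ ⊕ₙ Tm.one)) ≺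
     (⌜p⌝ ⊗ₙ ⌜b₁⌝ ⊗ₙ (⌜d₂⌝ ⊕ₙ Tm.one) ⊗ₙ (d₃ ⊕ₙ Tm.one)) ⊕ₙ
      (⌜p⌝ ⊗ₙ ⌜a₂⌝ ⊗ₙ (⌜d₁⌝ ⊕ₙ Tm.one) ⊗ₙ (d₃ ⊕ₙ Tm.one)) ⊕ₙ
      (⌜p⌝ ⊗ₙ ⌜a₃⌝ ⊗ₙ (⌜d₁⌝ ⊕ₙ Tm.one) ⊗ₙ (⌜d₂⌝ ⊕ₙ Tm.one)) ⊕ₙ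
      (⌜l⌝ ⊗ₙ (⌜d₁⌝ ⊕ₙ Tm.one) ⊗ₙ (⌜d₂⌝ ⊕ₙ Tm.one) ⊗ₙ (d₃ ⊕ₙ Tm.one)))

/-- The function `m ↦ m + m`, as the combinator term `Σ (+) (Σ Π Π)`. -/
def double : Tm Γ ty1 :=
  Tm.S .nat .nat .nat ⬝ Tm.add ⬝ (Tm.S .nat ty1 .nat ⬝ Tm.K .nat ty1 ⬝ Tm.K .nat .nat)

/-- The power `2 ^ n`, by iteration of `double`. -/
def twoPow (n : Tm Γ Ty.nat) : Tm Γ Ty.nat := Tm.R .nat ⬝ double ⬝ Tm.one ⬝ n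

/-- The code of the rational number `0`. -/
def ratZero : Tm Γ Ty.nat := Tm.zero

/-- The code of the rational number `1`: the pair of `u = 2` and `d = 0`. -/
def ratOne : Tm Γ Ty.nat := Tm.num 5

/-- `x ∈ ℝ`: `|x n - x (n + i)| < 1 / 2 ^ n` for all `n` and `i`. -/
def isReal (x : Tm Γ ty1) : Fm Γ :=
  forallB .nat fun n => forallB .nat fun i =>
    ratLt (⌜x⌝ ⬝ ⌜n⌝) Tm.zero (⌜x⌝ ⬝ (⌜n⌝ ⊕ₙ i)) ratZero Tm.one (twoPow ⌜n⌝) ⋏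
    ratLt (⌜x⌝ ⬝ (⌜n⌝ ⊕ₙ i)) Tm.zero (⌜x⌝ ⬝ ⌜n⌝) ratZero Tm.one (twoPow ⌜n⌝)

/-- `x < y` for real numbers: `x n + 2 / 2 ^ n < y n` for some `n`. -/
def realLt (x y : Tm Γ ty1) : Fm Γ :=
  existsB .nat fun n => ratLt (⌜x⌝ ⬝ n) (Tm.num 2) (⌜y⌝ ⬝ n) ratZero Tm.zero (twoPow n)

/-- `x = y` for real numbers: `|x n - y n| ≤ 2 / 2 ^ n` for all `n`. -/
def realEq (x y : Tm Γ ty1) : Fm Γ :=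
  forallB .nat fun n =>
    ∼(ratLt (⌜x⌝ ⬝ n) (Tm.num 2) (⌜y⌝ ⬝ n) ratZero Tm.zero (twoPow n)) ⋏
    ∼(ratLt (⌜y⌝ ⬝ n) (Tm.num 2) (⌜x⌝ ⬝ n) ratZero Tm.zero (twoPow n))

/-- `x < y + z` for real numbers, where the sum is represented by `n ↦ y (n + 1) + z (n + 1)`. -/
def realLtAdd (x y z : Tm Γ ty1) : Fm Γ :=
  existsB .nat fun n => ratLt (⌜x⌝ ⬝ n) (Tm.num 2)
    (⌜y⌝ ⬝ (n ⊕ₙ Tm.one)) (⌜z⌝ ⬝ (n ⊕ₙ Tm.one)) Tm.zero (twoPow n)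

/-- The real number with constant representing sequence `c`. -/
def realConst (c : Tm Γ Ty.nat) : Tm Γ ty1 := Tm.K .nat .nat ⬝ c

/-- `x` is a real number in the unit interval `[0, 1]`. -/
def inUnitInterval (x : Tm Γ ty1) : Fm Γ :=
  isReal x ⋏ ∼(realLt x (realConst ratZero)) ⋏ ∼(realLt (realConst ratOne) x)

/-- `x` lies in the open interval `(y - r, y + r)`. -/
def inInterval (x y r : Tm Γ ty1) : Fm Γ := realLtAdd y x r ⋏ realLtAdd x y r

/-- `Ψ` represents a function from the real numbers to the positive real numbers. -/
def isPosRealFun (Ψ : Tm Γ (ty1 ⇒ ty1)) : Fm Γ :=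
  (forallB ty1 fun x => isReal x ⟶ₘ
    (isReal (⌜Ψ⌝ ⬝ x) ⋏ realLt (realConst ratZero) (⌜Ψ⌝ ⬝ x))) ⋏
  (forallB ty1 fun x => forallB ty1 fun y => isReal ⌜x⌝ ⟶ₘ isReal y ⟶ₘ realEq ⌜x⌝ y ⟶ₘ
    realEq (⌜Ψ⌝ ⬝ ⌜x⌝) (⌜Ψ⌝ ⬝ y))

end Reals

/-- The Heine–Borel theorem for uncountable covers: for each `Ψ : ℝ → ℝ⁺` there are finitely many
`Y 0, …, Y (k - 1)` in `[0, 1]` such that the intervals `(Y i - Ψ (Y i), Y i + Ψ (Y i))`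
cover `[0, 1]`. -/
def HBU : Sentence :=
  forallB (ty1 ⇒ ty1) fun Ψ => isPosRealFun Ψ ⟶ₘ
    existsB .nat fun k => existsB (Ty.nat ⇒ ty1) fun Y =>
      (forallB .nat fun i => (i ≺ ⌜k⌝) ⟶ₘ inUnitInterval (⌜Y⌝ ⬝ i)) ⋏
      (forallB ty1 fun x => inUnitInterval x ⟶ₘ existsB .nat fun i =>
        (i ≺ ⌜k⌝) ⋏ inInterval ⌜x⌝ (⌜Y⌝ ⬝ i) (⌜Ψ⌝ ⬝ (⌜Y⌝ ⬝ i)))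

end HOA

namespace HOA

/-! ## Renaming and substitution -/

/-! Provability is replaced by truth in models. A sentence true in every extensional model of
`RCA0omega` in which `=` is equality is provable (`RCA0omega.proves_of_models`): an unprovable
sentence fails in a structure of terms built by a Henkin construction, and the extensionality axioms
allow that structure to be divided by pointwise equality. Soundness turns the two hypotheses on `X`
into implications inside a model, namely from `(∃²)` to `X`, through `ACA_of_existsTwo`, and from
`X` to `WKL`.

In a model each of the three disjunctions is equivalent to `WKL`. The direction from `WKL` is a case
distinction on `(∃²)`. If `(∃²)` fails, Grilliot's trick (`existsTwo_of_seq`) makes every functional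
continuous along Cantor space; the usual compactness argument gives `HBUc` (`HBUc_of_cont`), and
binary expansions give `HBU` (`HBU_of_HBUc`). If `(∃²)` holds, then so does `X`; moreover number
quantifiers are decidable, so a modulus of uniform continuity, which exists by `WKL`, can be
searched for (`FF_of_existsTwo`).

Conversely, suppose that an infinite tree has no path. Quantifier-free choice yields a functional
that finds for each `f` an initial segment outside the tree. Under `HBUc` it defines a cover whose
finite subcover bounds the lengths of sequences in the tree. Under `FF` its least version is
continuous, hence bounded on Cantor space. `HBU` needs more, because the radius must depend on the
real number only and not on its representation. The nodes of the tree are placed as dyadic intervals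
in `[1/2, 1]`, and the radius at a point is half the size of the largest neighbourhood lying in a
pair of adjacent intervals outside the tree. It is Lipschitz, hence well defined on reals, and
positive because there is no path (`exists_good`). A finite subcover then excludes long sequences.

The numbers of a model may be nonstandard, and induction is available only for predicates with a
characteristic function. Hence the explicit combinator terms, the bounded searches, and the ordered
field `Frac`, in which inequalities are checked. -/

theorem Ren.lift_comp {Γ Δ Θ : Ctx} (r : Ren Γ Δ) (r' : Ren Δ Θ) (τ : Ty) :
    (fun σ x => r'.lift τ σ (r.lift τ σ x)) = Ren.lift (fun σ x => r' σ (r σ x)) τ := by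
  funext σ x; cases x <;> rfl

theorem Ren.lift_id {Γ : Ctx} (τ : Ty) :
    Ren.lift (fun σ (x : Var Γ σ) => x) τ = fun _ x => x := by
  funext σ x; cases x <;> rfl

theorem Tm.rename_rename {Γ Δ Θ : Ctx} (r : Ren Γ Δ) (r' : Ren Δ Θ) {σ : Ty} (t : Tm Γ σ) :
    (t.rename r).rename r' = t.rename (fun σ x => r' σ (r σ x)) := by
  induction t <;> simp_all [Tm.rename]

theorem Tm.rename_id {Γ : Ctx} {σ : Ty} (t : Tm Γ σ) : t.rename (fun _ x => x) = t := by
  induction t <;> simp_all [Tm.rename]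

theorem Tm.subst_rename {Γ Δ Θ : Ctx} (r : Ren Γ Δ) (s : Sub Δ Θ) {σ : Ty} (t : Tm Γ σ) :
    (t.rename r).subst s = t.subst (fun σ x => s σ (r σ x)) := by
  induction t <;> simp_all [Tm.rename, Tm.subst]

theorem Tm.rename_subst {Γ Δ Θ : Ctx} (s : Sub Γ Δ) (r : Ren Δ Θ) {σ : Ty} (t : Tm Γ σ) :
    (t.subst s).rename r = t.subst (fun σ x => (s σ x).rename r) := by
  induction t <;> simp_all [Tm.rename, Tm.subst]

theorem Tm.subst_subst {Γ Δ Θ : Ctx} (s : Sub Γ Δ) (s' : Sub Δ Θ) {σ : Ty} (t : Tm Γ σ) :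
    (t.subst s).subst s' = t.subst (fun σ x => (s σ x).subst s') := by
  induction t <;> simp_all [Tm.subst]

theorem Tm.subst_var {Γ : Ctx} {σ : Ty} (t : Tm Γ σ) : t.subst (fun _ x => Tm.var x) = t := by
  induction t <;> simp_all [Tm.subst]

theorem Fm.rename_rename {Γ Δ Θ : Ctx} (r : Ren Γ Δ) (r' : Ren Δ Θ) (φ : Fm Γ) :
    (φ.rename r).rename r' = φ.rename (fun σ x => r' σ (r σ x)) := by
  induction φ generalizing Δ Θ <;>
    simp_all [Fm.rename, Tm.rename_rename, Ren.lift_comp]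

theorem Fm.rename_id {Γ : Ctx} (φ : Fm Γ) : φ.rename (fun _ x => x) = φ := by
  induction φ <;> simp_all [Fm.rename, Tm.rename_id, Ren.lift_id]

theorem Sub.lift_comp_ren {Γ Δ Θ : Ctx} (r : Ren Γ Δ) (s : Sub Δ Θ) (τ : Ty) :
    (fun σ x => s.lift τ σ (r.lift τ σ x)) = Sub.lift (fun σ x => s σ (r σ x)) τ := by
  funext σ x; cases x <;> rfl

theorem Fm.subst_rename {Γ Δ Θ : Ctx} (r : Ren Γ Δ) (s : Sub Δ Θ) (φ : Fm Γ) :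
    (φ.rename r).subst s = φ.subst (fun σ x => s σ (r σ x)) := by
  induction φ generalizing Δ Θ <;>
    simp_all [Fm.rename, Fm.subst, Tm.subst_rename, Sub.lift_comp_ren]

theorem Sub.lift_rename {Γ Δ Θ : Ctx} (s : Sub Γ Δ) (r : Ren Δ Θ) (τ : Ty) :
    (fun σ x => (s.lift τ σ x).rename (r.lift τ)) =
      Sub.lift (fun σ x => (s σ x).rename r) τ := by
  funext σ x
  cases x
  · rfl
  · simp only [Sub.lift, Tm.rename_rename, Ren.lift]

theorem Fm.rename_subst {Γ Δ Θ : Ctx} (s : Sub Γ Δ) (r : Ren Δ Θ) (φ : Fm Γ) :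
    (φ.subst s).rename r = φ.subst (fun σ x => (s σ x).rename r) := by
  induction φ generalizing Δ Θ <;>
    simp_all [Fm.rename, Fm.subst, Tm.rename_subst, Sub.lift_rename]

theorem Sub.lift_subst {Γ Δ Θ : Ctx} (s : Sub Γ Δ) (s' : Sub Δ Θ) (τ : Ty) :
    (fun σ x => (s.lift τ σ x).subst (s'.lift τ)) =
      Sub.lift (fun σ x => (s σ x).subst s') τ := by
  funext σ x
  cases x
  · rfl
  · simp only [Sub.lift, Tm.subst_rename, Tm.rename_subst]

theorem Fm.subst_subst {Γ Δ Θ : Ctx} (s : Sub Γ Δ) (s' : Sub Δ Θ) (φ : Fm Γ) :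
    (φ.subst s).subst s' = φ.subst (fun σ x => (s σ x).subst s') := by
  induction φ generalizing Δ Θ <;>
    simp_all [Fm.subst, Tm.subst_subst, Sub.lift_subst]

theorem Sub.lift_var {Γ : Ctx} (τ : Ty) :
    Sub.lift (fun σ (x : Var Γ σ) => Tm.var x) τ = fun _ x => Tm.var x := by
  funext σ x; cases x <;> rfl

theorem Fm.subst_var {Γ : Ctx} (φ : Fm Γ) : φ.subst (fun _ x => Tm.var x) = φ := by
  induction φ <;> simp_all [Fm.subst, Tm.subst_var, Sub.lift_var]

theorem Fm.inst_rename {Γ Δ : Ctx} {τ : Ty} (φ : Fm (τ :: Γ)) (t : Tm Γ τ) (r : Ren Γ Δ) :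
    (φ.inst t).rename r = (φ.rename (r.lift τ)).inst (t.rename r) := by
  rw [Fm.inst, Fm.inst, Fm.rename_subst, Fm.subst_rename]
  congr 1; funext σ x; cases x <;> rfl

theorem Fm.shift_rename {Γ Δ : Ctx} {τ : Ty} (φ : Fm Γ) (r : Ren Γ Δ) :
    (φ.shift τ).rename (r.lift τ) = (φ.rename r).shift τ := by
  rw [Fm.shift, Fm.shift, Fm.rename_rename, Fm.rename_rename]; rfl

theorem Fm.ofSentence_rename {Γ Δ : Ctx} (φ : Sentence) (r : Ren Γ Δ) :
    (φ.ofSentence Γ).rename r = φ.ofSentence Δ := by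
  rw [Fm.ofSentence, Fm.ofSentence, Fm.rename_rename]
  congr 1; funext σ x; cases x

theorem Fm.ofSentence_nil (φ : Sentence) : φ.ofSentence [] = φ := by
  rw [Fm.ofSentence]
  convert Fm.rename_id φ using 2
  funext σ x; cases x

/-! ## Structures and satisfaction -/

/-- A structure for the language of higher-order arithmetic. The equality of type `0` is
interpreted by a relation `eqv`. -/
structure Struc where
  C : Ty → Type
  app : ∀ {σ τ : Ty}, C (σ ⇒ τ) → C σ → C τ
  zero : C Ty.nat
  one : C Ty.nat
  add : C (Ty.nat ⇒ Ty.nat ⇒ Ty.nat)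
  mul : C (Ty.nat ⇒ Ty.nat ⇒ Ty.nat)
  K (ρ τ : Ty) : C (ρ ⇒ τ ⇒ ρ)
  S (δ ρ τ : Ty) : C ((δ ⇒ ρ ⇒ τ) ⇒ (δ ⇒ ρ) ⇒ δ ⇒ τ)
  R (σ : Ty) : C ((σ ⇒ σ) ⇒ σ ⇒ Ty.nat ⇒ σ)
  eqv : C Ty.nat → C Ty.nat → Prop
  lt : C Ty.nat → C Ty.nat → Prop

/-- Assignments of values to the variables of a context. -/
abbrev Struc.Env (M : Struc) (Γ : Ctx) : Type := ∀ σ : Ty, Var Γ σ → M.C σ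

section
variable {M : Struc}

def Env.cons {Γ : Ctx} {τ : Ty} (a : M.C τ) (e : M.Env Γ) : M.Env (τ :: Γ)
  | _, Var.z => a
  | _, Var.s x => e _ x

def Env.nil : M.Env [] := fun _ x => nomatch x

def Tm.eval {Γ : Ctx} (e : M.Env Γ) : {σ : Ty} → Tm Γ σ → M.C σ
  | _, Tm.var x => e _ x
  | _, Tm.zero => M.zero
  | _, Tm.one => M.one
  | _, Tm.add => M.add
  | _, Tm.mul => M.mul
  | _, Tm.K ρ τ => M.K ρ τ
  | _, Tm.S δ ρ τ => M.S δ ρ τ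
  | _, Tm.R σ => M.R σ
  | _, Tm.app t u => M.app (t.eval e) (u.eval e)

def Fm.Sat : {Γ : Ctx} → M.Env Γ → Fm Γ → Prop
  | _, e, Fm.eq t u => M.eqv (t.eval e) (u.eval e)
  | _, e, Fm.lt t u => M.lt (t.eval e) (u.eval e)
  | _, _, Fm.bot => False
  | _, e, Fm.imp φ ψ => φ.Sat e → ψ.Sat e
  | _, e, Fm.all σ φ => ∀ a : M.C σ, φ.Sat (Env.cons a e)

theorem Tm.eval_rename {Γ Δ : Ctx} (r : Ren Γ Δ) (e : M.Env Δ) {σ : Ty} (t : Tm Γ σ) :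
    (t.rename r).eval e = t.eval (fun σ x => e σ (r σ x)) := by
  induction t <;> simp_all [Tm.rename, Tm.eval]

theorem Tm.eval_subst {Γ Δ : Ctx} (s : Sub Γ Δ) (e : M.Env Δ) {σ : Ty} (t : Tm Γ σ) :
    (t.subst s).eval e = t.eval (fun σ x => (s σ x).eval e) := by
  induction t <;> simp_all [Tm.subst, Tm.eval]

theorem Env.cons_lift {Γ Δ : Ctx} (r : Ren Γ Δ) (e : M.Env Δ) {τ : Ty} (a : M.C τ) :
    (fun σ x => Env.cons a e σ (r.lift τ σ x)) = Env.cons a (fun σ x => e σ (r σ x)) := by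
  funext σ x; cases x <;> rfl

theorem Env.cons_sub_lift {Γ Δ : Ctx} (s : Sub Γ Δ) (e : M.Env Δ) {τ : Ty} (a : M.C τ) :
    (fun σ x => (s.lift τ σ x).eval (Env.cons a e)) =
      Env.cons a (fun σ x => (s σ x).eval e) := by
  funext σ x
  cases x
  · rfl
  · simp only [Sub.lift, Tm.eval_rename, Env.cons]

theorem Fm.sat_rename {Γ Δ : Ctx} (r : Ren Γ Δ) (e : M.Env Δ) (φ : Fm Γ) :
    (φ.rename r).Sat e ↔ φ.Sat (fun σ x => e σ (r σ x)) := by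
  induction φ generalizing Δ <;>
    simp_all [Fm.rename, Fm.Sat, Tm.eval_rename, Env.cons_lift]

theorem Fm.sat_subst {Γ Δ : Ctx} (s : Sub Γ Δ) (e : M.Env Δ) (φ : Fm Γ) :
    (φ.subst s).Sat e ↔ φ.Sat (fun σ x => (s σ x).eval e) := by
  induction φ generalizing Δ <;>
    simp_all [Fm.subst, Fm.Sat, Tm.eval_subst, Env.cons_sub_lift]

theorem Fm.sat_inst {Γ : Ctx} {τ : Ty} (φ : Fm (τ :: Γ)) (t : Tm Γ τ) (e : M.Env Γ) :
    (φ.inst t).Sat e ↔ φ.Sat (Env.cons (t.eval e) e) := by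
  rw [Fm.inst, Fm.sat_subst]
  apply iff_of_eq; congr 1; funext σ x; cases x <;> rfl

theorem Fm.sat_shift {Γ : Ctx} {τ : Ty} (φ : Fm Γ) (a : M.C τ) (e : M.Env Γ) :
    (φ.shift τ).Sat (Env.cons a e) ↔ φ.Sat e := by
  rw [Fm.shift, Fm.sat_rename]; rfl

theorem Env.eq_nil (e : M.Env []) : e = Env.nil := by
  funext σ x; cases x

theorem Fm.sat_ofSentence {Γ : Ctx} (φ : Sentence) (e : M.Env Γ) :
    (φ.ofSentence Γ).Sat e ↔ φ.Sat (Env.nil (M := M)) := by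
  rw [Fm.ofSentence, Fm.sat_rename, Env.eq_nil (fun σ x => e σ (Ren.ofEmpty Γ σ x))]

end

/-- `M` satisfies the sentence `φ`. -/
def Struc.Models (M : Struc) (φ : Sentence) : Prop := φ.Sat (Env.nil (M := M))

theorem Derives.sound {M : Struc} (hM : ∀ a b, M.eqv a b ↔ a = b) {T : Theory}
    (hT : ∀ φ ∈ T, M.Models φ) {Γ : Ctx} {H : List (Fm Γ)} {φ : Fm Γ} (h : Derives T H φ) :
    ∀ e : M.Env Γ, (∀ ψ ∈ H, ψ.Sat e) → φ.Sat e := by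
  induction h with
  | ax h => intro e _; rw [Fm.sat_ofSentence]; exact hT _ h
  | hyp h => intro e he; exact he _ h
  | impI _ ih =>
    intro e he h
    exact ih e (by simpa using ⟨h, he⟩)
  | impE _ _ ih₁ ih₂ => intro e he; exact ih₁ e he (ih₂ e he)
  | raa _ ih =>
    intro e he
    by_contra h
    exact ih e (by
      intro ψ hψ
      rcases List.mem_cons.1 hψ with rfl | hψ
      · exact h
      · exact he _ hψ)
  | allI _ ih =>
    intro e he a
    refine ih _ ?_
    intro ψ hψ
    obtain ⟨χ, hχ, rfl⟩ := List.mem_map.1 hψ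
    rw [Fm.sat_shift]; exact he _ hχ
  | allE t _ ih => intro e he; rw [Fm.sat_inst]; exact ih e he _
  | eqRefl t => intro e _; exact (hM _ _).2 rfl
  | eqSubst φ _ _ ih₁ ih₂ =>
    intro e he
    have h₁ := (hM _ _).1 (ih₁ e he)
    have h₂ := ih₂ e he
    rw [Fm.sat_inst] at h₂ ⊢
    rwa [← h₁]


/-! ### Completeness by a Henkin construction. -/

/-! ## Countability of the syntax -/

def Ty.code : Ty → ℕ
  | Ty.nat => 0
  | Ty.arr σ τ => Nat.pair σ.code τ.code + 1

theorem Ty.code_injective : Function.Injective Ty.code := by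
  intro σ
  induction σ with
  | nat => intro τ h; cases τ <;> simp_all [Ty.code]
  | arr σ₁ σ₂ ih₁ ih₂ =>
    intro τ h
    cases τ with
    | nat => simp [Ty.code] at h
    | arr τ₁ τ₂ =>
      simp only [Ty.code, Nat.add_right_cancel_iff, Nat.pair_eq_pair] at h
      rw [ih₁ h.1, ih₂ h.2]

instance : Countable Ty := Ty.code_injective.countable

instance : Nonempty Ty := ⟨Ty.nat⟩

def Var.code : {Γ : Ctx} → {σ : Ty} → Var Γ σ → ℕ
  | _, _, Var.z => 0
  | _, _, Var.s x => x.code + 1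

theorem Var.code_injective {Γ : Ctx} {σ σ' : Ty} (x : Var Γ σ) (y : Var Γ σ')
    (h : x.code = y.code) : (⟨σ, x⟩ : Σ σ, Var Γ σ) = ⟨σ', y⟩ := by
  induction x with
  | z => cases y <;> simp_all [Var.code]
  | s x ih =>
    cases y with
    | z => simp [Var.code] at h
    | s y =>
      have := ih y (by simpa [Var.code] using h)
      cases this; rfl

def Tm.code {Γ : Ctx} : {σ : Ty} → Tm Γ σ → ℕ
  | _, Tm.var x => Nat.pair 0 x.code
  | _, Tm.zero => Nat.pair 1 0
  | _, Tm.one => Nat.pair 2 0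
  | _, Tm.add => Nat.pair 3 0
  | _, Tm.mul => Nat.pair 4 0
  | _, Tm.K ρ τ => Nat.pair 5 (Nat.pair ρ.code τ.code)
  | _, Tm.S δ ρ τ => Nat.pair 6 (Nat.pair δ.code (Nat.pair ρ.code τ.code))
  | _, Tm.R σ => Nat.pair 7 σ.code
  | _, Tm.app t u => Nat.pair 8 (Nat.pair t.code u.code)

/-- The code of an application does not record the type of the argument, so the induction must
recover the type together with the term. For variables the position in the context determines the
type. -/
theorem Tm.code_injective {Γ : Ctx} {σ σ' : Ty} (t : Tm Γ σ) (u : Tm Γ σ')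
    (h : t.code = u.code) : (⟨σ, t⟩ : Σ σ, Tm Γ σ) = ⟨σ', u⟩ := by
  induction t generalizing σ' with
  | var x =>
    cases u <;> simp only [Tm.code, Nat.pair_eq_pair] at h <;> try omega
    have := Var.code_injective _ _ h.2
    cases this; rfl
  | zero => cases u <;> simp only [Tm.code, Nat.pair_eq_pair] at h <;> first | omega | rfl
  | one => cases u <;> simp only [Tm.code, Nat.pair_eq_pair] at h <;> first | omega | rfl
  | add => cases u <;> simp only [Tm.code, Nat.pair_eq_pair] at h <;> first | omega | rfl
  | mul => cases u <;> simp only [Tm.code, Nat.pair_eq_pair] at h <;> first | omega | rfl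
  | K ρ τ =>
    cases u <;> simp only [Tm.code, Nat.pair_eq_pair] at h <;> try omega
    cases Ty.code_injective h.2.1; cases Ty.code_injective h.2.2; rfl
  | S δ ρ τ =>
    cases u <;> simp only [Tm.code, Nat.pair_eq_pair] at h <;> try omega
    cases Ty.code_injective h.2.1; cases Ty.code_injective h.2.2.1
    cases Ty.code_injective h.2.2.2; rfl
  | R σ =>
    cases u <;> simp only [Tm.code, Nat.pair_eq_pair] at h <;> try omega
    cases Ty.code_injective h.2; rfl
  | app t₁ t₂ ih₁ ih₂ =>
    cases u <;> simp only [Tm.code, Nat.pair_eq_pair] at h <;> try omega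
    cases ih₁ _ h.2.1; cases ih₂ _ h.2.2; rfl

def Fm.code : {Γ : Ctx} → Fm Γ → ℕ
  | _, Fm.eq t u => Nat.pair 0 (Nat.pair t.code u.code)
  | _, Fm.lt t u => Nat.pair 1 (Nat.pair t.code u.code)
  | _, Fm.bot => Nat.pair 2 0
  | _, Fm.imp φ ψ => Nat.pair 3 (Nat.pair φ.code ψ.code)
  | _, Fm.all σ φ => Nat.pair 4 (Nat.pair σ.code φ.code)

theorem Fm.code_injective {Γ : Ctx} : Function.Injective (Fm.code (Γ := Γ)) := by
  intro φ
  induction φ with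
  | eq t u =>
    intro ψ h
    cases ψ <;> simp only [Fm.code, Nat.pair_eq_pair] at h <;> try omega
    cases Tm.code_injective _ _ h.2.1; cases Tm.code_injective _ _ h.2.2; rfl
  | lt t u =>
    intro ψ h
    cases ψ <;> simp only [Fm.code, Nat.pair_eq_pair] at h <;> try omega
    cases Tm.code_injective _ _ h.2.1; cases Tm.code_injective _ _ h.2.2; rfl
  | bot =>
    intro ψ h
    cases ψ <;> simp only [Fm.code, Nat.pair_eq_pair] at h <;> first | omega | rfl
  | imp φ₁ φ₂ ih₁ ih₂ =>
    intro ψ h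
    cases ψ <;> simp only [Fm.code, Nat.pair_eq_pair] at h <;> try omega
    cases ih₁ h.2.1; cases ih₂ h.2.2; rfl
  | all σ φ ih =>
    intro ψ h
    cases ψ <;> simp only [Fm.code, Nat.pair_eq_pair] at h <;> try omega
    cases Ty.code_injective h.2.1; cases ih h.2.2; rfl

instance {Γ : Ctx} : Countable (Fm Γ) := Fm.code_injective.countable

/-! ## Structural properties of derivations -/

theorem Derives.mono {T : Theory} {Γ : Ctx} {H H' : List (Fm Γ)} {φ : Fm Γ}
    (h : Derives T H φ) (hH : H ⊆ H') : Derives T H' φ := by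
  induction h with
  | ax h => exact .ax h
  | hyp h => exact .hyp (hH h)
  | impI _ ih => exact .impI (ih (List.cons_subset_cons _ hH))
  | impE _ _ ih₁ ih₂ => exact .impE (ih₁ hH) (ih₂ hH)
  | raa _ ih => exact .raa (ih (List.cons_subset_cons _ hH))
  | allI _ ih => exact .allI (ih (List.map_subset _ hH))
  | allE t _ ih => exact .allE t (ih hH)
  | eqRefl t => exact .eqRefl t
  | eqSubst φ _ _ ih₁ ih₂ => exact .eqSubst φ (ih₁ hH) (ih₂ hH)

theorem Derives.rename {T : Theory} {Γ : Ctx} {H : List (Fm Γ)} {φ : Fm Γ}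
    (h : Derives T H φ) {Δ : Ctx} (r : Ren Γ Δ) :
    Derives T (H.map (Fm.rename r)) (φ.rename r) := by
  induction h generalizing Δ with
  | ax h => rw [Fm.ofSentence_rename]; exact .ax h
  | hyp h => exact .hyp (List.mem_map_of_mem h)
  | impI _ ih => exact .impI (ih r)
  | impE _ _ ih₁ ih₂ => exact .impE (ih₁ r) (ih₂ r)
  | raa _ ih => exact .raa (ih r)
  | allI _ ih =>
    refine .allI ?_
    have := ih (r.lift _)
    simp only [List.map_map] at this ⊢
    convert this using 2
    funext ψ
    exact (Fm.shift_rename ψ r).symm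
  | allE t _ ih => rw [Fm.inst_rename]; exact .allE _ (ih r)
  | eqRefl t => exact .eqRefl _
  | eqSubst φ _ _ ih₁ ih₂ =>
    have h₂ := ih₂ r
    rw [Fm.inst_rename] at h₂ ⊢
    exact .eqSubst _ (ih₁ r) h₂

/-- A closed term of each type. -/
def Tm.default {Γ : Ctx} : (σ : Ty) → Tm Γ σ
  | Ty.nat => Tm.zero
  | Ty.arr σ τ => Tm.K τ σ ⬝ Tm.default τ

/-- Every type has a closed term, so a fresh variable is harmless: generalise over it and
instantiate by that term. This is where nonemptiness of all sorts enters. -/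
theorem Derives.shift_bot {T : Theory} {Γ : Ctx} {H : List (Fm Γ)} {σ : Ty}
    (h : Derives T (H.map (Fm.shift σ)) Fm.bot) : Derives T H Fm.bot :=
  Derives.allE (Tm.default σ) (Derives.allI h)

/-! ## The Henkin construction -/

/-- An enumeration of the types in which each type occurs infinitely often. -/
theorem exists_type_stream : ∃ c : ℕ → Ty, ∀ σ n, ∃ m, n ≤ m ∧ c m = σ := by
  obtain ⟨e, he⟩ := (countable_iff_exists_surjective (α := Ty)).1 inferInstance
  · refine ⟨fun n => e n.unpair.1, fun σ n => ?_⟩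
    obtain ⟨k, rfl⟩ := he σ
    exact ⟨Nat.pair k n, Nat.right_le_pair k n, by simp⟩

/-- The context of the first `n` members of a stream of types. -/
def stage (c : ℕ → Ty) : ℕ → Ctx
  | 0 => []
  | n + 1 => c n :: stage c n

/-- The inclusion of an earlier context in a later one. -/
def up (c : ℕ → Ty) {m n : ℕ} (h : m ≤ n) : Ren (stage c m) (stage c n) :=
  Nat.leRec (motive := fun n _ => Ren (stage c m) (stage c n))
    (fun _ x => x) (fun _ _ r σ x => Var.s (r σ x)) h

section
variable {c : ℕ → Ty}

theorem up_self (n : ℕ) : up c (le_refl n) = fun _ x => x := Nat.leRec_self ..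

theorem up_succ {m n : ℕ} (h : m ≤ n) :
    up c (Nat.le_succ_of_le h) = fun σ x => Var.s (up c h σ x) := Nat.leRec_succ ..

theorem up_up {m n k : ℕ} (h : m ≤ n) (h' : n ≤ k) (σ : Ty) (x : Var (stage c m) σ) :
    up c h' σ (up c h σ x) = up c (h.trans h') σ x := by
  induction k, h' using Nat.le_induction with
  | base => rw [up_self]
  | succ k h' ih =>
    rw [up_succ h', up_succ (h.trans h')]
    exact congrArg Var.s ih

theorem Tm.up_up {m n k : ℕ} (h : m ≤ n) (h' : n ≤ k) {σ : Ty} (t : Tm (stage c m) σ) :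
    (t.rename (up c h)).rename (up c h') = t.rename (up c (h.trans h')) := by
  rw [Tm.rename_rename]; congr 1; funext σ x; exact HOA.up_up h h' σ x

theorem Fm.up_up {m n k : ℕ} (h : m ≤ n) (h' : n ≤ k) (φ : Fm (stage c m)) :
    (φ.rename (up c h)).rename (up c h') = φ.rename (up c (h.trans h')) := by
  rw [Fm.rename_rename]; congr 1; funext σ x; exact HOA.up_up h h' σ x

theorem Tm.up_self {n : ℕ} {σ : Ty} (t : Tm (stage c n) σ) :
    t.rename (up c (le_refl n)) = t := by rw [HOA.up_self, Tm.rename_id]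

theorem Fm.up_self {n : ℕ} (φ : Fm (stage c n)) :
    φ.rename (up c (le_refl n)) = φ := by rw [HOA.up_self, Fm.rename_id]

theorem Fm.up_succ {n : ℕ} (φ : Fm (stage c n)) :
    φ.rename (up c (Nat.le_succ n)) = φ.shift (c n) := by
  have := HOA.up_succ (c := c) (le_refl n)
  rw [Fm.shift, show up c (Nat.le_succ n) = up c (Nat.le_succ_of_le (le_refl n)) from rfl, this]
  congr 1; funext σ x; rw [HOA.up_self]

/-- A consistent finite set of formulas in one of the contexts of a stream. -/
structure Cond (T : Theory) (c : ℕ → Ty) where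
  n : ℕ
  H : List (Fm (stage c n))
  con : ¬ Derives T H Fm.bot

variable {T : Theory}

/-- `s'` extends `s`. -/
def Cond.Le (s s' : Cond T c) : Prop :=
  ∃ h : s.n ≤ s'.n, ∀ φ ∈ s.H, φ.rename (up c h) ∈ s'.H

theorem Cond.Le.refl (s : Cond T c) : s.Le s :=
  ⟨le_refl _, fun φ h => by rwa [Fm.up_self]⟩

theorem Cond.Le.trans {s s' s'' : Cond T c} (h : s.Le s') (h' : s'.Le s'') : s.Le s'' := by
  obtain ⟨h₁, h₂⟩ := h
  obtain ⟨h₃, h₄⟩ := h'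
  exact ⟨h₁.trans h₃, fun φ hφ => by rw [← Fm.up_up h₁ h₃]; exact h₄ _ (h₂ _ hφ)⟩

/-- The formula `φ` is derivable from the condition `s`. -/
def Cond.Forces (s : Cond T c) {n : ℕ} (φ : Fm (stage c n)) : Prop :=
  ∃ h : n ≤ s.n, Derives T s.H (φ.rename (up c h))

theorem Cond.Forces.mono {s s' : Cond T c} {n : ℕ} {φ : Fm (stage c n)} (h : s.Forces φ)
    (hs : s.Le s') : s'.Forces φ := by
  obtain ⟨h₁, h₂⟩ := h
  obtain ⟨h₃, h₄⟩ := hs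
  refine ⟨h₁.trans h₃, ?_⟩
  rw [← Fm.up_up h₁ h₃]
  refine (h₂.rename (up c h₃)).mono ?_
  intro ψ hψ
  obtain ⟨χ, hχ, rfl⟩ := List.mem_map.1 hψ
  exact h₄ _ hχ

/-- Each stage adds one fresh variable, and `Derives.shift_bot` keeps the condition consistent. -/
theorem Cond.exists_raise (s : Cond T c) {n : ℕ} (hn : s.n ≤ n) :
    ∃ s' : Cond T c, s.Le s' ∧ s'.n = n := by
  induction n, hn using Nat.le_induction with
  | base => exact ⟨s, .refl s, rfl⟩
  | succ n _ ih =>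
    obtain ⟨s', h, rfl⟩ := ih
    refine ⟨⟨s'.n + 1, s'.H.map (Fm.rename (up c (Nat.le_succ _))), fun hb => s'.con ?_⟩,
      h.trans ⟨Nat.le_succ _, fun φ hφ => List.mem_map_of_mem hφ⟩, rfl⟩
    apply Derives.shift_bot (σ := c s'.n)
    have h : s'.H.map (Fm.rename (up c (Nat.le_succ _))) = s'.H.map (Fm.shift (c s'.n)) :=
      List.map_congr_left fun φ _ => Fm.up_succ φ
    rwa [h] at hb

/-- `s` decides `φ`, with a witness if `φ` is a refuted universal formula. -/
def Cond.Decides (s : Cond T c) {n : ℕ} (φ : Fm (stage c n)) : Prop :=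
  s.Forces φ ∨ s.Forces φ.neg ∧ ∀ (σ : Ty) (ψ : Fm (σ :: stage c n)), φ = Fm.all σ ψ →
    ∃ (m : ℕ) (h : n ≤ m) (t : Tm (stage c m) σ),
      s.Forces ((ψ.rename (Ren.lift (up c h) σ)).inst t).neg

theorem Fm.rename_lift_inst_var {Γ : Ctx} {σ : Ty} (ψ : Fm (σ :: Γ)) :
    (ψ.rename (Ren.lift (fun _ x => Var.s x) σ)).inst (Tm.var Var.z) = ψ := by
  rw [Fm.inst, Fm.subst_rename]
  convert Fm.subst_var ψ using 2
  funext τ x; cases x <;> rfl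

/-- The Henkin step. A formula consistent with the condition is added to it; otherwise its negation
is derivable. If the refuted formula is universal, a fresh variable is made a counterexample: were
this inconsistent, the body would be derivable for a fresh variable, hence universally. -/
theorem Cond.exists_decides (hc : ∀ σ n, ∃ m, n ≤ m ∧ c m = σ) (s : Cond T c) {n : ℕ}
    (φ : Fm (stage c n)) : ∃ s' : Cond T c, s.Le s' ∧ s'.Decides φ := by
  obtain ⟨s₁, hs₁, hn⟩ := s.exists_raise (le_max_left s.n n)
  have hn₁ : n ≤ s₁.n := hn ▸ le_max_right s.n n
  by_cases hcon : Derives T (φ.rename (up c hn₁) :: s₁.H) Fm.bot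
  swap
  · refine ⟨⟨s₁.n, _ :: s₁.H, hcon⟩, hs₁.trans ⟨le_refl _, fun ψ hψ => ?_⟩, .inl ⟨hn₁, ?_⟩⟩
    · rw [Fm.up_self]; exact List.mem_cons_of_mem _ hψ
    · exact .hyp List.mem_cons_self
  have hneg : s₁.Forces φ.neg := ⟨hn₁, .impI hcon⟩
  by_cases hall : ∃ (σ : Ty) (ψ : Fm (σ :: stage c n)), φ = Fm.all σ ψ
  swap
  · exact ⟨s₁, hs₁, .inr ⟨hneg, fun σ ψ h => (hall ⟨σ, ψ, h⟩).elim⟩⟩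
  obtain ⟨σ, ψ, rfl⟩ := hall
  -- The stream takes the value `σ` again at some later `m`, so the variable added in passing from
  -- stage `m` to `m + 1` is a fresh one of type `σ`.
  obtain ⟨m, hm, rfl⟩ := hc σ s₁.n
  obtain ⟨s₂, hs₂, rfl⟩ := s₁.exists_raise hm
  have hneg₂ := hneg.mono hs₂
  have hn₂ : n ≤ s₂.n := hn₁.trans hm
  set χ : Fm (stage c (s₂.n + 1)) := ψ.rename (Ren.lift (up c hn₂) (c s₂.n)) with hχ
  have hcon' : ¬ Derives T (χ.neg :: s₂.H.map (Fm.rename (up c (Nat.le_succ _)))) Fm.bot := by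
    intro hb
    apply s₂.con
    refine .impE hneg₂.2 (.allI ?_)
    have h : s₂.H.map (Fm.rename (up c (Nat.le_succ _))) = s₂.H.map (Fm.shift (c s₂.n)) := by
      apply List.map_congr_left; intro φ _; exact Fm.up_succ φ
    rw [h] at hb
    exact .raa hb
  have hle : s₂.Le ⟨s₂.n + 1, _, hcon'⟩ :=
    ⟨Nat.le_succ _, fun φ hφ => List.mem_cons_of_mem _ (List.mem_map_of_mem hφ)⟩
  refine ⟨⟨s₂.n + 1, _, hcon'⟩, hs₁.trans (hs₂.trans hle), .inr ⟨hneg₂.mono hle, ?_⟩⟩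
  rintro _ _ ⟨⟩
  refine ⟨s₂.n + 1, Nat.le_succ_of_le hn₂, Tm.var Var.z, le_refl _, ?_⟩
  rw [Fm.up_self]
  have : (ψ.rename (Ren.lift (up c (Nat.le_succ_of_le hn₂)) (c s₂.n))).inst (Tm.var Var.z) = χ := by
    refine Eq.trans ?_ (Fm.rename_lift_inst_var (Γ := stage c s₂.n) χ)
    have h₁ := Fm.rename_rename (Ren.lift (up c hn₂) (c s₂.n))
      (Ren.lift (fun _ (x : Var (stage c s₂.n) _) => (Var.s x : Var (c s₂.n :: _) _)) (c s₂.n)) ψ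
    rw [Ren.lift_comp] at h₁
    rw [HOA.up_succ hn₂]
    exact congrArg (fun χ => Fm.inst χ (Tm.var Var.z)) h₁.symm
  rw [this]
  exact .hyp List.mem_cons_self

/-- An increasing sequence of conditions that decides each formula. -/
structure Generic (T : Theory) (c : ℕ → Ty) where
  s : ℕ → Cond T c
  le_succ : ∀ k, (s k).Le (s (k + 1))
  decides : ∀ {n : ℕ} (φ : Fm (stage c n)), ∃ k, (s k).Decides φ

theorem exists_generic (hc : ∀ σ n, ∃ m, n ≤ m ∧ c m = σ) (s₀ : Cond T c) :
    ∃ g : Generic T c, g.s 0 = s₀ := by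
  have : Nonempty (Σ n, Fm (stage c n)) := ⟨⟨0, Fm.bot⟩⟩
  obtain ⟨e, he⟩ := (countable_iff_exists_surjective (α := Σ n, Fm (stage c n))).1 inferInstance
  choose f hf using fun (s : Cond T c) (φ : Σ n, Fm (stage c n)) => s.exists_decides hc φ.2
  refine ⟨⟨fun k => Nat.rec s₀ (fun k s => f s (e k)) k, fun k => (hf _ _).1, fun φ => ?_⟩, rfl⟩
  obtain ⟨k, hk⟩ := he ⟨_, φ⟩
  refine ⟨k + 1, ?_⟩
  have := (hf (Nat.rec s₀ (fun k s => f s (e k)) k) (e k)).2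
  rw [hk] at this
  convert this

namespace Generic
variable (g : Generic T c)

theorem le {k l : ℕ} (h : k ≤ l) : (g.s k).Le (g.s l) := by
  induction l, h using Nat.le_induction with
  | base => exact .refl _
  | succ l _ ih => exact ih.trans (g.le_succ l)

/-- The formulas forced by some member of the sequence. -/
def Tr {n : ℕ} (φ : Fm (stage c n)) : Prop := ∃ k, (g.s k).Forces φ

theorem exists_level (n k : ℕ) : ∃ l, k ≤ l ∧ n ≤ (g.s l).n := by
  obtain ⟨l, hl⟩ := g.decides (Fm.bot : Fm (stage c n))
  have : n ≤ (g.s l).n := by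
    rcases hl with h | h
    · exact h.1
    · exact h.1.1
  exact ⟨max k l, le_max_left _ _, this.trans (g.le (le_max_right k l)).1⟩

variable {g}

theorem tr_up {m n : ℕ} (h : m ≤ n) (φ : Fm (stage c m)) :
    g.Tr (φ.rename (up c h)) ↔ g.Tr φ := by
  constructor
  · rintro ⟨k, hk, hd⟩
    rw [Fm.up_up] at hd
    exact ⟨k, _, hd⟩
  · rintro ⟨k, hk⟩
    obtain ⟨l, hl, hn⟩ := g.exists_level n k
    obtain ⟨_, hd⟩ := hk.mono (g.le hl)
    refine ⟨l, hn, ?_⟩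
    rwa [Fm.up_up]

theorem tr_mp {n : ℕ} {φ ψ : Fm (stage c n)} (h : g.Tr (Fm.imp φ ψ)) (h' : g.Tr φ) :
    g.Tr ψ := by
  obtain ⟨k, hk⟩ := h
  obtain ⟨l, hl⟩ := h'
  obtain ⟨_, h₁⟩ := hk.mono (g.le (le_max_left k l))
  obtain ⟨_, h₂⟩ := hl.mono (g.le (le_max_right k l))
  exact ⟨_, _, .impE h₁ h₂⟩

theorem tr_of_derives {n : ℕ} {H : List (Fm (stage c n))} {φ : Fm (stage c n)}
    (h : Derives T H φ) (hH : ∀ ψ ∈ H, g.Tr ψ) : g.Tr φ := by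
  induction H generalizing φ with
  | nil =>
    obtain ⟨l, _, hn⟩ := g.exists_level n 0
    exact ⟨l, hn, (h.rename (up c hn)).mono (by simp)⟩
  | cons ψ H ih =>
    exact tr_mp (ih h.impI fun χ hχ => hH χ (List.mem_cons_of_mem _ hχ))
      (hH ψ List.mem_cons_self)

theorem not_tr_bot {n : ℕ} : ¬ g.Tr (Fm.bot : Fm (stage c n)) := by
  rintro ⟨k, _, h⟩
  exact (g.s k).con h

theorem tr_neg {n : ℕ} {φ : Fm (stage c n)} : g.Tr φ.neg ↔ ¬ g.Tr φ := by
  constructor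
  · intro h h'
    exact not_tr_bot (tr_mp h h')
  · intro h
    obtain ⟨k, hk | hk⟩ := g.decides φ
    · exact (h ⟨k, hk⟩).elim
    · exact ⟨k, hk.1⟩

theorem tr_imp {n : ℕ} {φ ψ : Fm (stage c n)} :
    g.Tr (Fm.imp φ ψ) ↔ (g.Tr φ → g.Tr ψ) := by
  constructor
  · exact tr_mp
  · intro h
    by_cases hφ : g.Tr φ
    · exact tr_of_derives (H := [ψ]) (.impI (.hyp (by simp))) (by simpa using h hφ)
    · refine tr_of_derives (H := [φ.neg]) (.impI (.raa ?_)) (by simpa using tr_neg.2 hφ)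
      exact .impE (.hyp (φ := φ.neg) (by simp)) (.hyp (by simp))

/-- The terms range over all later stages because the counterexample to a refuted universal formula
may be a variable that is introduced later. -/
theorem tr_all {n : ℕ} {σ : Ty} {ψ : Fm (σ :: stage c n)} :
    g.Tr (Fm.all σ ψ) ↔ ∀ (m : ℕ) (h : n ≤ m) (t : Tm (stage c m) σ),
      g.Tr ((ψ.rename (Ren.lift (up c h) σ)).inst t) := by
  constructor
  · intro h m hm t
    rw [← tr_up hm] at h
    exact tr_of_derives (H := [_]) (.allE t (.hyp List.mem_cons_self)) (by simpa [Fm.rename] using h)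
  · intro h
    obtain ⟨k, hk | hk⟩ := g.decides (Fm.all σ ψ)
    · exact ⟨k, hk⟩
    · obtain ⟨m, hm, t, ht⟩ := hk.2 σ ψ rfl
      exact (tr_neg.1 ⟨k, ht⟩ (h m hm t)).elim

variable (g)

/-- The structure of terms in the contexts of the stream. -/
def termStruc : Struc where
  C σ := Σ n, Tm (stage c n) σ
  app p q := ⟨max p.1 q.1,
    p.2.rename (up c (le_max_left _ _)) ⬝ q.2.rename (up c (le_max_right _ _))⟩
  zero := ⟨0, Tm.zero⟩
  one := ⟨0, Tm.one⟩
  add := ⟨0, Tm.add⟩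
  mul := ⟨0, Tm.mul⟩
  K ρ τ := ⟨0, Tm.K ρ τ⟩
  S δ ρ τ := ⟨0, Tm.S δ ρ τ⟩
  R σ := ⟨0, Tm.R σ⟩
  eqv p q := g.Tr (Fm.eq (p.2.rename (up c (le_max_left p.1 q.1)))
    (q.2.rename (up c (le_max_right p.1 q.1))))
  lt p q := g.Tr (Fm.lt (p.2.rename (up c (le_max_left p.1 q.1)))
    (q.2.rename (up c (le_max_right p.1 q.1))))

/-- The substitution given by an assignment in the term structure. -/
def sub {Γ : Ctx} (e : g.termStruc.Env Γ) {N : ℕ} (hN : ∀ σ x, (e σ x).1 ≤ N) :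
    Sub Γ (stage c N) := fun σ x => (e σ x).2.rename (up c (hN σ x))

/-- Values carry their own stage, so they are compared with substituted terms only after being
raised to a common stage `N`. -/
theorem eval_termStruc {Γ : Ctx} (e : g.termStruc.Env Γ) {N : ℕ} (hN : ∀ σ x, (e σ x).1 ≤ N)
    {σ : Ty} (t : Tm Γ σ) :
    ∃ h : (t.eval e).1 ≤ N, (t.eval e).2.rename (up c h) = t.subst (g.sub e hN) := by
  induction t with
  | var x => exact ⟨hN _ x, rfl⟩
  | app t u iht ihu =>
    obtain ⟨h₁, ht⟩ := iht
    obtain ⟨h₂, hu⟩ := ihu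
    refine ⟨max_le h₁ h₂, ?_⟩
    rw [Tm.subst, ← ht, ← hu, ← Tm.up_up (le_max_left _ _) (max_le h₁ h₂),
      ← Tm.up_up (le_max_right _ _) (max_le h₁ h₂)]
    rfl
  | _ => exact ⟨Nat.zero_le N, rfl⟩

variable {g}

theorem tr_eq {p q : g.termStruc.C Ty.nat} {N : ℕ} (hp : p.1 ≤ N) (hq : q.1 ≤ N) :
    g.termStruc.eqv p q ↔ g.Tr (Fm.eq (p.2.rename (up c hp)) (q.2.rename (up c hq))) := by
  have := tr_up (g := g) (max_le hp hq) (Fm.eq (p.2.rename (up c (le_max_left p.1 q.1)))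
    (q.2.rename (up c (le_max_right p.1 q.1))))
  rw [Fm.rename, Tm.up_up, Tm.up_up] at this
  exact this.symm

theorem tr_lt {p q : g.termStruc.C Ty.nat} {N : ℕ} (hp : p.1 ≤ N) (hq : q.1 ≤ N) :
    g.termStruc.lt p q ↔ g.Tr (Fm.lt (p.2.rename (up c hp)) (q.2.rename (up c hq))) := by
  have := tr_up (g := g) (max_le hp hq) (Fm.lt (p.2.rename (up c (le_max_left p.1 q.1)))
    (q.2.rename (up c (le_max_right p.1 q.1))))
  rw [Fm.rename, Tm.up_up, Tm.up_up] at this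
  exact this.symm

theorem sub_cons {Γ : Ctx} (e : g.termStruc.Env Γ) {N : ℕ} (hN : ∀ σ x, (e σ x).1 ≤ N)
    {σ : Ty} (p : g.termStruc.C σ) {m : ℕ} (hm : N ≤ m) (hp : p.1 ≤ m)
    (h : ∀ τ x, ((Env.cons p e : g.termStruc.Env (σ :: Γ)) τ x).1 ≤ m) (φ : Fm (σ :: Γ)) :
    ((φ.subst ((g.sub e hN).lift σ)).rename (Ren.lift (up c hm) σ)).inst
      (p.2.rename (up c hp)) = φ.subst (g.sub (Env.cons p e) h) := by
  rw [Fm.rename_subst, Fm.inst, Fm.subst_subst]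
  congr 1
  funext τ x
  cases x with
  | z => rfl
  | s x =>
    rw [Sub.lift, Tm.rename_rename, Tm.subst_rename, Generic.sub, Generic.sub, Tm.subst_rename]
    simp only [Ren.lift, Sub.single]
    rw [← Tm.subst_var (((Env.cons p e : g.termStruc.Env (σ :: Γ)) τ x.s).2.rename _),
      Tm.subst_rename]
    congr 1
    funext τ y
    rw [HOA.up_up]
    rfl

/-- The truth lemma. In the quantifier case the common stage has to grow to accommodate the new
value, which is why the statement allows any bound `N`. -/
theorem sat_termStruc {Γ : Ctx} (φ : Fm Γ) (e : g.termStruc.Env Γ) {N : ℕ}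
    (hN : ∀ σ x, (e σ x).1 ≤ N) : φ.Sat e ↔ g.Tr (φ.subst (g.sub e hN)) := by
  induction φ generalizing N with
  | eq t u =>
    obtain ⟨h₁, ht⟩ := g.eval_termStruc e hN t
    obtain ⟨h₂, hu⟩ := g.eval_termStruc e hN u
    rw [Fm.Sat, tr_eq h₁ h₂, ht, hu, Fm.subst]
  | lt t u =>
    obtain ⟨h₁, ht⟩ := g.eval_termStruc e hN t
    obtain ⟨h₂, hu⟩ := g.eval_termStruc e hN u
    rw [Fm.Sat, tr_lt h₁ h₂, ht, hu, Fm.subst]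
  | bot => exact iff_of_false id not_tr_bot
  | imp φ ψ ih₁ ih₂ => rw [Fm.Sat, ih₁ e hN, ih₂ e hN, Fm.subst, tr_imp]
  | @all Γ σ φ ih =>
    have hcons : ∀ (p : g.termStruc.C σ) (m : ℕ), N ≤ m → p.1 ≤ m →
        ∀ τ x, ((Env.cons p e : g.termStruc.Env (σ :: Γ)) τ x).1 ≤ m := by
      intro p m h h' τ x
      cases x with
      | z => exact h'
      | s x => exact (hN _ x).trans h
    rw [Fm.Sat, Fm.subst, tr_all]
    constructor
    · intro h m hm t
      have := (ih _ (hcons ⟨m, t⟩ m hm (le_refl m))).1 (h ⟨m, t⟩)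
      rw [← sub_cons e hN ⟨m, t⟩ hm (le_refl m), Tm.up_self] at this
      exact this
    · intro h p
      rw [ih _ (hcons p _ (le_max_left N p.1) (le_max_right N p.1)),
        ← sub_cons e hN p (le_max_left N p.1) (le_max_right N p.1)]
      exact h _ _ _

theorem models_termStruc (φ : Sentence) : g.termStruc.Models φ ↔ g.Tr (n := 0) φ := by
  rw [Struc.Models, sat_termStruc φ _ (N := 0) (fun σ x => nomatch x)]
  have : φ.subst (g.sub (Env.nil (M := g.termStruc)) (N := 0) (fun σ x => nomatch x)) = φ := by
    refine Eq.trans ?_ (Fm.subst_var φ)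
    congr 1; funext σ x; cases x
  exact iff_of_eq (congrArg g.Tr this)

end Generic
end

/-- A structure in which the interpretation of `=` is an equivalence relation that `<`
respects. -/
structure Struc.IsPre (M : Struc) : Prop where
  refl : ∀ a, M.eqv a a
  symm : ∀ {a b}, M.eqv a b → M.eqv b a
  trans : ∀ {a b c}, M.eqv a b → M.eqv b c → M.eqv a c
  lt_congr : ∀ {a a' b b'}, M.eqv a a' → M.eqv b b' → M.lt a b → M.lt a' b'

theorem Generic.isPre {T : Theory} {c : ℕ → Ty} (g : Generic T c) : g.termStruc.IsPre := by
  have subst : ∀ {n : ℕ} {t u : Tm (stage c n) Ty.nat} (φ : Fm (Ty.nat :: stage c n)),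
      g.Tr (Fm.eq t u) → g.Tr (φ.inst t) → g.Tr (φ.inst u) := by
    intro n t u φ h h'
    refine tr_of_derives (H := [Fm.eq t u, φ.inst t]) (.eqSubst (t := t) φ
      (.hyp (by simp)) (.hyp (by simp))) (by simp [h, h'])
  have weak : ∀ {n : ℕ} (t u : Tm (stage c n) Ty.nat),
      (t.rename fun _ x => Var.s x).subst (Sub.single u) = t := by
    intro n t u
    rw [Tm.subst_rename]; exact Tm.subst_var t
  have symm : ∀ {n : ℕ} {t u : Tm (stage c n) Ty.nat},
      g.Tr (Fm.eq t u) → g.Tr (Fm.eq u t) := by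
    intro n t u h
    -- The substitution rule is applied to the formula `z = t`, starting from `t = t`. Transitivity
    -- and the congruence of `<` arise from other formulas with one hole in the same way.
    have := subst (Fm.eq (Tm.var Var.z) (t.rename fun _ x => Var.s x)) h (by
      simp only [Fm.inst, Fm.subst, Tm.subst, Sub.single, weak]
      exact tr_of_derives (.eqRefl t) (H := []) (by simp))
    simpa only [Fm.inst, Fm.subst, Tm.subst, Sub.single, weak] using this
  refine ⟨fun a => ?_, fun {a b} h => ?_, fun {a b d} h h' => ?_, fun {a a' b b'} h h' hl => ?_⟩
  · exact tr_of_derives (.eqRefl _) (H := []) (by simp)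
  · have ha : a.1 ≤ max a.1 b.1 := le_max_left _ _
    have hb : b.1 ≤ max a.1 b.1 := le_max_right _ _
    rw [tr_eq ha hb] at h
    rw [tr_eq hb ha]
    exact symm h
  · have ha : a.1 ≤ max (max a.1 b.1) d.1 := by simp
    have hb : b.1 ≤ max (max a.1 b.1) d.1 := by simp
    have hd : d.1 ≤ max (max a.1 b.1) d.1 := by simp
    rw [tr_eq ha hb] at h
    rw [tr_eq hb hd] at h'
    rw [tr_eq ha hd]
    have := subst (Fm.eq ((a.2.rename (up c ha)).rename fun _ x => Var.s x) (Tm.var Var.z)) h' (by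
      simpa only [Fm.inst, Fm.subst, Tm.subst, Sub.single, weak] using h)
    simpa only [Fm.inst, Fm.subst, Tm.subst, Sub.single, weak] using this
  · have ha : a.1 ≤ max (max a.1 b.1) (max a'.1 b'.1) := by simp
    have hb : b.1 ≤ max (max a.1 b.1) (max a'.1 b'.1) := by simp
    have ha' : a'.1 ≤ max (max a.1 b.1) (max a'.1 b'.1) := by simp
    have hb' : b'.1 ≤ max (max a.1 b.1) (max a'.1 b'.1) := by simp
    rw [tr_eq ha ha'] at h
    rw [tr_eq hb hb'] at h'
    rw [tr_lt ha hb] at hl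
    rw [tr_lt ha' hb']
    have h₁ := subst (Fm.lt (Tm.var Var.z) ((b.2.rename (up c hb)).rename fun _ x => Var.s x)) h (by
      simpa only [Fm.inst, Fm.subst, Tm.subst, Sub.single, weak] using hl)
    simp only [Fm.inst, Fm.subst, Tm.subst, Sub.single, weak] at h₁
    have h₂ := subst (Fm.lt ((a'.2.rename (up c ha')).rename fun _ x => Var.s x) (Tm.var Var.z)) h'
      (by simpa only [Fm.inst, Fm.subst, Tm.subst, Sub.single, weak] using h₁)
    simpa only [Fm.inst, Fm.subst, Tm.subst, Sub.single, weak] using h₂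

/-- A sentence that is not provable fails in a structure that satisfies the axioms. -/
theorem exists_countermodel {T : Theory} {φ : Sentence} (h : ¬ T.Proves φ) :
    ∃ M : Struc, M.IsPre ∧ (∀ ψ ∈ T, M.Models ψ) ∧ ¬ M.Models φ := by
  obtain ⟨c, hc⟩ := exists_type_stream
  obtain ⟨g, hg⟩ := exists_generic hc
    (⟨0, [φ.neg], fun hb => h (.raa hb)⟩ : Cond T c)
  refine ⟨g.termStruc, g.isPre, fun ψ hψ => ?_, ?_⟩
  · rw [Generic.models_termStruc]
    refine Generic.tr_of_derives (H := []) ?_ (by simp)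
    have := Derives.ax (T := T) (Γ := []) (H := []) hψ
    rwa [Fm.ofSentence_nil] at this
  · rw [Generic.models_termStruc]
    refine Generic.tr_neg.1 ⟨0, ?_⟩
    rw [hg]
    refine ⟨le_refl 0, ?_⟩
    rw [Fm.up_self]
    exact .hyp List.mem_cons_self


/-! ### From structures to extensional models of the base theory. -/

/-! ## Satisfaction of the abbreviations -/

section
variable {M : Struc} {Γ Δ : Ctx}

instance {σ τ : Ty} : CoeFun (M.C (σ ⇒ τ)) (fun _ => M.C σ → M.C τ) := ⟨M.app⟩

@[simp] theorem Tm.eval_wk_refl {σ : Ty} (t : Tm Γ σ) (e : M.Env Γ) :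
    (@Tm.wk Γ Γ σ Ext.refl t).eval e = t.eval e := by
  rw [Tm.wk, Tm.eval_rename]; rfl

@[simp] theorem Tm.eval_wk_step {σ τ : Ty} [Ext Γ Δ] (t : Tm Γ σ) (a : M.C τ) (e : M.Env Δ) :
    (@Tm.wk Γ (τ :: Δ) σ Ext.step t).eval (Env.cons a e) = (Tm.wk t : Tm Δ σ).eval e := by
  rw [Tm.wk, Tm.eval_rename, Tm.wk, Tm.eval_rename]; rfl

@[simp] theorem Tm.eval_var_z {σ : Ty} (a : M.C σ) (e : M.Env Γ) :
    (Tm.var (Var.z : Var (σ :: Γ) σ)).eval (Env.cons a e) = a := rfl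

@[simp] theorem Tm.eval_var_s {σ τ : Ty} (x : Var Γ σ) (a : M.C τ) (e : M.Env Γ) :
    (Tm.var (Var.s x)).eval (Env.cons a e) = (Tm.var x).eval e := rfl

@[simp] theorem Tm.eval_app {σ τ : Ty} (t : Tm Γ (σ ⇒ τ)) (u : Tm Γ σ) (e : M.Env Γ) :
    (t ⬝ u).eval e = t.eval e (u.eval e) := rfl

@[simp] theorem Tm.eval_K {σ τ : Ty} (e : M.Env Γ) : (Tm.K σ τ).eval e = M.K σ τ := rfl

@[simp] theorem Tm.eval_S {ρ σ τ : Ty} (e : M.Env Γ) : (Tm.S ρ σ τ).eval e = M.S ρ σ τ := rfl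

@[simp] theorem Tm.eval_R {σ : Ty} (e : M.Env Γ) : (Tm.R σ).eval e = M.R σ := rfl

@[simp] theorem Fm.sat_imp (φ ψ : Fm Γ) (e : M.Env Γ) :
    (φ ⟶ₘ ψ).Sat e ↔ (φ.Sat e → ψ.Sat e) := Iff.rfl

@[simp] theorem Fm.sat_neg (φ : Fm Γ) (e : M.Env Γ) : (∼φ).Sat e ↔ ¬ φ.Sat e := Iff.rfl

@[simp] theorem Fm.sat_or (φ ψ : Fm Γ) (e : M.Env Γ) :
    (φ ⋎ ψ).Sat e ↔ φ.Sat e ∨ ψ.Sat e := by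
  rw [Fm.or, Fm.sat_imp, Fm.sat_neg]; tauto

@[simp] theorem Fm.sat_and (φ ψ : Fm Γ) (e : M.Env Γ) :
    (φ ⋏ ψ).Sat e ↔ φ.Sat e ∧ ψ.Sat e := by
  rw [Fm.and, Fm.sat_neg, Fm.sat_imp, Fm.sat_neg]; tauto

@[simp] theorem Fm.sat_iff (φ ψ : Fm Γ) (e : M.Env Γ) :
    (φ ⟷ₘ ψ).Sat e ↔ (φ.Sat e ↔ ψ.Sat e) := by
  rw [Fm.iff, Fm.sat_and, Fm.sat_imp, Fm.sat_imp]; tauto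

theorem Struc.models_or (φ ψ : Sentence) : M.Models (φ.or ψ) ↔ M.Models φ ∨ M.Models ψ :=
  Fm.sat_or _ _ _

theorem Struc.models_iff (φ ψ : Sentence) : M.Models (φ.iff ψ) ↔ (M.Models φ ↔ M.Models ψ) :=
  Fm.sat_iff _ _ _

@[simp] theorem Fm.sat_all {σ : Ty} (φ : Fm (σ :: Γ)) (e : M.Env Γ) :
    (Fm.all σ φ).Sat e ↔ ∀ a : M.C σ, φ.Sat (Env.cons a e) := Iff.rfl

@[simp] theorem Fm.sat_ex {σ : Ty} (φ : Fm (σ :: Γ)) (e : M.Env Γ) :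
    (Fm.ex σ φ).Sat e ↔ ∃ a : M.C σ, φ.Sat (Env.cons a e) := by
  rw [Fm.ex, Fm.sat_neg, Fm.sat_all]; simp

@[simp] theorem sat_forallB {σ : Ty} (φ : Tm (σ :: Γ) σ → Fm (σ :: Γ)) (e : M.Env Γ) :
    (forallB σ φ).Sat e ↔ ∀ a : M.C σ, (φ (Tm.var Var.z)).Sat (Env.cons a e) := Iff.rfl

@[simp] theorem sat_existsB {σ : Ty} (φ : Tm (σ :: Γ) σ → Fm (σ :: Γ)) (e : M.Env Γ) :
    (existsB σ φ).Sat e ↔ ∃ a : M.C σ, (φ (Tm.var Var.z)).Sat (Env.cons a e) := Fm.sat_ex _ _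

theorem Fm.sat_close (φ : Fm Γ) :
    (Fm.close Γ φ).Sat (Env.nil (M := M)) ↔ ∀ e : M.Env Γ, φ.Sat e := by
  induction Γ with
  | nil =>
    refine ⟨fun h e => ?_, fun h => h _⟩
    rw [Env.eq_nil e]; exact h
  | cons σ Γ ih =>
    rw [Fm.close, ih]
    refine ⟨fun h e => ?_, fun h e a => h _⟩
    convert h (fun τ x => e τ (Var.s x)) (e σ Var.z) using 1
    funext τ x; cases x <;> rfl

end

section
variable {M : Struc}

instance : Zero (M.C Ty.nat) := ⟨M.zero⟩
instance : One (M.C Ty.nat) := ⟨M.one⟩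
instance : Add (M.C Ty.nat) := ⟨fun a b => M.add a b⟩
instance : Mul (M.C Ty.nat) := ⟨fun a b => M.mul a b⟩

@[simp] theorem Struc.add_app (a b : M.C Ty.nat) : M.add a b = a + b := rfl
@[simp] theorem Struc.mul_app (a b : M.C Ty.nat) : M.mul a b = a * b := rfl
@[simp] theorem Struc.zero_eq : M.zero = 0 := rfl
@[simp] theorem Struc.one_eq : M.one = 1 := rfl
@[simp] theorem Tm.eval_zero {Γ : Ctx} (e : M.Env Γ) : (Tm.zero : Tm Γ _).eval e = 0 := rfl
@[simp] theorem Tm.eval_one {Γ : Ctx} (e : M.Env Γ) : (Tm.one : Tm Γ _).eval e = 1 := rfl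
@[simp] theorem Tm.eval_plus {Γ : Ctx} (t u : Tm Γ Ty.nat) (e : M.Env Γ) :
    (t ⊕ₙ u).eval e = t.eval e + u.eval e := rfl
@[simp] theorem Tm.eval_times {Γ : Ctx} (t u : Tm Γ Ty.nat) (e : M.Env Γ) :
    (t ⊗ₙ u).eval e = t.eval e * u.eval e := rfl

end

/-! ## The extensional collapse -/

section
variable (M : Struc)

/-- Extensional equality in a structure. -/
def Struc.Eqv : (σ : Ty) → M.C σ → M.C σ → Prop
  | Ty.nat, a, b => M.eqv a b
  | Ty.arr _ τ, f, g => ∀ z, Struc.Eqv τ (M.app f z) (M.app g z)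

theorem sat_eqAt {M : Struc} {Γ : Ctx} {τ : Ty} (x y : Tm Γ τ) (e : M.Env Γ) :
    (eqAt τ x y).Sat e ↔ M.Eqv τ (x.eval e) (y.eval e) := by
  induction τ generalizing Γ with
  | nat => rfl
  | arr _ _ _ ih => simp [eqAt, ih, Struc.Eqv]

/-- The functions of a structure respect extensional equality. -/
structure Struc.IsExt : Prop extends M.IsPre where
  ext : ∀ {σ τ : Ty} {x y : M.C σ} (F : M.C (σ ⇒ τ)), M.Eqv σ x y → M.Eqv τ (F x) (F y)

variable {M}

theorem Struc.IsPre.equivalence (h : M.IsPre) (σ : Ty) : Equivalence (M.Eqv σ) := by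
  induction σ with
  | nat => exact ⟨h.refl, h.symm, h.trans⟩
  | arr σ τ _ ih =>
    exact ⟨fun f z => ih.refl _, fun h z => ih.symm (h z), fun h h' z => ih.trans (h z) (h' z)⟩

/-- Extensional equality as a setoid. -/
def Struc.IsExt.setoid (h : M.IsExt) (σ : Ty) : Setoid (M.C σ) :=
  ⟨M.Eqv σ, h.toIsPre.equivalence σ⟩

/-- The quotient by extensional equality. -/
def Struc.IsExt.collapse (h : M.IsExt) : Struc where
  C σ := Quotient (h.setoid σ)
  app {_ τ} := Quotient.map₂ M.app fun _ _ hf _ y hx =>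
    ((h.setoid τ).trans (h.ext _ hx) (hf y) : M.Eqv τ _ _)
  zero := Quotient.mk _ M.zero
  one := Quotient.mk _ M.one
  add := Quotient.mk _ M.add
  mul := Quotient.mk _ M.mul
  K _ _ := Quotient.mk _ (M.K _ _)
  S _ _ _ := Quotient.mk _ (M.S _ _ _)
  R _ := Quotient.mk _ (M.R _)
  eqv := Eq
  lt := Quotient.lift₂ M.lt fun _ _ _ _ ha hb =>
    propext ⟨h.lt_congr ha hb, h.lt_congr (h.symm ha) (h.symm hb)⟩

/-- The quotient map. -/
def Struc.IsExt.proj (h : M.IsExt) {σ : Ty} (a : M.C σ) : h.collapse.C σ :=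
  Quotient.mk (h.setoid σ) a

theorem Struc.IsExt.eval_collapse (h : M.IsExt) {Γ : Ctx} (e : M.Env Γ) {σ : Ty} (t : Tm Γ σ) :
    t.eval (M := h.collapse) (fun _ x => h.proj (e _ x)) = h.proj (t.eval e) := by
  induction t with
  | app t u iht ihu => rw [Tm.eval, iht, ihu]; rfl
  | _ => rfl

/-- The quotient map is surjective at each type and preserves the atomic relations in both
directions, so it preserves all formulas. -/
theorem Struc.IsExt.sat_collapse (h : M.IsExt) {Γ : Ctx} (φ : Fm Γ) (e : M.Env Γ) :
    φ.Sat (M := h.collapse) (fun _ x => h.proj (e _ x)) ↔ φ.Sat e := by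
  induction φ with
  | eq t u =>
    rw [Fm.Sat, eval_collapse, eval_collapse]
    exact Quotient.eq (r := h.setoid Ty.nat)
  | lt t u => rw [Fm.Sat, eval_collapse, eval_collapse]; rfl
  | bot => rfl
  | imp φ ψ ih₁ ih₂ => rw [Fm.Sat, ih₁, ih₂]; rfl
  | all σ φ ih =>
    have : ∀ a : M.C σ, (Env.cons (h.proj a) (fun τ x => h.proj (e τ x)) :
        h.collapse.Env _) = fun τ x => h.proj (Env.cons a e τ x) := by
      intro a; funext τ x; cases x <;> rfl
    constructor
    · intro hs a
      rw [← ih, ← this]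
      exact hs _
    · intro hs a
      obtain ⟨a, rfl⟩ := Quotient.exists_rep a
      have := this a
      rw [Struc.IsExt.proj] at this
      rw [this, ih]
      exact hs a

theorem Struc.IsExt.models_collapse (h : M.IsExt) (φ : Sentence) :
    h.collapse.Models φ ↔ M.Models φ := by
  rw [Struc.Models, Struc.Models, ← h.sat_collapse φ Env.nil]
  rw [Env.eq_nil fun σ x => h.proj (Env.nil (M := M) σ x)]

end

/-- An extensional model of `RCA₀^ω` in which `=` is interpreted by equality. -/
class Struc.IsModel (M : Struc) : Prop where
  eqv_iff : ∀ {a b : M.C Ty.nat}, M.eqv a b ↔ a = b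
  funext : ∀ {σ τ : Ty} {f g : M.C (σ ⇒ τ)}, (∀ x, f x = g x) → f = g
  models : ∀ {φ : Sentence}, RCA0omegaAxiom φ → M.Models φ

/-- The Henkin countermodel satisfies the extensionality axioms, so it can be collapsed without
changing the truth of any sentence. In the quotient, functions with equal values are equal. -/
theorem RCA0omega.proves_of_models {φ : Sentence}
    (h : ∀ M : Struc, M.IsModel → M.Models φ) : RCA0omega.Proves φ := by
  by_contra hφ
  obtain ⟨M, hM, hT, hn⟩ := exists_countermodel hφ
  have hext : M.IsExt := by
    refine ⟨hM, fun {σ τ x y} F hxy => ?_⟩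
    have := hT _ (RCA0omegaAxiom.ext σ τ)
    simp only [Struc.Models, sat_forallB, Fm.sat_imp, sat_eqAt] at this
    simpa using this x y F (by simpa using hxy)
  refine hn ((hext.models_collapse φ).1 (h _ ⟨Iff.rfl, fun {σ τ f g} hfg => ?_, fun hψ =>
    (hext.models_collapse _).2 (hT _ hψ)⟩))
  obtain ⟨f, rfl⟩ := Quotient.exists_rep f
  obtain ⟨g, rfl⟩ := Quotient.exists_rep g
  exact Quotient.sound fun z => Quotient.exact (hfg (Quotient.mk _ z))

theorem Struc.IsModel.sound {M : Struc} (hM : M.IsModel) {T : Theory} {φ : Sentence}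
    (h : Theory.Proves (RCA0omega ∪ T) φ) (hT : ∀ ψ ∈ T, M.Models ψ) : M.Models φ :=
  Derives.sound (fun _ _ => hM.eqv_iff) (fun ψ hψ => hψ.elim hM.models (hT ψ)) h _ (by simp)

/-! ## The arithmetic of a model -/

section
variable {M : Struc} [hM : M.IsModel]

theorem Struc.eqv_eq (τ : Ty) (a b : M.C τ) : M.Eqv τ a b ↔ a = b := by
  induction τ with
  | nat => exact hM.eqv_iff
  | arr σ τ _ ih =>
    simp only [Struc.Eqv, ih]
    exact ⟨hM.funext, fun h x => by rw [h]⟩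

@[simp] theorem Fm.sat_eq {Γ : Ctx} (t u : Tm Γ Ty.nat) (e : M.Env Γ) :
    (t ≐ u).Sat e ↔ t.eval e = u.eval e := hM.eqv_iff

@[simp] theorem sat_eqAt_iff {Γ : Ctx} {τ : Ty} (x y : Tm Γ τ) (e : M.Env Γ) :
    (eqAt τ x y).Sat e ↔ x.eval e = y.eval e := by rw [sat_eqAt, Struc.eqv_eq]

@[simp] theorem Struc.K_app {ρ τ : Ty} (x : M.C ρ) (y : M.C τ) : M.K ρ τ x y = x := by
  simpa [Struc.Models] using hM.models (RCA0omegaAxiom.combK ρ τ) x y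

@[simp] theorem Struc.S_app {δ ρ τ : Ty} (x : M.C (δ ⇒ ρ ⇒ τ)) (y : M.C (δ ⇒ ρ)) (z : M.C δ) :
    M.S δ ρ τ x y z = x z (y z) := by
  simpa [Struc.Models] using hM.models (RCA0omegaAxiom.combS δ ρ τ) x y z

variable (M) in
theorem Struc.ax {φ : Sentence} (h : BasicAxiom φ) : φ.Sat (Env.nil (M := M)) :=
  hM.models (.basic h)

instance Struc.commSemiring : CommSemiring (M.C Ty.nat) :=
  have add_comm' (a b : M.C Ty.nat) : a + b = b + a := by simpa using M.ax .add_comm a b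
  have add_zero' (a : M.C Ty.nat) : a + 0 = a := by simpa using M.ax .add_zero a
  have mul_comm' (a b : M.C Ty.nat) : a * b = b * a := by simpa using M.ax .mul_comm a b
  have mul_zero' (a : M.C Ty.nat) : a * 0 = 0 := by simpa using M.ax .mul_zero a
  have mul_one' (a : M.C Ty.nat) : a * 1 = a := by simpa using M.ax .mul_one a
  have mul_add' (a b c : M.C Ty.nat) : a * (b + c) = a * b + a * c := by
    simpa using M.ax .mul_add a b c
  { nsmul := nsmulRec
    add_assoc := fun a b c => by simpa using M.ax .add_assoc a b c
    add_comm := add_comm'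
    zero_add := fun a => by rw [add_comm', add_zero']
    add_zero := add_zero'
    mul_assoc := fun a b c => by simpa using M.ax .mul_assoc a b c
    mul_comm := mul_comm'
    mul_zero := mul_zero'
    zero_mul := fun a => by rw [mul_comm', mul_zero']
    mul_one := mul_one'
    one_mul := fun a => by rw [mul_comm', mul_one']
    left_distrib := mul_add'
    right_distrib := fun a b c => by rw [mul_comm', mul_add', mul_comm' c, mul_comm' c] }

noncomputable instance Struc.linearOrder : LinearOrder (M.C Ty.nat) where
  lt a b := M.lt a b
  le a b := M.lt a b ∨ a = b
  le_refl a := .inr rfl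
  le_trans a b c h h' := by
    rcases h with h | rfl
    · rcases h' with h' | rfl
      · exact .inl (M.ax .lt_trans a b c h h')
      · exact .inl h
    · exact h'
  lt_iff_le_not_ge a b := by
    have irr := M.ax .lt_irrefl
    have trans := M.ax .lt_trans
    constructor
    · intro h
      refine ⟨.inl h, ?_⟩
      rintro (h' | rfl)
      · exact irr a (trans a b a h h')
      · exact irr _ h
    · rintro ⟨h | rfl, h'⟩
      · exact h
      · exact (h' (.inr rfl)).elim
  le_antisymm a b h h' := by
    rcases h with h | rfl
    · rcases h' with h' | rfl
      · exact (M.ax .lt_irrefl a (M.ax .lt_trans a b a h h')).elim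
      · rfl
    · rfl
  le_total a b := by
    have := M.ax .lt_total a b
    simp only [Fm.sat_or, Fm.sat_eq] at this
    rcases this with h | h | h
    · exact .inl (.inl h)
    · exact .inl (.inr h)
    · exact .inr (.inl h)
  toDecidableLE := Classical.decRel _

@[simp] theorem Fm.sat_lt {Γ : Ctx} (t u : Tm Γ Ty.nat) (e : M.Env Γ) :
    (t ≺ u).Sat e ↔ t.eval e < u.eval e := Iff.rfl

@[simp] theorem Fm.sat_le {Γ : Ctx} (t u : Tm Γ Ty.nat) (e : M.Env Γ) :
    (t ≼ u).Sat e ↔ t.eval e ≤ u.eval e := by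
  rw [Fm.le, Fm.sat_or, Fm.sat_lt, Fm.sat_eq, le_iff_lt_or_eq]

theorem lt_add_one_iff' {a b : M.C Ty.nat} : a < b + 1 ↔ a ≤ b := by
  have h01 : (0 : M.C Ty.nat) < 1 := M.ax .zero_lt_one
  have hadd : ∀ a b c : M.C Ty.nat, a < b → a + c < b + c := fun a b c => M.ax .add_lt_add a b c
  constructor
  · intro h
    simpa using M.ax .lt_succ a b (by simpa using h)
  · intro h
    refine h.trans_lt ?_
    have := hadd 0 1 b h01
    rwa [zero_add, add_comm] at this

instance Struc.isStrictOrderedRing : IsStrictOrderedRing (M.C Ty.nat) := by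
  have h01 : (0 : M.C Ty.nat) < 1 := M.ax .zero_lt_one
  have hadd : ∀ a b c : M.C Ty.nat, a < b → a + c < b + c := fun a b c => M.ax .add_lt_add a b c
  have hmul : ∀ a b c : M.C Ty.nat, a < b → 0 < c → a * c < b * c :=
    fun a b c => M.ax .mul_lt_mul a b c
  have hadd' : ∀ a b : M.C Ty.nat, a ≤ b → ∀ c, c + a ≤ c + b := by
    intro a b h c
    rcases h.eq_or_lt with rfl | h
    · rfl
    · rw [add_comm c, add_comm c]; exact (hadd a b c h).le
  have hcancel : ∀ a b c : M.C Ty.nat, a + b ≤ a + c → b ≤ c := by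
    intro a b c h
    by_contra hlt
    rw [not_le] at hlt
    have := hadd c b a hlt
    rw [add_comm c, add_comm b] at this
    exact absurd h (not_le.2 this)
  exact {
    add_le_add_left := fun a b h c => by rw [add_comm a, add_comm b]; exact hadd' a b h c
    le_of_add_le_add_left := hcancel
    zero_le_one := h01.le
    exists_pair_ne := ⟨0, 1, h01.ne⟩
    mul_lt_mul_of_pos_left := fun a ha b c h => by
      rw [mul_comm a, mul_comm a]; exact hmul _ _ _ h ha
    mul_lt_mul_of_pos_right := fun a ha b c h => hmul _ _ _ h ha }

theorem Struc.zero_le' (a : M.C Ty.nat) : 0 ≤ a := not_lt.1 (M.ax .not_lt_zero a)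

end


/-! ## Terms with parameters and abstraction -/

/-- Terms in which elements of a structure occur as parameters. -/
inductive PTm (M : Struc) (Γ : Ctx) : Ty → Type
  | var {σ : Ty} : Var Γ σ → PTm M Γ σ
  | cst {σ : Ty} : M.C σ → PTm M Γ σ
  | app {σ τ : Ty} : PTm M Γ (σ ⇒ τ) → PTm M Γ σ → PTm M Γ τ

prefix:max "♯" => PTm.cst

section
variable {M : Struc} {Γ : Ctx}

instance {σ τ : Ty} : CoeFun (PTm M Γ (σ ⇒ τ)) (fun _ => PTm M Γ σ → PTm M Γ τ) := ⟨PTm.app⟩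

def PTm.eval (e : M.Env Γ) : {σ : Ty} → PTm M Γ σ → M.C σ
  | _, PTm.var x => e _ x
  | _, PTm.cst a => a
  | _, PTm.app t u => M.app (t.eval e) (u.eval e)

/-- Abstraction of the innermost variable, by means of the combinators. -/
def PTm.lam {σ : Ty} : {τ : Ty} → PTm M (σ :: Γ) τ → PTm M Γ (σ ⇒ τ)
  -- The identity as `Σ Π Π`; the type `0` of the discarded argument is arbitrary.
  | _, PTm.var Var.z => ♯(M.app (M.app (M.S σ (Ty.nat ⇒ σ) σ) (M.K σ (Ty.nat ⇒ σ))) (M.K σ Ty.nat))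
  | _, PTm.var (Var.s x) => PTm.app ♯(M.K _ σ) (PTm.var x)
  | _, PTm.cst a => ♯(M.app (M.K _ σ) a)
  | _, PTm.app t u => PTm.app (PTm.app ♯(M.S σ _ _) t.lam) u.lam

/-- The variables, numbered from the innermost one. -/
abbrev PTm.v0 {σ : Ty} : PTm M (σ :: Γ) σ := .var .z
abbrev PTm.v1 {σ τ : Ty} : PTm M (τ :: σ :: Γ) σ := .var (.s .z)
abbrev PTm.v2 {σ τ ρ : Ty} : PTm M (ρ :: τ :: σ :: Γ) σ := .var (.s (.s .z))
abbrev PTm.v3 {σ τ ρ δ : Ty} : PTm M (δ :: ρ :: τ :: σ :: Γ) σ := .var (.s (.s (.s .z)))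
abbrev PTm.v4 {σ τ ρ δ ε : Ty} : PTm M (ε :: δ :: ρ :: τ :: σ :: Γ) σ :=
  .var (.s (.s (.s (.s .z))))

@[simp] theorem PTm.eval_cst {σ : Ty} (e : M.Env Γ) (a : M.C σ) : (♯a : PTm M Γ σ).eval e = a :=
  rfl

@[simp] theorem PTm.eval_app {σ τ : Ty} (e : M.Env Γ) (t : PTm M Γ (σ ⇒ τ)) (u : PTm M Γ σ) :
    (PTm.app t u).eval e = t.eval e (u.eval e) := rfl

@[simp] theorem PTm.eval_var_z {σ : Ty} (a : M.C σ) (e : M.Env Γ) :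
    (PTm.var (Var.z : Var (σ :: Γ) σ)).eval (Env.cons a e) = a := rfl

@[simp] theorem PTm.eval_var_s {σ τ : Ty} (x : Var Γ σ) (a : M.C τ) (e : M.Env Γ) :
    (PTm.var (Var.s x)).eval (Env.cons a e) = (PTm.var x).eval e := rfl

/-- The value of a closed term. -/
def PTm.val {σ : Ty} (t : PTm M [] σ) : M.C σ := t.eval Env.nil

end

section
variable {M : Struc} [hM : M.IsModel] {Γ : Ctx}

@[simp] theorem PTm.eval_lam {σ τ : Ty} (t : PTm M (σ :: Γ) τ) (e : M.Env Γ) (a : M.C σ) :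
    t.lam.eval e a = t.eval (Env.cons a e) := by
  induction t with
  | var x => cases x <;> simp [PTm.lam]
  | cst a => simp [PTm.lam]
  | app t u iht ihu => simp [PTm.lam, iht, ihu]

@[simp] theorem PTm.val_lam {σ τ : Ty} (t : PTm M [σ] τ) (a : M.C σ) :
    t.lam.val a = t.eval (Env.cons a Env.nil) := PTm.eval_lam t _ a

/-! ## The axioms of a model -/

open PTm

@[simp] theorem Struc.R_zero (f : M.C ty1) (m : M.C Ty.nat) : M.R Ty.nat f m 0 = m := by
  simpa [Struc.Models] using hM.models RCA0omegaAxiom.rec_zero f m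

@[simp] theorem Struc.R_succ (f : M.C ty1) (m n : M.C Ty.nat) :
    M.R Ty.nat f m (n + 1) = f (M.R Ty.nat f m n) := by
  simpa [Struc.Models] using hM.models RCA0omegaAxiom.rec_succ f m n

theorem qf_induction (A : Fm (Ty.nat :: Γ)) (hA : A.IsQF) (e : M.Env Γ)
    (h₀ : A.Sat (Env.cons 0 e))
    (hs : ∀ n, A.Sat (Env.cons n e) → A.Sat (Env.cons (n + 1) e)) (n : M.C Ty.nat) :
    A.Sat (Env.cons n e) := by
  have h := hM.models (RCA0omegaAxiom.induction Γ A hA)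
  rw [inductionFor, Struc.Models, Fm.sat_close] at h
  refine h e ((Fm.sat_inst A _ e).2 h₀) (fun n hn => ?_) n
  rw [Fm.sat_subst]
  convert hs n hn using 1
  funext σ x
  cases x <;> rfl

theorem qf_choice (A : Fm (Ty.nat :: ty1 :: Γ)) (hA : A.IsQF) (e : M.Env Γ)
    (h : ∀ x, ∃ y, A.Sat (Env.cons y (Env.cons x e))) :
    ∃ Y : M.C ty2, ∀ x, A.Sat (Env.cons (Y x) (Env.cons x e)) := by
  have hc := hM.models (RCA0omegaAxiom.choice Γ A hA)
  rw [choiceFor, Struc.Models, Fm.sat_close] at hc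
  have := hc e (fun x => (Fm.sat_ex _ _).2 (h x))
  rw [Fm.sat_ex] at this
  obtain ⟨Y, hY⟩ := this
  refine ⟨Y, fun x => ?_⟩
  have := hY x
  rw [Fm.sat_subst] at this
  convert this using 1
  funext σ y
  rcases y with _ | _ | y <;> rfl

theorem Fm.IsQF.neg {φ : Fm Γ} (h : φ.IsQF) : (∼φ).IsQF := .imp h .bot
theorem Fm.IsQF.or {φ ψ : Fm Γ} (h : φ.IsQF) (h' : ψ.IsQF) : (φ ⋎ ψ).IsQF := .imp h.neg h'
theorem Fm.IsQF.and {φ ψ : Fm Γ} (h : φ.IsQF) (h' : ψ.IsQF) : (φ ⋏ ψ).IsQF := (h.imp h'.neg).neg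

/-! ## Truncated subtraction -/

theorem add_one_le_iff' {a b : M.C Ty.nat} : a + 1 ≤ b ↔ a < b := by
  rw [← not_lt, lt_add_one_iff', not_le]

/-- The axioms contain no subtraction. If `a` were not of the form `b + c`, then quantifier-free
induction would give `b + n < a` for all `n`, which fails for `n = a`. -/
theorem exists_add_of_le' {a b : M.C Ty.nat} (h : b ≤ a) : ∃ c, a = b + c := by
  by_contra! hne
  have key := qf_induction (M := M) (Γ := [Ty.nat, Ty.nat])
    (Tm.var (.s .z) ⊕ₙ Tm.var .z ≺ Tm.var (.s (.s .z))) (.lt _ _)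
    (Env.cons b (Env.cons a Env.nil))
    (by simpa using lt_of_le_of_ne h (fun h => hne 0 (by simp [h])))
    (fun n hn => by
      simp only [Fm.sat_lt, Tm.eval_plus, Tm.eval_var_z, Tm.eval_var_s] at hn ⊢
      rw [← add_assoc]
      exact lt_of_le_of_ne (add_one_le_iff'.2 hn) (fun h => hne (n + 1) (by rw [← h, add_assoc])))
    a
  simp only [Fm.sat_lt, Tm.eval_plus, Tm.eval_var_z, Tm.eval_var_s] at key
  have h0 := Struc.zero_le' b
  have : 0 + a ≤ b + a := add_le_add_left h0 a
  rw [zero_add] at this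
  exact absurd key (not_lt.2 this)

theorem exists_sub : ∃ s : M.C (Ty.nat ⇒ Ty.nat ⇒ Ty.nat), ∀ a b,
    (b ≤ a → b + s a b = a) ∧ (a < b → s a b = 0) := by
  -- The choice axiom has a single argument of type 1, so the pair `(a, b)` is passed as the
  -- function `n ↦ a + b * n`. Its values at `0` and `1` are `a` and `a + b`, and `a = b + y`
  -- becomes `x 0 + x 0 = x 1 + y`.
  let x₀ : Tm [Ty.nat, ty1] Ty.nat := Tm.var (.s .z) ⬝ Tm.zero
  let x₁ : Tm [Ty.nat, ty1] Ty.nat := Tm.var (.s .z) ⬝ Tm.one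
  obtain ⟨Y, hY⟩ := qf_choice (M := M) (Γ := [])
    ((x₀ ⊕ₙ x₀ ≐ x₁ ⊕ₙ Tm.var .z) ⋎ ((x₀ ⊕ₙ x₀ ≺ x₁) ⋏ (Tm.var .z ≐ Tm.zero)))
    (.or (.eq _ _) (.and (.lt _ _) (.eq _ _))) Env.nil (fun x => by
      simp only [x₀, x₁, Fm.sat_or, Fm.sat_and, Fm.sat_eq, Fm.sat_lt, Tm.eval_plus,
        Tm.eval_app, Tm.eval_var_z, Tm.eval_var_s, Tm.eval_zero, Tm.eval_one]
      rcases le_or_gt (x 1) (x 0 + x 0) with h | h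
      · obtain ⟨c, hc⟩ := exists_add_of_le' h
        exact ⟨c, .inl hc⟩
      · exact ⟨0, .inr ⟨h, rfl⟩⟩)
  refine ⟨(lam (lam (♯Y (lam (♯M.add (♯M.add v2 ♯0) (♯M.mul v1 v0)))))).val, fun a b => ?_⟩
  have hf := hY ((lam (♯M.add (♯M.add v2 ♯0) (♯M.mul v1 v0))).eval
    (Env.cons b (Env.cons a Env.nil)))
  simp only [x₀, x₁, Fm.sat_or, Fm.sat_and, Fm.sat_eq, Fm.sat_lt, Tm.eval_plus,
    Tm.eval_app, Tm.eval_var_z, Tm.eval_var_s, Tm.eval_zero, Tm.eval_one, eval_lam,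
    PTm.eval_app, PTm.eval_cst, PTm.eval_var_z, PTm.eval_var_s, Struc.add_app, Struc.mul_app,
    mul_zero, mul_one, add_zero, add_assoc] at hf
  simp only [val_lam, eval_lam, PTm.eval_app, PTm.eval_cst]
  rcases hf with hf | ⟨hf, hf'⟩
  · have hf := add_left_cancel hf
    refine ⟨fun _ => hf.symm, fun h => ?_⟩
    have h₁ : b ≤ a := by
      rw [hf]; exact le_add_of_nonneg_right (Struc.zero_le' _)
    exact absurd h (not_lt.2 h₁)
  · have hf := lt_of_add_lt_add_left hf
    exact ⟨fun h => absurd hf (not_lt.2 h), fun _ => hf'⟩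

/-- Truncated subtraction, as an element of the model. -/
noncomputable def Struc.sub : M.C (Ty.nat ⇒ Ty.nat ⇒ Ty.nat) := (exists_sub (M := M)).choose

noncomputable instance : _root_.Sub (M.C Ty.nat) := ⟨fun a b => Struc.sub a b⟩

@[simp] theorem Struc.sub_app (a b : M.C Ty.nat) : Struc.sub a b = a - b := rfl

instance : CanonicallyOrderedAdd (M.C Ty.nat) where
  exists_add_of_le := exists_add_of_le'
  le_self_add _ b := le_add_of_nonneg_right (Struc.zero_le' b)
  le_add_self _ b := le_add_of_nonneg_left (Struc.zero_le' b)

instance : OrderedSub (M.C Ty.nat) where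
  tsub_le_iff_right a b c := by
    have h := (exists_sub (M := M)).choose_spec a b
    change (b ≤ a → b + (a - b) = a) ∧ (a < b → a - b = 0) at h
    rcases le_or_gt b a with hab | hab
    · conv_rhs => rw [← h.1 hab, add_comm b]
      exact (add_le_add_iff_right b).symm
    · rw [h.2 hab]
      exact iff_of_true (Struc.zero_le' c) (hab.le.trans (le_add_self))

end


/-! ## The ordered field of fractions of an ordered semiring -/

section
variable (N : Type) [CommSemiring N] [LinearOrder N] [IsStrictOrderedRing N]

/-- A representation of the fraction `(a - b) / d`. -/
structure FracRep where
  a : N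
  b : N
  d : N
  pos : 0 < d

variable {N}

def FracRep.Le (x y : FracRep N) : Prop := x.a * y.d + y.b * x.d ≤ y.a * x.d + x.b * y.d

theorem FracRep.Le.trans {x y z : FracRep N} (h : x.Le y) (h' : y.Le z) : x.Le z := by
  unfold FracRep.Le at *
  refine le_of_mul_le_mul_right ?_ y.pos
  have h₁ := mul_le_mul_of_nonneg_right h z.pos.le
  have h₂ := mul_le_mul_of_nonneg_right h' x.pos.le
  have h₃ := add_le_add h₁ h₂
  refine le_of_add_le_add_right (a := y.b * x.d * z.d + y.a * z.d * x.d) ?_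
  convert h₃ using 1 <;> ring

variable (N) in
instance FracRep.setoid : Setoid (FracRep N) where
  r x y := x.Le y ∧ y.Le x
  iseqv := ⟨fun x => by simp [FracRep.Le], fun h => h.symm,
    fun h h' => ⟨h.1.trans h'.1, h'.2.trans h.2⟩⟩

theorem FracRep.equiv_iff {x y : FracRep N} :
    x ≈ y ↔ x.a * y.d + y.b * x.d = y.a * x.d + x.b * y.d :=
  ⟨fun h => le_antisymm h.1 h.2, fun h => ⟨h.le, h.ge⟩⟩

variable (N) in
/-- The ordered field of fractions `(a - b) / d`. -/
def Frac : Type := Quotient (FracRep.setoid N)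

namespace Frac

def mk (x : FracRep N) : Frac N := Quotient.mk _ x

theorem mk_eq_mk {x y : FracRep N} :
    mk x = mk y ↔ x.a * y.d + y.b * x.d = y.a * x.d + x.b * y.d :=
  Quotient.eq.trans FracRep.equiv_iff

theorem ind {p : Frac N → Prop} (h : ∀ x, p (mk x)) (x : Frac N) : p x := Quotient.ind h x

instance : Zero (Frac N) := ⟨mk ⟨0, 0, 1, zero_lt_one⟩⟩
instance : One (Frac N) := ⟨mk ⟨1, 0, 1, zero_lt_one⟩⟩

theorem zero_def : (0 : Frac N) = mk ⟨0, 0, 1, zero_lt_one⟩ := rfl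
theorem one_def : (1 : Frac N) = mk ⟨1, 0, 1, zero_lt_one⟩ := rfl

instance : Neg (Frac N) :=
  ⟨Quotient.map (fun x => ⟨x.b, x.a, x.d, x.pos⟩) fun x y h => by
    rw [FracRep.equiv_iff] at h ⊢
    dsimp only
    rw [add_comm, add_comm (y.b * _)]; exact h.symm⟩

instance : Add (Frac N) :=
  ⟨Quotient.map₂ (fun x y => ⟨x.a * y.d + y.a * x.d, x.b * y.d + y.b * x.d, x.d * y.d,
    mul_pos x.pos y.pos⟩) fun x x' hx y y' hy => by
    rw [FracRep.equiv_iff] at hx hy ⊢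
    have h₁ := congrArg (· * (y.d * y'.d)) hx
    have h₂ := congrArg (· * (x.d * x'.d)) hy
    have := congrArg₂ (· + ·) h₁ h₂
    dsimp only at this ⊢
    convert this using 1 <;> ring⟩

instance : Mul (Frac N) :=
  ⟨Quotient.map₂ (fun x y => ⟨x.a * y.a + x.b * y.b, x.a * y.b + x.b * y.a, x.d * y.d,
    mul_pos x.pos y.pos⟩) fun x x' hx y y' hy => by
    rw [FracRep.equiv_iff] at hx hy ⊢
    have h₁ := congrArg (· * (y.a * y'.d)) hx
    have h₁' := congrArg (· * (y.b * y'.d)) hx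
    have h₂ := congrArg (· * (x'.a * x.d)) hy
    have h₂' := congrArg (· * (x'.b * x.d)) hy
    have := congrArg₂ (· + ·) (congrArg₂ (· + ·) h₁ h₁'.symm) (congrArg₂ (· + ·) h₂ h₂'.symm)
    dsimp only at this ⊢
    -- Without subtraction, the mixed terms common to the four multiples of the hypotheses are added
    -- to both sides and cancelled.
    refine add_right_cancel (b := x'.b * x.d * y.a * y'.d + x'.a * x.d * y.b * y'.d +
      (x'.a * x.d * y.a * y'.d + x'.b * x.d * y.b * y'.d)) ?_
    convert this using 1 <;> ring⟩

theorem neg_mk (x : FracRep N) : -mk x = mk ⟨x.b, x.a, x.d, x.pos⟩ := rfl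
theorem mk_add_mk (x y : FracRep N) : mk x + mk y =
    mk ⟨x.a * y.d + y.a * x.d, x.b * y.d + y.b * x.d, x.d * y.d, mul_pos x.pos y.pos⟩ := rfl
theorem mk_mul_mk (x y : FracRep N) : mk x * mk y =
    mk ⟨x.a * y.a + x.b * y.b, x.a * y.b + x.b * y.a, x.d * y.d, mul_pos x.pos y.pos⟩ := rfl

instance commRing : CommRing (Frac N) where
  nsmul := nsmulRec
  zsmul := zsmulRec
  add_assoc x y z := by
    induction x using ind; induction y using ind; induction z using ind
    simp only [mk_add_mk, mk_eq_mk]; ring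
  add_comm x y := by
    induction x using ind; induction y using ind
    simp only [mk_add_mk, mk_eq_mk]; ring
  zero_add x := by
    induction x using ind
    simp only [zero_def, mk_add_mk, mk_eq_mk]; ring
  add_zero x := by
    induction x using ind
    simp only [zero_def, mk_add_mk, mk_eq_mk]; ring
  neg_add_cancel x := by
    induction x using ind
    simp only [zero_def, neg_mk, mk_add_mk, mk_eq_mk]; ring
  mul_assoc x y z := by
    induction x using ind; induction y using ind; induction z using ind
    simp only [mk_mul_mk, mk_eq_mk]; ring
  mul_comm x y := by
    induction x using ind; induction y using ind
    simp only [mk_mul_mk, mk_eq_mk]; ring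
  zero_mul x := by
    induction x using ind
    simp only [zero_def, mk_mul_mk, mk_eq_mk]; ring
  mul_zero x := by
    induction x using ind
    simp only [zero_def, mk_mul_mk, mk_eq_mk]; ring
  one_mul x := by
    induction x using ind
    simp only [one_def, mk_mul_mk, mk_eq_mk]; ring
  mul_one x := by
    induction x using ind
    simp only [one_def, mk_mul_mk, mk_eq_mk]; ring
  left_distrib x y z := by
    induction x using ind; induction y using ind; induction z using ind
    simp only [mk_mul_mk, mk_add_mk, mk_eq_mk]; ring
  right_distrib x y z := by
    induction x using ind; induction y using ind; induction z using ind
    simp only [mk_mul_mk, mk_add_mk, mk_eq_mk]; ring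

instance : LE (Frac N) :=
  ⟨Quotient.lift₂ FracRep.Le fun _ _ _ _ h h' =>
    propext ⟨fun k => (h.2.trans k).trans h'.1, fun k => (h.1.trans k).trans h'.2⟩⟩

theorem mk_le_mk {x y : FracRep N} :
    mk x ≤ mk y ↔ x.a * y.d + y.b * x.d ≤ y.a * x.d + x.b * y.d := Iff.rfl

noncomputable instance linearOrder : LinearOrder (Frac N) where
  le_refl x := by induction x using ind; rw [mk_le_mk]
  le_trans x y z := by
    induction x using ind; induction y using ind; induction z using ind
    exact FracRep.Le.trans
  le_antisymm x y := by
    induction x using ind; induction y using ind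
    intro h h'
    exact mk_eq_mk.2 (le_antisymm h h')
  le_total x y := by
    induction x using ind; induction y using ind
    exact _root_.le_total (_ : N) _
  toDecidableLE := Classical.decRel _

theorem mk_lt_mk {x y : FracRep N} :
    mk x < mk y ↔ x.a * y.d + y.b * x.d < y.a * x.d + x.b * y.d := by
  rw [← not_le, mk_le_mk, ← not_le]

instance : Nontrivial (Frac N) := ⟨0, 1, by simp [zero_def, one_def, mk_eq_mk]⟩

/-- The embedding of the semiring. -/
@[coe] def of (n : N) : Frac N := mk ⟨n, 0, 1, zero_lt_one⟩

instance : CoeTail N (Frac N) := ⟨of⟩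

@[simp, norm_cast] theorem coe_zero : ((0 : N) : Frac N) = 0 := rfl
@[simp, norm_cast] theorem coe_one : ((1 : N) : Frac N) = 1 := rfl
@[simp, norm_cast] theorem coe_add (a b : N) : ((a + b : N) : Frac N) = a + b := by
  simp [of, mk_add_mk]
@[simp, norm_cast] theorem coe_mul (a b : N) : ((a * b : N) : Frac N) = a * b := by
  simp [of, mk_mul_mk]
@[simp, norm_cast] theorem coe_le {a b : N} : (a : Frac N) ≤ b ↔ a ≤ b := by
  simp [of, mk_le_mk]
@[simp, norm_cast] theorem coe_lt {a b : N} : (a : Frac N) < b ↔ a < b := by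
  simp [of, mk_lt_mk]
@[simp, norm_cast] theorem coe_inj {a b : N} : (a : Frac N) = b ↔ a = b := by
  simp [of, mk_eq_mk]
@[simp, norm_cast] theorem coe_ofNat (n : ℕ) [n.AtLeastTwo] :
    ((OfNat.ofNat n : N) : Frac N) = OfNat.ofNat n := by
  have h : ∀ n : ℕ, ((n : N) : Frac N) = n := fun n => by
    induction n with
    | zero => simp
    | succ n ih => rw [Nat.cast_succ, coe_add, ih, coe_one, Nat.cast_succ]
  exact h n

variable [ExistsAddOfLE N]

instance : IsStrictOrderedRing (Frac N) := by
  have : IsOrderedAddMonoid (Frac N) := ⟨fun x y h z => by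
    induction x using ind; induction y using ind; induction z using ind
    rename_i x y z
    rw [mk_le_mk] at h
    rw [mk_add_mk, mk_add_mk, mk_le_mk]
    dsimp only
    have := mul_le_mul_of_nonneg_right h (mul_pos z.pos z.pos).le
    refine le_trans (le_of_eq ?_) ((add_le_add_left this
      ((z.a + z.b) * x.d * y.d * z.d)).trans (le_of_eq ?_)) <;> ring, fun x y h z => by
    induction x using ind; induction y using ind; induction z using ind
    rename_i x y z
    rw [mk_le_mk] at h
    rw [mk_add_mk, mk_add_mk, mk_le_mk]
    dsimp only
    have := mul_le_mul_of_nonneg_right h (mul_pos z.pos z.pos).le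
    refine le_trans (le_of_eq ?_) ((add_le_add_left this
      ((z.a + z.b) * x.d * y.d * z.d)).trans (le_of_eq ?_)) <;> ring⟩
  have : ZeroLEOneClass (Frac N) := ⟨by
    rw [zero_def, one_def, mk_le_mk]; simp⟩
  refine IsStrictOrderedRing.of_mul_pos fun x y hx hy => ?_
  induction x using ind; induction y using ind
  rename_i x y
  rw [zero_def, mk_lt_mk] at hx hy
  rw [zero_def, mk_mul_mk, mk_lt_mk]
  simp only [zero_mul, mul_one, zero_add, add_zero] at hx hy ⊢
  exact mul_add_mul_lt_mul_add_mul' hx hy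

/-- The sign of `(a - b) / d` tells which of `a` and `b` is larger; their difference is then a
positive element of the semiring and serves as the denominator of the inverse. -/
theorem exists_mul_eq_one {x : Frac N} (hx : x ≠ 0) : ∃ y, x * y = 1 := by
  induction x using ind
  rename_i x
  rw [zero_def, Ne, mk_eq_mk] at hx
  simp only [zero_mul, mul_one, zero_add, add_zero] at hx
  rcases lt_or_gt_of_ne hx with h | h
  · obtain ⟨c, hc⟩ := exists_add_of_le h.le
    have hpos : 0 < c := by rw [hc] at h; exact pos_of_lt_add_right h
    refine ⟨mk ⟨0, x.d, c, hpos⟩, ?_⟩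
    rw [mk_mul_mk, one_def, mk_eq_mk]
    simp only [hc]; ring
  · obtain ⟨c, hc⟩ := exists_add_of_le h.le
    have hpos : 0 < c := by rw [hc] at h; exact pos_of_lt_add_right h
    refine ⟨mk ⟨x.d, 0, c, hpos⟩, ?_⟩
    rw [mk_mul_mk, one_def, mk_eq_mk]
    simp only [hc]; ring

open Classical in
noncomputable instance : Inv (Frac N) :=
  ⟨fun x => if h : x ≠ 0 then (exists_mul_eq_one h).choose else 0⟩

noncomputable instance field : Field (Frac N) where
  mul_inv_cancel x hx := by
    change x * dite _ _ _ = 1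
    rw [dif_pos hx]; exact (exists_mul_eq_one hx).choose_spec
  inv_zero := dif_neg (by simp)
  nnqsmul := _
  qsmul := _

theorem coe_sub [_root_.Sub N] [OrderedSub N] {a b : N} (h : b ≤ a) :
    ((a - b : N) : Frac N) = a - b := by
  rw [eq_sub_iff_add_eq, ← coe_add, tsub_add_cancel_of_le h]

end Frac
end

/-! ### Inequalities between numbers of a model, read in the ordered field. -/

section
variable {M : Struc} [hM : M.IsModel] {a b : M.C Ty.nat}

/-- The ordered field generated by the numbers of a model. -/
abbrev Struc.Q (M : Struc) [M.IsModel] : Type := Frac (M.C Ty.nat)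

theorem nat_le : a ≤ b ↔ (a : M.Q) ≤ b := Frac.coe_le.symm
-- Discreteness: a strict inequality between numbers has a gap of `1`. In this form it is usable by
-- linear arithmetic over a field.
theorem nat_lt : a < b ↔ (a : M.Q) + 1 ≤ b := by rw [← add_one_le_iff', nat_le]; simp
theorem nat_eq : a = b ↔ (a : M.Q) = b := Frac.coe_inj.symm
@[simp, norm_cast] theorem coe_two : ((2 : M.C Ty.nat) : M.Q) = 2 := Frac.coe_ofNat 2
theorem coe_nonneg (a : M.C Ty.nat) : (0 : M.Q) ≤ a := by
  rw [← Frac.coe_zero, Frac.coe_le]; exact Struc.zero_le' a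

end

/-! ## Bounded formulas as terms

A term `t` of type `0` stands for the formula `t = 0`. -/

infixl:90 " ◦ " => PTm.app

namespace PTm

section
variable {M : Struc} {Γ : Ctx}

instance : Zero (PTm M Γ Ty.nat) := ⟨♯0⟩
instance : One (PTm M Γ Ty.nat) := ⟨♯1⟩
instance : Add (PTm M Γ Ty.nat) := ⟨fun t u => ♯M.add t u⟩
instance : Mul (PTm M Γ Ty.nat) := ⟨fun t u => ♯M.mul t u⟩

@[simp] theorem eval_zero (e : M.Env Γ) : (0 : PTm M Γ Ty.nat).eval e = 0 := rfl
@[simp] theorem eval_one (e : M.Env Γ) : (1 : PTm M Γ Ty.nat).eval e = 1 := rfl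
@[simp] theorem eval_add (e : M.Env Γ) (t u : PTm M Γ Ty.nat) :
    (t + u).eval e = t.eval e + u.eval e := rfl
@[simp] theorem eval_mul (e : M.Env Γ) (t u : PTm M Γ Ty.nat) :
    (t * u).eval e = t.eval e * u.eval e := rfl

end

section
variable {M : Struc} [hM : M.IsModel] {Γ : Ctx}

noncomputable instance : _root_.Sub (PTm M Γ Ty.nat) := ⟨fun t u => ♯Struc.sub t u⟩

@[simp] theorem eval_sub (e : M.Env Γ) (t u : PTm M Γ Ty.nat) :
    (t - u).eval e = t.eval e - u.eval e := rfl

noncomputable def tle (t u : PTm M Γ Ty.nat) : PTm M Γ Ty.nat := t - u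
noncomputable def tlt (t u : PTm M Γ Ty.nat) : PTm M Γ Ty.nat := (t + 1) - u
noncomputable def teq (t u : PTm M Γ Ty.nat) : PTm M Γ Ty.nat := (t - u) + (u - t)
noncomputable def tnot (t : PTm M Γ Ty.nat) : PTm M Γ Ty.nat := 1 - t
noncomputable def tand (t u : PTm M Γ Ty.nat) : PTm M Γ Ty.nat := t + u
noncomputable def tor (t u : PTm M Γ Ty.nat) : PTm M Γ Ty.nat := t * u
noncomputable def timp (t u : PTm M Γ Ty.nat) : PTm M Γ Ty.nat := (1 - t) * u
/-- The definition by cases: `t` if `c = 0`, and `u` otherwise. -/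
noncomputable def tite (c t u : PTm M Γ Ty.nat) : PTm M Γ Ty.nat :=
  (1 - c) * t + (1 - (1 - c)) * u

variable (e : M.Env Γ) (t u c : PTm M Γ Ty.nat)

theorem one_sub_eq_zero {a : M.C Ty.nat} : 1 - a = 0 ↔ a ≠ 0 := by
  rw [tsub_eq_zero_iff_le, ← zero_add (1 : M.C Ty.nat), add_one_le_iff', pos_iff_ne_zero]

@[simp] theorem eval_le : (tle t u).eval e = 0 ↔ t.eval e ≤ u.eval e := by
  rw [tle, eval_sub, tsub_eq_zero_iff_le]
@[simp] theorem eval_lt : (tlt t u).eval e = 0 ↔ t.eval e < u.eval e := by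
  rw [tlt, eval_sub, tsub_eq_zero_iff_le, eval_add, eval_one, add_one_le_iff']
@[simp] theorem eval_eq : (teq t u).eval e = 0 ↔ t.eval e = u.eval e := by
  rw [teq, eval_add, add_eq_zero, eval_sub, eval_sub, tsub_eq_zero_iff_le, tsub_eq_zero_iff_le,
    le_antisymm_iff]
@[simp] theorem eval_not : (tnot t).eval e = 0 ↔ ¬ t.eval e = 0 := by
  rw [tnot, eval_sub, eval_one, one_sub_eq_zero]
@[simp] theorem eval_and : (tand t u).eval e = 0 ↔ t.eval e = 0 ∧ u.eval e = 0 := by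
  rw [tand, eval_add, add_eq_zero]
@[simp] theorem eval_or : (tor t u).eval e = 0 ↔ t.eval e = 0 ∨ u.eval e = 0 := by
  rw [tor, eval_mul, mul_eq_zero]
@[simp] theorem eval_imp : (timp t u).eval e = 0 ↔ (t.eval e = 0 → u.eval e = 0) := by
  rw [timp, eval_mul, mul_eq_zero, eval_sub, eval_one, one_sub_eq_zero]; tauto
@[simp] theorem eval_ite :
    (tite c t u).eval e = if c.eval e = 0 then t.eval e else u.eval e := by
  rw [tite, eval_add, eval_mul, eval_mul, eval_sub, eval_sub, eval_sub, eval_one]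
  split_ifs with h
  · simp [h]
  · rw [one_sub_eq_zero.2 h]; simp

end
end PTm

/-! ### Arithmetic inside a model from recursion and quantifier-free choice. -/

section
variable {M : Struc} [hM : M.IsModel]
open PTm

/-! ## Induction, least numbers, bounded quantifiers -/

/-- The predicate `P` has a characteristic function in the model. -/
def Dec (P : M.C Ty.nat → Prop) : Prop := ∃ a : M.C ty1, ∀ n, a n = 0 ↔ P n

/-- Quantifier-free induction with the characteristic function as parameter. Every later induction
in a model exhibits such a function as a combinator term. -/
theorem Dec.induction {P : M.C Ty.nat → Prop} (h : Dec P) (h₀ : P 0)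
    (hs : ∀ n, P n → P (n + 1)) (n : M.C Ty.nat) : P n := by
  obtain ⟨a, ha⟩ := h
  have := qf_induction (M := M) (Γ := [ty1]) (Tm.var (.s .z) ⬝ Tm.var .z ≐ Tm.zero) (.eq _ _)
    (Env.cons a Env.nil) (by simpa [ha] using h₀) (by simpa [ha] using hs) n
  simpa [ha] using this

theorem exists_eq_add_one {n : M.C Ty.nat} (h : n ≠ 0) : ∃ m, n = m + 1 :=
  ⟨n - 1, (tsub_add_cancel_of_le (by
    rw [← zero_add (1 : M.C Ty.nat), add_one_le_iff', pos_iff_ne_zero]; exact h)).symm⟩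

/-- Bounded search: the least zero of `a` below `n`, or `n` if there is none. -/
noncomputable def Struc.bmin : M.C (ty1 ⇒ Ty.nat ⇒ Ty.nat) :=
  (lam (♯(M.R Ty.nat) (lam (tite (v1 ◦ v0) v0 (v0 + 1))) 0)).val

theorem bmin_zero (a : M.C ty1) : Struc.bmin a 0 = 0 := by simp [Struc.bmin]

/-- The recursor passes on the previous value but not the counter. The value itself does the
counting: it increases by one until it meets a zero and then stays there. -/
theorem bmin_succ (a : M.C ty1) (n : M.C Ty.nat) : Struc.bmin a (n + 1) =
    if a (Struc.bmin a n) = 0 then Struc.bmin a n else Struc.bmin a n + 1 := by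
  simp only [Struc.bmin, val_lam, PTm.eval_app, eval_cst, Struc.R_succ, eval_lam, eval_ite]
  rfl

theorem bmin_le (a : M.C ty1) (n : M.C Ty.nat) : Struc.bmin a n ≤ n := by
  refine Dec.induction (P := fun n => Struc.bmin a n ≤ n)
    ⟨(lam (tle (♯Struc.bmin ♯a v0) v0)).val, by simp⟩ (by rw [bmin_zero]) (fun n ih => ?_) n
  rw [bmin_succ]
  split_ifs
  · exact ih.trans le_self_add
  · exact add_le_add_left ih 1

theorem bmin_spec (a : M.C ty1) (n : M.C Ty.nat) :
    Struc.bmin a n = n ∨ a (Struc.bmin a n) = 0 := by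
  refine Dec.induction (P := fun n => Struc.bmin a n = n ∨ a (Struc.bmin a n) = 0)
    ⟨(lam (tor (teq (♯Struc.bmin ♯a v0) v0) (♯a (♯Struc.bmin ♯a v0)))).val, by simp⟩
    (by simp [bmin_zero]) (fun n ih => ?_) n
  rw [bmin_succ]
  split_ifs with h
  · exact .inr h
  · exact .inl (by rw [ih.resolve_right h])

theorem bmin_add {a : M.C ty1} {m : M.C Ty.nat} (hm : a m = 0) (k : M.C Ty.nat) :
    Struc.bmin a (m + k) = Struc.bmin a m := by
  have h0 : a (Struc.bmin a m) = 0 := by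
    rcases bmin_spec a m with h | h
    · rw [h, hm]
    · exact h
  refine Dec.induction (P := fun k => Struc.bmin a (m + k) = Struc.bmin a m)
    ⟨(lam (teq (♯Struc.bmin ♯a (♯m + v0)) (♯Struc.bmin ♯a ♯m))).val, by simp⟩
    (by rw [add_zero]) (fun k ih => ?_) k
  rw [← add_assoc, bmin_succ, if_pos (by rw [ih, h0]), ih]

theorem bmin_le_of {a : M.C ty1} {m : M.C Ty.nat} (hm : a m = 0) (n : M.C Ty.nat) :
    Struc.bmin a n ≤ m := by
  rcases le_total m n with h | h
  · obtain ⟨k, rfl⟩ := exists_add_of_le h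
    rw [bmin_add hm]; exact bmin_le a m
  · exact (bmin_le a n).trans h

theorem bmin_zero_of {a : M.C ty1} {m n : M.C Ty.nat} (hm : a m = 0) (h : m ≤ n) :
    a (Struc.bmin a n) = 0 := by
  rcases bmin_spec a n with h' | h'
  · have := bmin_le_of hm n
    rw [h'] at this ⊢
    rwa [← le_antisymm h this]
  · exact h'

theorem Dec.least {P : M.C Ty.nat → Prop} (h : Dec P) {n : M.C Ty.nat} (hn : P n) :
    ∃ m ≤ n, P m ∧ ∀ k < m, ¬ P k := by
  obtain ⟨a, ha⟩ := h
  refine ⟨Struc.bmin a n, bmin_le a n, (ha _).1 (bmin_zero_of ((ha n).2 hn) le_rfl),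
    fun k hk hP => ?_⟩
  exact absurd hk (not_lt.2 (bmin_le_of ((ha k).2 hP) n))

/-- The characteristic function of `∃ i < n, a i = 0`. -/
noncomputable def Struc.bex : M.C (ty1 ⇒ Ty.nat ⇒ Ty.nat) :=
  (lam (lam (tlt (♯Struc.bmin v1 v0) v0))).val

theorem bex_iff (a : M.C ty1) (n : M.C Ty.nat) : Struc.bex a n = 0 ↔ ∃ i < n, a i = 0 := by
  simp only [Struc.bex, val_lam, eval_lam, eval_lt, PTm.eval_app, eval_cst, PTm.eval_var_z,
    PTm.eval_var_s]
  constructor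
  · intro h
    exact ⟨_, h, (bmin_spec a n).resolve_left h.ne⟩
  · rintro ⟨i, hi, h⟩
    exact (bmin_le_of h n).trans_lt hi

namespace PTm
variable {Γ : Ctx}

/-- `∃ i < n, t i`. -/
noncomputable def tex (n : PTm M Γ Ty.nat) (t : PTm M (Ty.nat :: Γ) Ty.nat) : PTm M Γ Ty.nat :=
  ♯Struc.bex (lam t) n
/-- `∀ i < n, t i`. -/
noncomputable def tall (n : PTm M Γ Ty.nat) (t : PTm M (Ty.nat :: Γ) Ty.nat) : PTm M Γ Ty.nat :=
  tnot (tex n (tnot t))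
/-- The least `i < n` with `t i`, or `n` if there is none. -/
noncomputable def tmu (n : PTm M Γ Ty.nat) (t : PTm M (Ty.nat :: Γ) Ty.nat) : PTm M Γ Ty.nat :=
  ♯Struc.bmin (lam t) n

@[simp] theorem eval_ex (e : M.Env Γ) (n : PTm M Γ Ty.nat) (t : PTm M (Ty.nat :: Γ) Ty.nat) :
    (tex n t).eval e = 0 ↔ ∃ i < n.eval e, t.eval (Env.cons i e) = 0 := by
  simp [tex, bex_iff]

@[simp] theorem eval_all (e : M.Env Γ) (n : PTm M Γ Ty.nat) (t : PTm M (Ty.nat :: Γ) Ty.nat) :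
    (tall n t).eval e = 0 ↔ ∀ i < n.eval e, t.eval (Env.cons i e) = 0 := by
  simp [tall]

theorem eval_mu_zero {e : M.Env Γ} {n : PTm M Γ Ty.nat} {t : PTm M (Ty.nat :: Γ) Ty.nat}
    {m : M.C Ty.nat} (h : t.eval (Env.cons m e) = 0) (hm : m ≤ n.eval e) :
    t.eval (Env.cons ((tmu n t).eval e) e) = 0 := by
  have := bmin_zero_of (a := (lam t).eval e) (m := m) (by simpa using h) hm
  simpa [tmu] using this

theorem eval_mu_le {e : M.Env Γ} {n : PTm M Γ Ty.nat} {t : PTm M (Ty.nat :: Γ) Ty.nat}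
    {m : M.C Ty.nat} (h : t.eval (Env.cons m e) = 0) : (tmu n t).eval e ≤ m := by
  have := bmin_le_of (a := (lam t).eval e) (m := m) (by simpa using h) (n.eval e)
  simpa [tmu] using this

end PTm

/-! ## Choice and bounding -/

theorem choice_fun (a : M.C (ty1 ⇒ Ty.nat ⇒ Ty.nat)) (h : ∀ x, ∃ y, a x y = 0) :
    ∃ Y : M.C ty2, ∀ x, a x (Y x) = 0 := by
  have := qf_choice (M := M) (Γ := [ty1 ⇒ Ty.nat ⇒ Ty.nat])
    (Tm.var (.s (.s .z)) ⬝ Tm.var (.s .z) ⬝ Tm.var .z ≐ Tm.zero) (.eq _ _)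
    (Env.cons a Env.nil) (by simpa using h)
  simpa using this

/-- Choice over numbers reduces to choice over functions by coding a number as a constant function.
-/
theorem choice_nat (a : M.C (Ty.nat ⇒ Ty.nat ⇒ Ty.nat)) (h : ∀ x, ∃ y, a x y = 0) :
    ∃ Y : M.C ty1, ∀ x, a x (Y x) = 0 := by
  obtain ⟨Y, hY⟩ := choice_fun (lam (lam (♯a (v1 ◦ 0) v0))).val (by simpa using fun x : M.C ty1 => h (x 0))
  refine ⟨(lam (♯Y (lam v1))).val, fun x => ?_⟩
  simpa using hY ((lam v1).eval (Env.cons x Env.nil))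

/-- "Some `B` is a bound" is an unbounded existential statement and not available for induction. The
induction therefore asserts that the maximum is attained at some place below `k`, which has bounded
quantifiers only. -/
theorem exists_bound (Y : M.C ty1) (k : M.C Ty.nat) : ∃ B, ∀ i < k, Y i ≤ B := by
  have key := Dec.induction (P := fun k => k = 0 ∨ ∃ i < k, ∀ j < k, Y j ≤ Y i)
    ⟨(lam (tor (teq v0 0) (tex v0 (tall v1 (tle (♯Y v0) (♯Y v1)))))).val, by simp⟩ (.inl rfl)
    (fun k ih => .inr ?_) k
  · rcases key with rfl | ⟨i, _, hi⟩
    · exact ⟨0, fun i hi => absurd hi (not_lt.2 (Struc.zero_le' i))⟩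
    · exact ⟨_, hi⟩
  · have hk : k < k + 1 := lt_add_one_iff'.2 le_rfl
    rcases ih with rfl | ⟨i, hik, hi⟩
    · refine ⟨0, hk, fun j hj => ?_⟩
      rw [le_antisymm (lt_add_one_iff'.1 hj) (Struc.zero_le' j)]
    · rcases le_total (Y k) (Y i) with h | h
      · refine ⟨i, hik.trans hk, fun j hj => ?_⟩
        rcases (lt_add_one_iff'.1 hj).eq_or_lt with rfl | hj
        · exact h
        · exact hi j hj
      · refine ⟨k, hk, fun j hj => ?_⟩
        rcases (lt_add_one_iff'.1 hj).eq_or_lt with rfl | hj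
        · exact le_rfl
        · exact (hi j hj).trans h

/-! ## Powers of two, division, logarithm -/

end

section
variable {M : Struc}

/-- The function `n ↦ 2 ^ n`. -/
def Struc.pow : M.C ty1 := M.R Ty.nat (double.eval (Env.nil (M := M))) 1

@[simp] theorem eval_twoPow {Γ : Ctx} (t : Tm Γ Ty.nat) (e : M.Env Γ) :
    (twoPow t).eval e = Struc.pow (t.eval e) := rfl

end

section
variable {M : Struc} [hM : M.IsModel]
open PTm

@[simp] theorem eval_double {Γ : Ctx} (e : M.Env Γ) (n : M.C Ty.nat) :
    (double.eval e) n = n + n := by simp [double, Tm.eval]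

@[simp] theorem pow_zero' : Struc.pow (0 : M.C Ty.nat) = 1 := by simp [Struc.pow]

theorem pow_succ' (n : M.C Ty.nat) : Struc.pow (n + 1) = 2 * Struc.pow n := by
  rw [Struc.pow, Struc.R_succ, eval_double, two_mul]

theorem pow_pos' (n : M.C Ty.nat) : 0 < Struc.pow n := by
  refine Dec.induction (P := fun n => 0 < Struc.pow n) ⟨(lam (tlt 0 (♯Struc.pow v0))).val, by simp⟩
    (by simp) (fun n ih => ?_) n
  rw [pow_succ']; exact mul_pos two_pos ih

theorem pow_add' (m n : M.C Ty.nat) : Struc.pow (m + n) = Struc.pow m * Struc.pow n := by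
  refine Dec.induction (P := fun n => Struc.pow (m + n) = Struc.pow m * Struc.pow n)
    ⟨(lam (teq (♯Struc.pow (♯m + v0)) (♯Struc.pow ♯m * ♯Struc.pow v0))).val, by simp⟩
    (by simp) (fun n ih => ?_) n
  rw [← add_assoc, pow_succ', ih, pow_succ']; ring

theorem lt_pow (n : M.C Ty.nat) : n < Struc.pow n := by
  refine Dec.induction (P := fun n => n < Struc.pow n) ⟨(lam (tlt v0 (♯Struc.pow v0))).val, by simp⟩
    (by simp) (fun n ih => ?_) n
  rw [pow_succ']
  simp only [nat_lt] at *; push_cast at *; linarith [coe_nonneg n]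

theorem pow_le_pow {m n : M.C Ty.nat} (h : m ≤ n) : Struc.pow m ≤ Struc.pow n := by
  obtain ⟨k, rfl⟩ := exists_add_of_le h
  rw [pow_add']
  exact le_mul_of_one_le_right (Struc.zero_le' _)
    (by rw [← zero_add (1 : M.C Ty.nat), add_one_le_iff']; exact pow_pos' k)

theorem pow_lt_pow_iff {m n : M.C Ty.nat} : Struc.pow m < Struc.pow n ↔ m < n := by
  constructor
  · intro h; by_contra h'
    exact absurd h (not_lt.2 (pow_le_pow (not_lt.1 h')))
  · intro h
    have := pow_le_pow (add_one_le_iff'.2 h)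
    rw [pow_succ'] at this
    have h' := pow_pos' m
    simp only [nat_lt, nat_le] at *; push_cast at *; linarith

/-- Division with remainder. -/
noncomputable def Struc.div : M.C (Ty.nat ⇒ Ty.nat ⇒ Ty.nat) :=
  (lam (lam (tmu v1 (tlt v2 ((v0 + 1) * v1))))).val

theorem lt_div_add_one_mul (a : M.C Ty.nat) {d : M.C Ty.nat} (hd : 0 < d) :
    a < (Struc.div a d + 1) * d := by
  have h : a < (a + 1) * d := by
    rw [← add_one_le_iff']
    exact le_mul_of_one_le_right (Struc.zero_le' _)
      (by rw [← zero_add (1 : M.C Ty.nat), add_one_le_iff']; exact hd)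
  have := eval_mu_zero (M := M) (e := Env.cons d (Env.cons a Env.nil)) (n := v1)
    (t := tlt v2 ((v0 + 1) * v1)) (m := a) (by simpa using h) (by simp)
  simpa [Struc.div] using this

theorem div_mul_le (a d : M.C Ty.nat) : Struc.div a d * d ≤ a := by
  by_contra h
  rw [not_le] at h
  have h0 : Struc.div a d ≠ 0 := by
    intro h0; rw [h0, zero_mul] at h
    exact absurd h (not_lt.2 (Struc.zero_le' a))
  obtain ⟨q, hq⟩ := exists_eq_add_one h0
  rw [hq] at h
  have := eval_mu_le (M := M) (e := Env.cons d (Env.cons a Env.nil)) (n := v1)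
    (t := tlt v2 ((v0 + 1) * v1)) (m := q) (by simpa using h)
  have : Struc.div a d ≤ q := by simpa [Struc.div] using this
  rw [hq] at this
  exact absurd this (not_le.2 (lt_add_one_iff'.2 le_rfl))

theorem div_eq {a d q : M.C Ty.nat} (h : q * d ≤ a) (h' : a < (q + 1) * d) :
    Struc.div a d = q := by
  have hd : 0 < d := by
    rw [pos_iff_ne_zero]; rintro rfl
    rw [mul_zero] at h'; exact absurd h' (not_lt.2 (Struc.zero_le' a))
  have h₁ := lt_of_mul_lt_mul_right ((div_mul_le a d).trans_lt h') (Struc.zero_le' d)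
  have h₂ := lt_of_mul_lt_mul_right (h.trans_lt (lt_div_add_one_mul a hd)) (Struc.zero_le' d)
  exact le_antisymm (lt_add_one_iff'.1 h₁) (lt_add_one_iff'.1 h₂)

/-- The integral part of the binary logarithm. -/
noncomputable def Struc.log : M.C ty1 := (lam (tmu v0 (tlt v1 (♯Struc.pow (v0 + 1))))).val

theorem lt_pow_log (s : M.C Ty.nat) : s < Struc.pow (Struc.log s + 1) := by
  have h : s < Struc.pow (s + 1) := (lt_pow s).trans (pow_lt_pow_iff.2 (lt_add_one_iff'.2 le_rfl))
  have := eval_mu_zero (M := M) (e := Env.cons s Env.nil) (n := v0)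
    (t := tlt v1 (♯Struc.pow (v0 + 1))) (m := s) (by simpa using h) (by simp)
  simpa [Struc.log] using this

theorem pow_log_le {s : M.C Ty.nat} (hs : 0 < s) : Struc.pow (Struc.log s) ≤ s := by
  by_contra h
  rw [not_le] at h
  have h0 : Struc.log s ≠ 0 := by
    intro h0; rw [h0, pow_zero', ← zero_add (1 : M.C Ty.nat), lt_add_one_iff'] at h
    exact absurd hs (not_lt.2 h)
  obtain ⟨q, hq⟩ := exists_eq_add_one h0
  rw [hq] at h
  have := eval_mu_le (M := M) (e := Env.cons s Env.nil) (n := v0)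
    (t := tlt v1 (♯Struc.pow (v0 + 1))) (m := q) (by simpa using h)
  have : Struc.log s ≤ q := by simpa [Struc.log] using this
  rw [hq] at this
  exact absurd this (not_le.2 (lt_add_one_iff'.2 le_rfl))

theorem log_eq {s n : M.C Ty.nat} (h : Struc.pow n ≤ s) (h' : s < Struc.pow (n + 1)) :
    Struc.log s = n := by
  have hs : 0 < s := (pow_pos' n).trans_le h
  have h₁ := pow_lt_pow_iff.1 ((pow_log_le hs).trans_lt h')
  have h₂ := pow_lt_pow_iff.1 (h.trans_lt (lt_pow_log s))
  exact le_antisymm (lt_add_one_iff'.1 h₁) (lt_add_one_iff'.1 h₂)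

end

/-! ### Cantor space and binary trees inside a model. -/

section
variable {M : Struc} [hM : M.IsModel]
open PTm

/-! ## Codes of finite binary sequences -/

/-- The sign of a number. -/
noncomputable def sgn (x : M.C Ty.nat) : M.C Ty.nat := 1 - (1 - x)

theorem sgn_le_one (x : M.C Ty.nat) : sgn x ≤ 1 := tsub_le_self

theorem eq_zero_or_one {x : M.C Ty.nat} (h : x ≤ 1) : x = 0 ∨ x = 1 := by
  rcases h.eq_or_lt with h | h
  · exact .inr h
  · rw [← zero_add (1 : M.C Ty.nat), lt_add_one_iff'] at h
    exact .inl (le_antisymm h (Struc.zero_le' x))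

theorem sgn_of_le_one {x : M.C Ty.nat} (h : x ≤ 1) : sgn x = x := by
  rcases eq_zero_or_one h with rfl | rfl <;> simp [sgn]

/-- The code of the initial segment of length `n` of (the sign of) `f`. -/
noncomputable def Struc.seg : M.C (ty1 ⇒ Ty.nat ⇒ Ty.nat) :=
  (lam (♯(M.R Ty.nat) (lam (v0 + v0 + (1 - (1 - v1 ◦ (♯Struc.log v0))))) 1)).val

@[simp] theorem seg_zero (f : M.C ty1) : Struc.seg f 0 = 1 := by simp [Struc.seg]

/-- The recursor does not supply the position of the next digit, so it is read off as the logarithm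
of the code obtained so far. Taking signs makes the code meaningful for every `f`, binary or not. -/
theorem seg_succ_log (f : M.C ty1) (n : M.C Ty.nat) :
    Struc.seg f (n + 1) = Struc.seg f n + Struc.seg f n + sgn (f (Struc.log (Struc.seg f n))) := by
  simp [Struc.seg, sgn]

theorem seg_bounds (f : M.C ty1) (n : M.C Ty.nat) :
    Struc.pow n ≤ Struc.seg f n ∧ Struc.seg f n < Struc.pow (n + 1) := by
  refine Dec.induction (P := fun n => Struc.pow n ≤ Struc.seg f n ∧
    Struc.seg f n < Struc.pow (n + 1)) ⟨(lam (tand (tle (♯Struc.pow v0) (♯Struc.seg ♯f v0))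
      (tlt (♯Struc.seg ♯f v0) (♯Struc.pow (v0 + 1))))).val, by simp⟩
    (by
      rw [seg_zero, pow_succ', pow_zero']
      exact ⟨le_rfl, by simp only [nat_lt]; push_cast; linarith⟩) (fun n ih => ?_) n
  have h := sgn_le_one (f (Struc.log (Struc.seg f n)))
  have h' := coe_nonneg (sgn (f (Struc.log (Struc.seg f n))))
  rw [seg_succ_log, pow_succ' (n + 1), pow_succ' n] at *
  obtain ⟨h₁, h₂⟩ := ih
  simp only [nat_lt, nat_le] at *
  push_cast at *
  constructor <;> linarith

@[simp] theorem log_seg (f : M.C ty1) (n : M.C Ty.nat) : Struc.log (Struc.seg f n) = n :=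
  log_eq (seg_bounds f n).1 (seg_bounds f n).2

theorem seg_succ (f : M.C ty1) (n : M.C Ty.nat) :
    Struc.seg f (n + 1) = 2 * Struc.seg f n + sgn (f n) := by
  rw [seg_succ_log, log_seg, two_mul]

theorem seg_pos (f : M.C ty1) (n : M.C Ty.nat) : 0 < Struc.seg f n :=
  (pow_pos' n).trans_le (seg_bounds f n).1

theorem div_one' (a : M.C Ty.nat) : Struc.div a 1 = a :=
  div_eq (by rw [mul_one]) (by rw [mul_one]; exact lt_add_one_iff'.2 le_rfl)

theorem seg_div (f : M.C ty1) (n k : M.C Ty.nat) :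
    Struc.div (Struc.seg f (n + k)) (Struc.pow k) = Struc.seg f n := by
  refine Dec.induction (P := fun k => Struc.div (Struc.seg f (n + k)) (Struc.pow k) =
    Struc.seg f n) ⟨(lam (teq (♯Struc.div (♯Struc.seg ♯f (♯n + v0)) (♯Struc.pow v0))
      (♯Struc.seg ♯f ♯n))).val, by simp⟩ (by simp [div_one']) (fun k ih => ?_) k
  have h₁ := div_mul_le (Struc.seg f (n + k)) (Struc.pow k)
  have h₂ := lt_div_add_one_mul (Struc.seg f (n + k)) (pow_pos' k)
  rw [ih] at h₁ h₂
  have h := sgn_le_one (f (n + k))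
  have h' := coe_nonneg (sgn (f (n + k)))
  rw [← add_assoc, seg_succ, pow_succ']
  apply div_eq <;>
  · simp only [nat_lt, nat_le] at *
    push_cast at *
    linarith

theorem div_two_mul (s : M.C Ty.nat) {d : M.C Ty.nat} (hd : 0 < d) :
    2 * Struc.div s (2 * d) ≤ Struc.div s d ∧ Struc.div s d ≤ 2 * Struc.div s (2 * d) + 1 := by
  have h2d : 0 < 2 * d := mul_pos two_pos hd
  have h₁ := (div_mul_le s (2 * d)).trans_lt (lt_div_add_one_mul s hd)
  have h₂ := (div_mul_le s d).trans_lt (lt_div_add_one_mul s h2d)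
  constructor
  · rw [← lt_add_one_iff']
    refine lt_of_mul_lt_mul_right (a := d) ?_ hd.le
    rwa [mul_comm 2, mul_assoc]
  · rw [← lt_add_one_iff']
    refine lt_of_mul_lt_mul_right (a := d) (h₂.trans_eq ?_) hd.le
    rw [← one_add_one_eq_two]; ring

/-- The finite binary sequence with code `s`, followed by zeros. -/
noncomputable def Struc.dec : M.C (Ty.nat ⇒ ty1) :=
  (lam (lam (tite (tlt v0 (♯Struc.log v1))
    (♯Struc.div v1 (♯Struc.pow (♯Struc.log v1 - (v0 + 1))) -
      (1 + 1) * ♯Struc.div v1 (♯Struc.pow (♯Struc.log v1 - v0))) 0))).val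

/-- For `i ≤ log s`, dividing `s` by `2 ^ (log s - i)` leaves the code of the initial segment of
length `i`; the digit is what is added in passing from length `i` to length `i + 1`. -/
theorem dec_app (s i : M.C Ty.nat) : Struc.dec s i = if i < Struc.log s then
    Struc.div s (Struc.pow (Struc.log s - (i + 1))) - 2 * Struc.div s (Struc.pow (Struc.log s - i))
    else 0 := by
  simp only [Struc.dec, val_lam, eval_lam, eval_ite, eval_lt, PTm.eval_app, eval_cst, eval_sub,
    PTm.eval_var_z, PTm.eval_var_s, PTm.eval_mul, PTm.eval_add, PTm.eval_one, PTm.eval_zero,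
    one_add_one_eq_two]

theorem div_pow_log {s i : M.C Ty.nat} (hi : i < Struc.log s) :
    Struc.div s (Struc.pow (Struc.log s - (i + 1))) =
      2 * Struc.div s (Struc.pow (Struc.log s - i)) + Struc.dec s i ∧ Struc.dec s i ≤ 1 := by
  have hle := add_one_le_iff'.2 hi
  obtain ⟨k, hk⟩ := exists_add_of_le hle
  have e₁ : Struc.log s - (i + 1) = k := by rw [hk, add_tsub_cancel_left]
  have e₂ : Struc.log s - i = k + 1 := by
    rw [hk, add_assoc, add_tsub_cancel_left, add_comm]
  rw [dec_app, if_pos hi, e₁, e₂, pow_succ']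
  obtain ⟨h₁, h₂⟩ := div_two_mul s (pow_pos' k)
  exact ⟨(add_tsub_cancel_of_le h₁).symm, tsub_le_iff_left.2 h₂⟩

theorem dec_le_one (s i : M.C Ty.nat) : Struc.dec s i ≤ 1 := by
  by_cases hi : i < Struc.log s
  · exact (div_pow_log hi).2
  · rw [dec_app, if_neg hi]; exact Struc.zero_le' 1

theorem seg_dec_of_le {s n : M.C Ty.nat} (hs : 0 < s) (hn : n ≤ Struc.log s) :
    Struc.seg (Struc.dec s) n = Struc.div s (Struc.pow (Struc.log s - n)) := by
  revert hn
  refine Dec.induction (P := fun n => n ≤ Struc.log s → Struc.seg (Struc.dec s) n =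
    Struc.div s (Struc.pow (Struc.log s - n)))
    ⟨(lam (timp (tle v0 (♯Struc.log ♯s)) (teq (♯Struc.seg (♯Struc.dec ♯s) v0)
      (♯Struc.div ♯s (♯Struc.pow (♯Struc.log ♯s - v0)))))).val, by simp⟩
    (fun _ => ?_) (fun n ih hn => ?_) n
  · rw [seg_zero, tsub_zero]
    refine (div_eq (by rw [one_mul]; exact pow_log_le hs) ?_).symm
    have := lt_pow_log s
    rwa [pow_succ', ← one_add_one_eq_two] at this
  · have hn' := add_one_le_iff'.1 hn
    rw [seg_succ, ih hn'.le, sgn_of_le_one (dec_le_one _ _), (div_pow_log hn').1]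

theorem seg_dec {s : M.C Ty.nat} (hs : 0 < s) : Struc.seg (Struc.dec s) (Struc.log s) = s := by
  rw [seg_dec_of_le hs le_rfl, tsub_self, pow_zero', div_one']

theorem seg_seg (f : M.C ty1) {n m : M.C Ty.nat} (h : n ≤ m) :
    Struc.div (Struc.seg f m) (Struc.pow (m - n)) = Struc.seg f n := by
  obtain ⟨k, rfl⟩ := exists_add_of_le h
  rw [add_tsub_cancel_left, seg_div]

theorem dec_seg (f : M.C ty1) {i n : M.C Ty.nat} (h : i < n) :
    Struc.dec (Struc.seg f n) i = sgn (f i) := by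
  have h' : i < Struc.log (Struc.seg f n) := by rwa [log_seg]
  have := (div_pow_log h').1
  rw [log_seg, seg_seg f (add_one_le_iff'.2 h), seg_seg f h.le, seg_succ] at this
  exact (add_left_cancel this).symm

theorem seg_dec_seg (f : M.C ty1) {n m : M.C Ty.nat} (h : n ≤ m) :
    Struc.seg (Struc.dec (Struc.seg f m)) n = Struc.seg f n := by
  rw [seg_dec_of_le (seg_pos f m) (by rwa [log_seg]), log_seg, seg_seg f h]

theorem seg_congr {f g : M.C ty1} {n : M.C Ty.nat} (h : ∀ i < n, sgn (f i) = sgn (g i)) :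
    Struc.seg f n = Struc.seg g n := by
  refine Dec.induction (P := fun k => k ≤ n → Struc.seg f k = Struc.seg g k)
    ⟨(lam (timp (tle v0 ♯n) (teq (♯Struc.seg ♯f v0) (♯Struc.seg ♯g v0)))).val, by simp⟩
    (fun _ => by simp) (fun k ih hk => ?_) n le_rfl
  have hk' := add_one_le_iff'.1 hk
  rw [seg_succ, seg_succ, ih hk'.le, h k hk']

theorem eq_seg_of_rec {f h : M.C ty1} (hf : ∀ n, f n ≤ 1) (h₀ : h 0 = 1)
    (hs : ∀ n, h (n + 1) = 2 * h n + f n) (n : M.C Ty.nat) : h n = Struc.seg f n := by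
  refine Dec.induction (P := fun n => h n = Struc.seg f n)
    ⟨(lam (teq (♯h v0) (♯Struc.seg ♯f v0))).val, by simp⟩ (by simp [h₀]) (fun n ih => ?_) n
  rw [hs, ih, seg_succ, sgn_of_le_one (hf n)]

/-! ## The principles in a model -/

/-- `f` is an element of Cantor space. -/
def IsBin (f : M.C ty1) : Prop := ∀ n, f n ≤ 1
/-- `f` and `g` agree below `N`. -/
def Agree (f g : M.C ty1) (N : M.C Ty.nat) : Prop := ∀ n < N, f n = g n
def IsCont (Y : M.C ty2) : Prop := ∀ f, ∃ N, ∀ g, Agree f g N → Y f = Y g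
def IsTree (T : M.C ty1) : Prop := ∀ s b, 0 < s → b ≤ 1 → T (2 * s + b) = 1 → T s = 1
def IsInf (T : M.C ty1) : Prop := ∀ n, ∃ s, n < s ∧ T s = 1

variable {Γ : Ctx} (e : M.Env Γ)

@[simp] theorem sat_isBinary (f : Tm Γ ty1) : (isBinary f).Sat e ↔ IsBin (f.eval e) := by
  simp [isBinary, IsBin]

@[simp] theorem sat_agree (f g : Tm Γ ty1) (N : Tm Γ Ty.nat) :
    (agree f g N).Sat e ↔ Agree (f.eval e) (g.eval e) (N.eval e) := by
  simp [agree, Agree]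

@[simp] theorem sat_isCont (Y : Tm Γ ty2) : (isCont Y).Sat e ↔ IsCont (Y.eval e) := by
  simp [isCont, IsCont]

@[simp] theorem eval_snoc (s b : Tm Γ Ty.nat) : (snoc s b).eval e = 2 * s.eval e + b.eval e := by
  simp [snoc, two_mul]

@[simp] theorem sat_mem (s : Tm Γ Ty.nat) (T : Tm Γ ty1) :
    (mem s T).Sat e ↔ T.eval e (s.eval e) = 1 := by simp [mem]

@[simp] theorem sat_isTree (T : Tm Γ ty1) : (isTree T).Sat e ↔ IsTree (T.eval e) := by
  simp [isTree, IsTree]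

@[simp] theorem sat_isInfinite (T : Tm Γ ty1) : (isInfinite T).Sat e ↔ IsInf (T.eval e) := by
  simp [isInfinite, IsInf]

@[simp] theorem sat_isPath (f T : Tm Γ ty1) : (isPath f T).Sat e ↔
    IsBin (f.eval e) ∧ ∀ n, T.eval e (Struc.seg (f.eval e) n) = 1 := by
  simp only [isPath, Fm.sat_and, sat_isBinary, sat_existsB, Fm.sat_eq, Tm.eval_app,
    Tm.eval_var_z, Tm.eval_zero, Tm.eval_one, sat_forallB, Tm.eval_wk_step, Tm.eval_wk_refl,
    Tm.eval_plus, eval_snoc, sat_mem]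
  refine and_congr_right fun hf => ⟨?_, fun h => ⟨Struc.seg (f.eval e), seg_zero _, fun n => ?_, h⟩⟩
  · rintro ⟨h, h₀, hs, hT⟩ n
    rw [← eq_seg_of_rec hf h₀ hs]; exact hT n
  · rw [seg_succ, sgn_of_le_one (hf n)]

theorem models_WKL : M.Models WKL ↔ ∀ T : M.C ty1, IsTree T → IsInf T →
    ∃ f, IsBin f ∧ ∀ n, T (Struc.seg f n) = 1 := by
  simp [WKL, Struc.Models]

theorem models_existsTwo : M.Models existsTwo ↔ ∃ φ : M.C ty2, (∀ f, φ f ≤ 1) ∧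
    ∀ f, (∃ n, f n = 0) ↔ φ f = 0 := by
  simp [existsTwo, Struc.Models]

theorem models_FF : M.Models FF ↔ ∃ Φ : M.C ty3, ∀ Y : M.C ty2, IsCont Y → ∀ f g, IsBin f →
    IsBin g → Agree f g (Φ Y) → Y f = Y g := by
  simp [FF, Struc.Models]

theorem models_HBUc : M.Models HBUc ↔ ∀ G : M.C ty2, ∃ k, ∃ F : M.C (Ty.nat ⇒ ty1),
    (∀ i < k, IsBin (F i)) ∧ ∀ f, IsBin f → ∃ i < k, Agree f (F i) (G (F i)) := by
  simp [HBUc, Struc.Models]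

/-! ## Trees -/

theorem IsTree.seg {T : M.C ty1} (hT : IsTree T) {f : M.C ty1} {n m : M.C Ty.nat} (h : n ≤ m)
    (hm : T (Struc.seg f m) = 1) : T (Struc.seg f n) = 1 := by
  obtain ⟨k, rfl⟩ := exists_add_of_le h
  revert hm
  refine Dec.induction (P := fun k => T (Struc.seg f (n + k)) = 1 → T (Struc.seg f n) = 1)
    ⟨(lam (timp (teq (♯T (♯Struc.seg ♯f (♯n + v0))) 1) (teq (♯T (♯Struc.seg ♯f ♯n)) 1))).val,
      by simp⟩ (by simp) (fun k ih hm => ih ?_) k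
  rw [← add_assoc, seg_succ] at hm
  exact hT _ _ (seg_pos _ _) (sgn_le_one _) hm

theorem IsTree.seg_dec {T : M.C ty1} (hT : IsTree T) {s n : M.C Ty.nat} (hs : 0 < s)
    (hn : n ≤ Struc.log s) (h : T s = 1) : T (Struc.seg (Struc.dec s) n) = 1 :=
  hT.seg hn (by rwa [HOA.seg_dec hs])

/-- Infinitude speaks of codes, not of lengths. A sequence shorter than `n` has a code below `2 ^
n`, so a code above this bound belongs to a sequence of length at least `n`. -/
theorem IsInf.exists_log {T : M.C ty1} (hT : IsInf T) (n : M.C Ty.nat) :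
    ∃ s, 0 < s ∧ n ≤ Struc.log s ∧ T s = 1 := by
  obtain ⟨s, hs, h⟩ := hT (Struc.pow n)
  refine ⟨s, (pow_pos' n).trans hs, ?_, h⟩
  rw [← lt_add_one_iff', ← pow_lt_pow_iff]
  exact hs.trans (lt_pow_log s)

theorem isBin_dec (s : M.C Ty.nat) : IsBin (Struc.dec s) := dec_le_one s

theorem Agree.seg {f g : M.C ty1} {n : M.C Ty.nat} (h : Agree f g n) :
    Struc.seg f n = Struc.seg g n := seg_congr fun i hi => by rw [h i hi]

theorem IsBin.agree_dec_seg {f : M.C ty1} (hf : IsBin f) (n : M.C Ty.nat) :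
    Agree f (Struc.dec (Struc.seg f n)) n := fun i hi => by
  rw [dec_seg f hi, sgn_of_le_one (hf i)]

theorem Agree.mono {f g : M.C ty1} {n m : M.C Ty.nat} (h : Agree f g m) (hn : n ≤ m) :
    Agree f g n := fun i hi => h i (hi.trans_le hn)

theorem Agree.symm {f g : M.C ty1} {n : M.C Ty.nat} (h : Agree f g n) : Agree g f n :=
  fun i hi => (h i hi).symm

theorem Agree.trans {f g h : M.C ty1} {n : M.C Ty.nat} (h₁ : Agree f g n) (h₂ : Agree g h n) :
    Agree f h n := fun i hi => (h₁ i hi).trans (h₂ i hi)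

end

/-! ### The principles on Cantor space: `WKL`, `HBUc`, `FF` and `(∃²)`. -/

section
variable {M : Struc} [hM : M.IsModel]
open PTm

/-! ## Trees without paths -/

theorem sgn_sgn (x : M.C Ty.nat) : sgn (sgn x) = sgn x := sgn_of_le_one (sgn_le_one x)

theorem exists_exit {T : M.C ty1} (hT : ¬ ∃ f, IsBin f ∧ ∀ n, T (Struc.seg f n) = 1)
    (f : M.C ty1) : ∃ n, ¬ T (Struc.seg f n) = 1 := by
  by_contra! h
  -- Codes of initial segments depend on the signs of the values only, so the sign of `f` is an
  -- element of Cantor space with the same segments. Thus an exit exists for arbitrary `f`, as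
  -- choice requires.
  have hf : ∀ n, (lam (1 - (1 - ♯f v0)) : PTm M [] _).val n = sgn (f n) := fun n => by simp [sgn]
  refine hT ⟨(lam (1 - (1 - ♯f v0))).val, fun n => ?_, fun n => ?_⟩
  · rw [hf]; exact sgn_le_one _
  · rw [seg_congr (g := f) fun i _ => by rw [hf, sgn_sgn]]
    exact h n

/-- A functional that finds, for each `f`, an initial segment outside of the tree. -/
theorem exists_exit_functional {T : M.C ty1}
    (hT : ¬ ∃ f, IsBin f ∧ ∀ n, T (Struc.seg f n) = 1) :
    ∃ G : M.C ty2, ∀ f, ¬ T (Struc.seg f (G f)) = 1 := by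
  obtain ⟨G, hG⟩ := choice_fun (lam (lam (tnot (teq (♯T (♯Struc.seg v1 v0)) 1)))).val
    (by simpa using exists_exit hT)
  exact ⟨G, by simpa using hG⟩

/-- Let `G` find exits from a tree without paths. A sequence in the tree longer than all `G (F i)`,
continued by zeros, lies in one of the covering neighbourhoods and so begins with the exit segment
of some `F i`, although the tree is closed under initial segments. -/
theorem WKL_of_HBUc (h : M.Models HBUc) : M.Models WKL := by
  rw [models_HBUc] at h
  rw [models_WKL]
  intro T hT hinf
  by_contra hno
  obtain ⟨G, hG⟩ := exists_exit_functional hno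
  obtain ⟨k, F, _, hcov⟩ := h G
  obtain ⟨N, hN⟩ := exists_bound (lam (♯G (♯F v0))).val k
  simp only [val_lam, PTm.eval_app, eval_cst, PTm.eval_var_z] at hN
  obtain ⟨s, hs, hlog, hTs⟩ := hinf.exists_log N
  obtain ⟨i, hi, hag⟩ := hcov _ (isBin_dec s)
  apply hG (F i)
  rw [← hag.seg]
  exact hT.seg_dec hs ((hN i hi).trans hlog) hTs

/-- The exits obtained by choice need not depend continuously on `f`. The least exit does, since
whether it occurs by `n` is determined by the segment of length `n`. -/
theorem exists_min_exit_functional {T : M.C ty1}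
    (hT : ¬ ∃ f, IsBin f ∧ ∀ n, T (Struc.seg f n) = 1) :
    ∃ Y : M.C ty2, ∀ f, ¬ T (Struc.seg f (Y f)) = 1 ∧ ∀ n, ¬ T (Struc.seg f n) = 1 → Y f ≤ n := by
  obtain ⟨G, hG⟩ := exists_exit_functional hT
  refine ⟨(lam (tmu (♯G v0) (tnot (teq (♯T (♯Struc.seg v1 v0)) 1)))).val, fun f => ⟨?_, ?_⟩⟩
  · have := eval_mu_zero (M := M) (e := Env.cons f Env.nil) (n := ♯G v0)
      (t := tnot (teq (♯T (♯Struc.seg v1 v0)) 1)) (m := G f) (by simpa using hG f) (by simp)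
    simpa using this
  · intro n hn
    have := eval_mu_le (M := M) (e := Env.cons f Env.nil) (n := ♯G v0)
      (t := tnot (teq (♯T (♯Struc.seg v1 v0)) 1)) (m := n) (by simpa using hn)
    simpa using this

/-- If `N` is a modulus of uniform continuity for the least exit, its value on Cantor space is
determined by the segment of length `N`. There are finitely many such segments, so the exits are
bounded by some `K`, contradicting sequences in the tree of length at least `max N K`. -/
theorem WKL_of_FF (h : M.Models FF) : M.Models WKL := by
  rw [models_FF] at h
  rw [models_WKL]
  intro T hT hinf
  by_contra hno
  obtain ⟨Y, hY⟩ := exists_min_exit_functional hno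
  obtain ⟨Φ, hΦ⟩ := h
  have hcont : IsCont Y := by
    intro f
    refine ⟨Y f, fun g hg => ?_⟩
    have h₁ : Y g ≤ Y f := (hY g).2 _ (by rw [← hg.seg]; exact (hY f).1)
    refine le_antisymm ((hY f).2 _ ?_) h₁
    rw [(hg.mono h₁).seg]; exact (hY g).1
  set N := Φ Y
  obtain ⟨K, hK⟩ := exists_bound (lam (♯Y (♯Struc.dec v0))).val (Struc.pow (N + 1))
  simp only [val_lam, PTm.eval_app, eval_cst, PTm.eval_var_z] at hK
  obtain ⟨s, hs, hlog, hTs⟩ := hinf.exists_log (max N K)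
  have hNs := (le_max_left N K).trans hlog
  have hag := (isBin_dec s).agree_dec_seg N
  have hY' := hΦ Y hcont _ _ (isBin_dec s) (isBin_dec _) hag
  have hle := hK _ (seg_bounds (Struc.dec s) N).2
  rw [← hY'] at hle
  exact (hY (Struc.dec s)).1 (hT.seg_dec hs (hle.trans ((le_max_right N K).trans hlog)) hTs)

/-! ## Discontinuous functionals -/

/-- Grilliot's trick. From `h` one computes `J h`, which is `f` if `h` has no zero and `g m` if `m`
is its least zero. The value at `k` needs only `h 0, …, h k`, because `g m` agrees with `f` below
`m`. Then `Y (J h) = Y f` decides whether `h` has a zero. -/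
theorem existsTwo_of_seq {Y : M.C ty2} {f : M.C ty1} (g : M.C (Ty.nat ⇒ ty1))
    (hg : ∀ n, Agree f (g n) n) (hY : ∀ n, Y (g n) ≠ Y f) : M.Models existsTwo := by
  classical
  obtain ⟨J, hJ⟩ : ∃ J : M.C (ty1 ⇒ ty1), ∀ h k, J h k =
      if ∃ i < k + 1, h i = 0 then
        g ((tmu (v0 + 1) (teq (v2 ◦ v0) 0)).eval (Env.cons k (Env.cons h Env.nil))) k
      else f k :=
    ⟨(lam (lam (tite (tex (v0 + 1) (teq (v2 ◦ v0) 0))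
      (♯g (tmu (v0 + 1) (teq (v2 ◦ v0) 0)) v0) (♯f v0)))).val, fun h k => by
        have hc : (tex (v0 + 1) (teq (v2 ◦ v0) 0)).eval (Env.cons k (Env.cons h Env.nil)) = 0 ↔
          ∃ i < k + 1, h i = 0 := by simp
        by_cases hh : ∃ i < k + 1, h i = 0
        · simp [hc, hh]
        · simp [hc, hh]⟩
  have h₁ : ∀ h : M.C ty1, (¬ ∃ n, h n = 0) → J h = f := by
    intro h hh
    refine hM.funext fun k => ?_
    rw [hJ, if_neg]
    rintro ⟨i, _, hi⟩
    exact hh ⟨i, hi⟩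
  have h₂ : ∀ h : M.C ty1, (∃ n, h n = 0) → ∃ m, J h = g m := by
    rintro h ⟨n, hn⟩
    obtain ⟨m, _, hm, hmin⟩ := Dec.least (P := fun n => h n = 0) ⟨h, by simp⟩ hn
    refine ⟨m, hM.funext fun k => ?_⟩
    rw [hJ]
    split_ifs with hk
    · obtain ⟨i, hik, hi⟩ := hk
      have hmk : m ≤ k + 1 := by
        by_contra hlt
        exact hmin i (hik.trans (not_le.1 hlt)) hi
      congr 2
      apply le_antisymm
      · exact eval_mu_le (by simpa using hm)
      · by_contra hlt
        apply hmin _ (not_le.1 hlt)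
        have := eval_mu_zero (M := M) (e := Env.cons k (Env.cons h Env.nil)) (n := v0 + 1)
          (t := teq (v2 ◦ v0) 0) (m := m) (by simpa using hm) (by simpa using hmk)
        simpa using this
    -- No zero has been seen up to `k`, so `k < m`, and there `f` and `g m` coincide.
    · refine hg m k ?_
      by_contra hlt
      exact hk ⟨m, lt_add_one_iff'.2 (not_lt.1 hlt), hm⟩
  rw [models_existsTwo]
  have hval : ∀ h, (lam (tite (teq (♯Y (♯J v0)) (♯Y ♯f)) 1 0)).val h =
      if Y (J h) = Y f then 1 else 0 := fun h => by simp
  refine ⟨(lam (tite (teq (♯Y (♯J v0)) (♯Y ♯f)) 1 0)).val, fun h => ?_, fun h => ?_⟩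
  · rw [hval]; split_ifs
    · exact le_rfl
    · exact Struc.zero_le' 1
  · rw [hval]
    constructor
    · intro hh
      obtain ⟨m, hm⟩ := h₂ h hh
      rw [if_neg]; rw [hm]; exact hY m
    · intro hh
      by_contra hn
      rw [h₁ h hn, if_pos rfl] at hh
      exact one_ne_zero hh

/-- Only numbers can be chosen, not functions. If a discontinuity at `f` shows on finite sequences
continued by zeros, their codes can be chosen. Otherwise `Y` has the value `Y f` on all such
sequences close to `f`, and some nearby binary `g` has a different value; then `Y` is discontinuous
at `g` along the truncations of `g`. -/
theorem cont_of_not_existsTwo (h : ¬ M.Models existsTwo) (Y : M.C ty2) {f : M.C ty1} :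
    ∃ N, ∀ g, IsBin g → Agree f g N → Y f = Y g := by
  by_contra! hdis
  by_cases hA : ∀ N, ∃ s, Agree f (Struc.dec s) N ∧ Y (Struc.dec s) ≠ Y f
  · obtain ⟨S, hS⟩ := choice_nat (M := M) (lam (lam (tand
      (tall v1 (teq (♯f v0) (♯Struc.dec v1 v0)))
      (tnot (teq (♯Y (♯Struc.dec v0)) (♯Y ♯f)))))).val (by simpa [Agree] using hA)
    simp only [val_lam, eval_lam, eval_and, eval_all, eval_not, eval_eq, PTm.eval_app, eval_cst,
      PTm.eval_var_z, PTm.eval_var_s] at hS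
    refine h (existsTwo_of_seq (Y := Y) (f := f) (lam (♯Struc.dec (♯S v0))).val
      (fun n => ?_) (fun n => ?_))
    · simpa [Agree] using (hS n).1
    · simpa using (hS n).2
  · push Not at hA
    obtain ⟨N, hN⟩ := hA
    obtain ⟨g, hg, hag, hne⟩ := hdis N
    refine h (existsTwo_of_seq (Y := Y) (f := g) (lam (♯Struc.dec (♯Struc.seg ♯g (♯N + v0)))).val
      (fun n => ?_) (fun n => ?_))
    · simpa using (hg.agree_dec_seg (N + n)).mono le_add_self
    · have := hN (Struc.seg g (N + n)) (hag.trans ((hg.agree_dec_seg (N + n)).mono le_self_add))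
      simpa [this] using hne

/-! ## Compactness from weak König's lemma -/

theorem exists_seg_snoc {s b : M.C Ty.nat} (hs : 0 < s) (hb : b ≤ 1) :
    ∃ f, IsBin f ∧ s = Struc.seg f (Struc.log s) ∧
      2 * s + b = Struc.seg f (Struc.log s + 1) := by
  have hf : ∀ i, (lam (tite (tlt v0 ♯(Struc.log s)) (♯Struc.dec ♯s v0) ♯b)).val i =
      if i < Struc.log s then Struc.dec s i else b := fun i => by simp
  have h : Struc.seg (lam (tite (tlt v0 ♯(Struc.log s)) (♯Struc.dec ♯s v0) ♯b)).val
      (Struc.log s) = s := by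
    conv_rhs => rw [← seg_dec hs]
    exact seg_congr fun i hi => by rw [hf, if_pos hi]
  refine ⟨_, fun i => ?_, h.symm, ?_⟩
  · rw [hf]; split_ifs
    · exact dec_le_one s i
    · exact hb
  · rw [seg_succ, h, hf, if_neg (lt_irrefl _), sgn_of_le_one hb]

theorem isTree_of_seg {T : M.C ty1}
    (h : ∀ f n, IsBin f → T (Struc.seg f (n + 1)) = 1 → T (Struc.seg f n) = 1) : IsTree T := by
  intro s b hs hb hT
  obtain ⟨f, hf, h₁, h₂⟩ := exists_seg_snoc hs hb
  rw [h₁]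
  exact h f _ hf (by rwa [← h₂])

theorem le_seg (f : M.C ty1) (n : M.C Ty.nat) : n < Struc.seg f n :=
  (lt_pow n).trans_le (seg_bounds f n).1

/-- The tree consists of the sequences that are not yet covered by the neighbourhood of one of their
initial segments continued by zeros. On a path `f`, continuity makes `G` at long truncations equal
to `G f`, and a truncation of length at least `G f` covers. So there is no path, and by `WKL` the
tree is finite. -/
theorem HBUc_of_cont (hW : M.Models WKL)
    (hc : ∀ (Y : M.C ty2) (f : M.C ty1), ∃ N, ∀ g, IsBin g → Agree f g N → Y f = Y g) :
    M.Models HBUc := by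
  rw [models_WKL] at hW
  rw [models_HBUc]
  intro G
  obtain ⟨T, hT⟩ : ∃ T : M.C ty1, ∀ s, T s = 1 ↔
      ∀ n ≤ Struc.log s, ¬ G (Struc.dec (Struc.seg (Struc.dec s) n)) ≤ n := by
    refine ⟨(lam (tite (tall (♯Struc.log v0 + 1)
      (tnot (tle (♯G (♯Struc.dec (♯Struc.seg (♯Struc.dec v1) v0))) v0))) 1 0)).val, fun s => ?_⟩
    simp [lt_add_one_iff']
  have hseg : ∀ f m, T (Struc.seg f m) = 1 ↔
      ∀ n ≤ m, ¬ G (Struc.dec (Struc.seg f n)) ≤ n := by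
    intro f m
    rw [hT, log_seg]
    exact forall₂_congr fun n hn => by rw [seg_dec_seg f hn]
  have htree : IsTree T := isTree_of_seg fun f n _ h => by
    rw [hseg] at h ⊢
    exact fun m hm => h m (hm.trans le_self_add)
  by_cases hinf : IsInf T
  · obtain ⟨f, hf, hp⟩ := hW T htree hinf
    obtain ⟨N, hN⟩ := hc G f
    have hp' := (hseg f (max N (G f))).1 (hp _) _ le_rfl
    rw [← hN _ (isBin_dec _) ((hf.agree_dec_seg _).mono (le_max_left _ _))] at hp'
    exact (hp' (le_max_right _ _)).elim
  · unfold IsInf at hinf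
    push Not at hinf
    obtain ⟨n₀, hn₀⟩ := hinf
    -- The covering points are the sequences of length at most `n₀` continued by zeros; all their
    -- codes lie below `2 ^ (n₀ + 1)`.
    refine ⟨Struc.pow (n₀ + 1), Struc.dec, fun i _ => isBin_dec i, fun f hf => ?_⟩
    have := hn₀ (Struc.seg f n₀) (le_seg f n₀)
    rw [Ne, hseg] at this
    push Not at this
    obtain ⟨n, hn, hG⟩ := this
    refine ⟨Struc.seg f n, (seg_bounds f n).2.trans_le (pow_le_pow (add_le_add_left hn 1)), ?_⟩
    exact (hf.agree_dec_seg n).mono hG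

theorem HBUc_of_WKL (hW : M.Models WKL) (h : ¬ M.Models existsTwo) : M.Models HBUc :=
  HBUc_of_cont hW fun Y _ => cont_of_not_existsTwo h Y

/-! ## Consequences of `(∃²)` -/

/-- With `(∃²)` and choice there is an unbounded search operator `μ`. Being a modulus for sequences
that end in zeros quantifies over numbers only, so `μ` finds such a modulus once one is known to
exist. Continuity carries it over to all of Cantor space. -/
theorem FF_of_existsTwo (hW : M.Models WKL) (h : M.Models existsTwo) : M.Models FF := by
  rw [models_WKL] at hW
  rw [models_existsTwo] at h
  rw [models_FF]
  obtain ⟨φ, _, hφ⟩ := h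
  obtain ⟨μ, hμ⟩ : ∃ μ : M.C ty2, ∀ f : M.C ty1, (∃ n, f n = 0) → f (μ f) = 0 := by
    obtain ⟨μ, hμ⟩ := choice_fun (lam (lam (timp (♯φ v1) (v1 ◦ v0)))).val (fun f => by
      by_cases hf : ∃ n, f n = 0
      · obtain ⟨n, hn⟩ := hf
        exact ⟨n, by simp [hn]⟩
      · exact ⟨0, by simp [← hφ, hf]⟩)
    refine ⟨μ, fun f hf => ?_⟩
    have := hμ f
    simp only [val_lam, eval_lam, eval_imp, PTm.eval_app, eval_cst, PTm.eval_var_z,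
      PTm.eval_var_s] at this
    exact this ((hφ f).1 hf)
  obtain ⟨P, hP⟩ : ∃ P : M.C (ty2 ⇒ ty1), ∀ Y N, P Y N = 0 ↔ ∀ s t,
      Agree (Struc.dec s) (Struc.dec t) N → Y (Struc.dec s) = Y (Struc.dec t) := by
    refine ⟨(lam (lam (tnot (♯φ (lam (♯φ (lam (tand
      (tall v2 (teq (♯Struc.dec v2 v0) (♯Struc.dec v1 v0)))
      (tnot (teq (v3 ◦ (♯Struc.dec v1)) (v3 ◦ (♯Struc.dec v0)))))))))))).val, fun Y N => ?_⟩
    simp [← hφ, Agree]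
  have hex : ∀ Y, IsCont Y → ∃ N, P Y N = 0 := by
    intro Y hY
    by_contra! hno
    simp only [Ne, hP] at hno
    push Not at hno
    -- If no modulus exists, the sequences having two extensions with different values of `Y` form
    -- an infinite tree, and a path through it is a point of discontinuity.
    obtain ⟨T, hT⟩ : ∃ T : M.C ty1, ∀ u, T u = 1 ↔ ∃ s t,
        (Agree (Struc.dec s) (Struc.dec u) (Struc.log u) ∧
        Agree (Struc.dec t) (Struc.dec u) (Struc.log u)) ∧
        Y (Struc.dec s) ≠ Y (Struc.dec t) := by
      refine ⟨(lam (tite (♯φ (lam (♯φ (lam (tand (tand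
        (tall (♯Struc.log v2) (teq (♯Struc.dec v2 v0) (♯Struc.dec v3 v0)))
        (tall (♯Struc.log v2) (teq (♯Struc.dec v1 v0) (♯Struc.dec v3 v0))))
        (tnot (teq (♯Y (♯Struc.dec v1)) (♯Y (♯Struc.dec v0))))))))) 1 0)).val, fun u => ?_⟩
      simp only [val_lam, eval_ite]
      split_ifs with hc <;> simp [← hφ] at hc <;> simpa [Agree] using hc
    have hseg : ∀ f n, IsBin f → (T (Struc.seg f n) = 1 ↔ ∃ s t,
        (Agree (Struc.dec s) f n ∧ Agree (Struc.dec t) f n) ∧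
        Y (Struc.dec s) ≠ Y (Struc.dec t)) := by
      intro f n hf
      rw [hT, log_seg]
      have h := hf.agree_dec_seg n
      exact exists₂_congr fun s t => and_congr_left fun _ => and_congr
        ⟨fun h' => h'.trans h.symm, fun h' => h'.trans h⟩
        ⟨fun h' => h'.trans h.symm, fun h' => h'.trans h⟩
    have htree : IsTree T := isTree_of_seg fun f n hf h => by
      rw [hseg f _ hf] at h ⊢
      obtain ⟨s, t, ⟨h₁, h₂⟩, h₃⟩ := h
      exact ⟨s, t, ⟨h₁.mono le_self_add, h₂.mono le_self_add⟩, h₃⟩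
    have hinf : IsInf T := by
      intro n
      obtain ⟨s, t, hag, hne⟩ := hno n
      refine ⟨Struc.seg (Struc.dec s) n, le_seg _ n, ?_⟩
      rw [hseg _ _ (isBin_dec s)]
      exact ⟨s, t, ⟨fun _ _ => rfl, hag.symm⟩, hne⟩
    obtain ⟨f, hf, hp⟩ := hW T htree hinf
    obtain ⟨N, hN⟩ := hY f
    obtain ⟨s, t, ⟨h₁, h₂⟩, h₃⟩ := (hseg f N hf).1 (hp N)
    exact h₃ ((hN _ h₁.symm).symm.trans (hN _ h₂.symm))
  refine ⟨(lam (♯μ (♯P v0))).val, fun Y hY f g hf hg hag => ?_⟩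
  simp only [val_lam, PTm.eval_app, eval_cst, PTm.eval_var_z] at hag
  have hN := (hP Y _).1 (hμ (P Y) (hex Y hY))
  set N := μ (P Y)
  obtain ⟨N₁, h₁⟩ := hY f
  obtain ⟨N₂, h₂⟩ := hY g
  set n := max N (max N₁ N₂)
  have hn : N ≤ n := le_max_left _ _
  have hn₁ : N₁ ≤ n := (le_max_left _ _).trans (le_max_right _ _)
  have hn₂ : N₂ ≤ n := (le_max_right _ _).trans (le_max_right _ _)
  rw [h₁ _ ((hf.agree_dec_seg n).mono hn₁), h₂ _ ((hg.agree_dec_seg n).mono hn₂)]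
  exact hN _ _ (((hf.agree_dec_seg n).mono hn).symm.trans
    (hag.trans ((hg.agree_dec_seg n).mono hn)))

/-- A term regarded as a term with parameters. -/
def Tm.toPTm (M : Struc) {Γ : Ctx} : {σ : Ty} → Tm Γ σ → PTm M Γ σ
  | _, Tm.var x => .var x
  | _, Tm.zero => ♯M.zero
  | _, Tm.one => ♯M.one
  | _, Tm.add => ♯M.add
  | _, Tm.mul => ♯M.mul
  | _, Tm.K ρ τ => ♯(M.K ρ τ)
  | _, Tm.S δ ρ τ => ♯(M.S δ ρ τ)
  | _, Tm.R σ => ♯(M.R σ)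
  | _, Tm.app t u => .app (t.toPTm M) (u.toPTm M)

theorem Tm.eval_toPTm {M : Struc} {Γ : Ctx} {σ : Ty} (t : Tm Γ σ) (e : M.Env Γ) :
    (t.toPTm M).eval e = t.eval e := by
  induction t with
  | app t u iht ihu => rw [Tm.toPTm, PTm.eval_app, iht, ihu]; rfl
  | _ => rfl

/-- Each number quantifier is evaluated by `φ`, so an arithmetical formula becomes a term in its
free variables. -/
theorem Fm.IsArith.exists_char {φ : M.C ty2} (hφ : ∀ f, (∃ n, f n = 0) ↔ φ f = 0) {Γ : Ctx}
    {A : Fm Γ} (hA : A.IsArith) :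
    ∃ t : PTm M Γ Ty.nat, ∀ e : M.Env Γ, t.eval e = 0 ↔ A.Sat e := by
  induction hA with
  | @eq _ t u _ _ => exact ⟨teq (t.toPTm M) (u.toPTm M), fun e => by simp [Tm.eval_toPTm]⟩
  | @lt _ t u _ _ => exact ⟨tlt (t.toPTm M) (u.toPTm M), fun e => by simp [Tm.eval_toPTm]⟩
  | bot => exact ⟨1, fun e => by simp [Fm.Sat]⟩
  | imp _ _ ih₁ ih₂ =>
    obtain ⟨t, ht⟩ := ih₁
    obtain ⟨u, hu⟩ := ih₂
    exact ⟨timp t u, fun e => by simp [ht, hu, Fm.Sat]⟩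
  | all0 _ ih =>
    obtain ⟨t, ht⟩ := ih
    exact ⟨tnot (♯φ (lam (tnot t))), fun e => by simp [← hφ, ht]⟩

theorem ACA_of_existsTwo (h : M.Models existsTwo) {ψ : Sentence} (hψ : ψ ∈ ACA) :
    M.Models ψ := by
  rw [models_existsTwo] at h
  obtain ⟨φ, _, hφ⟩ := h
  obtain ⟨Γ, A, hA⟩ := hψ
  rw [Struc.Models, Fm.sat_close]
  classical
  intro e
  obtain ⟨t, ht⟩ := hA.exists_char hφ
  have hval : ∀ n, (lam (tite t 1 0)).eval e n = if A.Sat (Env.cons n e) then 1 else 0 := by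
    intro n; simp [ht]
  simp only [sat_existsB, Fm.sat_and, sat_isBinary, Tm.eval_var_z, Fm.sat_all, Fm.sat_iff,
    sat_mem, Tm.eval_wk_step, Tm.eval_wk_refl, Fm.sat_rename, Env.cons_lift]
  refine ⟨(lam (tite t 1 0)).eval e, fun n => ?_, fun n => ?_⟩
  · rw [hval]; split_ifs
    · exact le_rfl
    · exact Struc.zero_le' 1
  · rw [hval]
    change _ ↔ A.Sat (Env.cons n e)
    split_ifs with hs <;> simp [hs]

end

/-! ### Rational and real numbers inside a model, and `HBU` from `HBUc`. -/

section
variable {M : Struc} [hM : M.IsModel]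
open PTm

/-! ## Codes of rational numbers -/

theorem exists_half (u : M.C Ty.nat) : ∃ h ≤ u, u = 2 * h ∨ u = 2 * h + 1 := by
  have h₁ := div_mul_le u 2
  have h₂ := lt_div_add_one_mul u two_pos
  refine ⟨Struc.div u 2, ?_, ?_⟩
  · have := coe_nonneg (Struc.div u 2)
    simp only [nat_le] at *; push_cast at *; linarith
  · rcases (lt_add_one_iff'.1 (show u < 2 * Struc.div u 2 + 1 + 1 by
      simp only [nat_lt] at *; push_cast at *; linarith)).eq_or_lt with h | h
    · exact .inr h
    · refine .inl (le_antisymm (lt_add_one_iff'.1 h) ?_)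
      rwa [mul_comm]

/-- Induction along the diagonals: after `(u, d)` comes `(u + 1, d - 1)`, or `(0, u + 1)` if `d =
0`. The bounds on `u` and `d` make the statement decidable. -/
theorem exists_unpair (c : M.C Ty.nat) : ∃ u ≤ c, ∃ d ≤ c,
    c + c = (u + d) * (u + d + 1) + (u + u) := by
  have := Dec.induction (P := fun c : M.C Ty.nat => ∃ u < c + 1, ∃ d < c + 1,
      c + c = (u + d) * (u + d + 1) + (u + u))
    ⟨(lam (tex (v0 + 1) (tex (v1 + 1)
      (teq (v2 + v2) ((v1 + v0) * (v1 + v0 + 1) + (v1 + v1)))))).val, by simp⟩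
    ⟨0, by simp, 0, by simp, by simp⟩ (fun c ih => ?_) c
  · simpa only [lt_add_one_iff'] using this
  · obtain ⟨u, hu, d, hd, h⟩ := ih
    by_cases hd0 : d = 0
    · subst hd0
      refine ⟨0, lt_of_le_of_lt (Struc.zero_le' _) (lt_add_one_iff'.2 le_rfl), u + 1,
        by simpa using hu, ?_⟩
      have : c + 1 + (c + 1) = c + c + 2 := by ring
      rw [this, h]; ring
    · obtain ⟨d, rfl⟩ := exists_eq_add_one hd0
      refine ⟨u + 1, by simpa using hu, d, ?_, ?_⟩
      · exact (lt_add_one_iff'.2 le_rfl).trans (hd.trans (lt_add_one_iff'.2 le_rfl))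
      · have : c + 1 + (c + 1) = c + c + 2 := by ring
        rw [this, h]; ring

/-- The code lies between consecutive triangular numbers, which determines the diagonal `u + d`; on
a diagonal the code determines `u`. -/
theorem unpair_unique {u d u' d' : M.C Ty.nat}
    (h : (u + d) * (u + d + 1) + (u + u) = (u' + d') * (u' + d' + 1) + (u' + u')) :
    u = u' ∧ d = d' := by
  have key : ∀ u d u' d' : M.C Ty.nat,
      (u + d) * (u + d + 1) + (u + u) = (u' + d') * (u' + d' + 1) + (u' + u') →
      u + d ≤ u' + d' := by
    intro u d u' d' h
    by_contra hlt
    have hlt := add_one_le_iff'.2 (not_le.1 hlt)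
    have h₁ : (u' + d' + 1) * (u' + d' + 1 + 1) ≤ (u + d) * (u + d + 1) :=
      mul_le_mul' hlt (add_le_add_left hlt 1)
    have := coe_nonneg d'
    have := coe_nonneg u
    simp only [nat_le, nat_eq] at *
    push_cast at *
    linarith
  have hs := le_antisymm (key _ _ _ _ h) (key _ _ _ _ h.symm)
  rw [hs] at h
  have hu : u = u' := by
    have := add_left_cancel h
    simp only [nat_eq] at *
    push_cast at *
    linarith
  subst hu
  exact ⟨rfl, add_left_cancel hs⟩

/-- Choice yields one number at a time, so `u` is chosen while `d` remains under a bounded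
quantifier. -/
theorem exists_ratU : ∃ U : M.C ty1, ∀ c, ∃ d < c + 1,
    c + c = (U c + d) * (U c + d + 1) + (U c + U c) := by
  obtain ⟨U, hU⟩ := choice_nat (M := M) (lam (lam (tex (v1 + 1)
    (teq (v2 + v2) ((v1 + v0) * (v1 + v0 + 1) + (v1 + v1)))))).val (fun c => by
      obtain ⟨u, _, d, hd, h⟩ := exists_unpair c
      exact ⟨u, by simpa using ⟨d, lt_add_one_iff'.2 hd, h⟩⟩)
  exact ⟨U, by simpa using hU⟩

noncomputable def Struc.ratU : M.C ty1 := (exists_ratU (M := M)).choose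

theorem exists_ratD : ∃ D : M.C ty1, ∀ c,
    c + c = (Struc.ratU c + D c) * (Struc.ratU c + D c + 1) + (Struc.ratU c + Struc.ratU c) := by
  obtain ⟨D, hD⟩ := choice_nat (M := M) (lam (lam (teq (v1 + v1)
    ((♯Struc.ratU v1 + v0) * (♯Struc.ratU v1 + v0 + 1) + (♯Struc.ratU v1 + ♯Struc.ratU v1))))).val
    (fun c => by
      obtain ⟨d, _, h⟩ := (exists_ratU (M := M)).choose_spec c
      exact ⟨d, by simpa [Struc.ratU] using h⟩)
  exact ⟨D, by simpa using hD⟩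

/-- The predecessor of the denominator of the rational number with a given code. -/
noncomputable def Struc.ratD : M.C ty1 := (exists_ratD (M := M)).choose

/-- The positive part of the numerator. -/
noncomputable def Struc.ratA : M.C ty1 :=
  (lam (tite (teq (♯Struc.ratU v0) ((1 + 1) * ♯Struc.div (♯Struc.ratU v0) (1 + 1)))
    (♯Struc.div (♯Struc.ratU v0) (1 + 1)) 0)).val

/-- The negative part of the numerator. -/
noncomputable def Struc.ratB : M.C ty1 :=
  (lam (tite (teq (♯Struc.ratU v0) ((1 + 1) * ♯Struc.div (♯Struc.ratU v0) (1 + 1)))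
    0 (♯Struc.div (♯Struc.ratU v0) (1 + 1) + 1))).val

/-- `c` is the code of `(a - b) / (d + 1)`. -/
def IsRat (c a b d : M.C Ty.nat) : Prop :=
  ∃ u, c + c = (u + d) * (u + d + 1) + (u + u) ∧
    (u = a + a ∧ b = 0 ∨ u + 1 = b + b ∧ a = 0)

theorem isRat_self (c : M.C Ty.nat) :
    IsRat c (Struc.ratA c) (Struc.ratB c) (Struc.ratD c) := by
  refine ⟨Struc.ratU c, (exists_ratD (M := M)).choose_spec c, ?_⟩
  have h₁ := div_mul_le (Struc.ratU c) 2
  have h₂ := lt_div_add_one_mul (Struc.ratU c) two_pos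
  by_cases h : Struc.ratU c = 2 * Struc.div (Struc.ratU c) 2
  · have hA : Struc.ratA c = Struc.div (Struc.ratU c) 2 := by
      simp [Struc.ratA, one_add_one_eq_two, ← h]
    have hB : Struc.ratB c = 0 := by simp [Struc.ratB, one_add_one_eq_two, ← h]
    exact .inl ⟨by rw [hA, ← two_mul, ← h], hB⟩
  · have hA : Struc.ratA c = 0 := by simp [Struc.ratA, one_add_one_eq_two, h]
    have hB : Struc.ratB c = Struc.div (Struc.ratU c) 2 + 1 := by
      simp [Struc.ratB, one_add_one_eq_two, h]
    refine .inr ⟨?_, hA⟩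
    rw [hB]
    have h₃ := lt_of_le_of_ne h₁ (by rw [mul_comm]; exact Ne.symm h)
    apply le_antisymm <;> simp only [nat_lt, nat_le] at * <;> push_cast at * <;> linarith

theorem IsRat.eq {c a b d : M.C Ty.nat} (h : IsRat c a b d) :
    Struc.ratA c = a ∧ Struc.ratB c = b ∧ Struc.ratD c = d := by
  obtain ⟨u, hu, hab⟩ := h
  obtain ⟨u', hu', hab'⟩ := isRat_self c
  obtain ⟨rfl, rfl⟩ := unpair_unique (hu'.symm.trans hu)
  set a' := Struc.ratA c
  set b' := Struc.ratB c
  have odd : ∀ x y : M.C Ty.nat, x + x + 1 ≠ y + y := by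
    intro x y h
    rcases lt_or_ge x y with h' | h' <;> simp only [nat_lt, nat_le, nat_eq] at * <;>
      push_cast at * <;> linarith
  have inj : ∀ x y : M.C Ty.nat, x + x = y + y → x = y := by
    intro x y h; simp only [nat_eq] at *; push_cast at *; linarith
  rcases hab with ⟨h₁, h₂⟩ | ⟨h₁, h₂⟩ <;> rcases hab' with ⟨h₃, h₄⟩ | ⟨h₃, h₄⟩
  · exact ⟨inj _ _ (h₃.symm.trans h₁), h₄.trans h₂.symm, rfl⟩
  · exact absurd (by rw [← h₁, h₃]) (odd a b')
  · exact absurd (by rw [← h₃, h₁]) (odd a' b)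
  · exact ⟨h₄.trans h₂.symm, inj _ _ (h₃.symm.trans h₁), rfl⟩

theorem isRat_iff {c a b d : M.C Ty.nat} : IsRat c a b d ↔
    Struc.ratA c = a ∧ Struc.ratB c = b ∧ Struc.ratD c = d :=
  ⟨IsRat.eq, by rintro ⟨rfl, rfl, rfl⟩; exact isRat_self c⟩

/-- The rational number with code `c`. -/
noncomputable def ratVal (c : M.C Ty.nat) : M.Q :=
  (Struc.ratA c - Struc.ratB c) / (Struc.ratD c + 1)

theorem IsRat.ratVal {c a b d : M.C Ty.nat} (h : IsRat c a b d) :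
    ratVal c = (a - b : M.Q) / (d + 1) := by
  obtain ⟨rfl, rfl, rfl⟩ := h.eq; rfl

@[simp] theorem ratVal_zero : ratVal (0 : M.C Ty.nat) = 0 := by
  have h : IsRat (0 : M.C Ty.nat) 0 0 0 := ⟨0, by simp, by simp⟩
  simp [h.ratVal]

@[simp] theorem ratVal_five : ratVal (1 + 1 + 1 + 1 + 1 : M.C Ty.nat) = 1 := by
  have h : IsRat (1 + 1 + 1 + 1 + 1 : M.C Ty.nat) 1 0 0 := ⟨1 + 1, by ring, by simp⟩
  simp [h.ratVal]

/-- The code of `a / D`, for `D > 0`. -/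
noncomputable def Struc.mkrat : M.C (Ty.nat ⇒ Ty.nat ⇒ Ty.nat) :=
  (lam (lam (♯Struc.div ((v1 + v1 + (v0 - 1)) * (v1 + v1 + (v0 - 1) + 1)
    + (v1 + v1 + (v1 + v1))) (1 + 1)))).val

/-- A product of consecutive numbers is even, so the halving in the pairing function is exact. -/
theorem isRat_mkrat (a D : M.C Ty.nat) :
    IsRat (Struc.mkrat a D) a 0 (D - 1) := by
  refine ⟨a + a, ?_, .inl ⟨rfl, rfl⟩⟩
  set w := a + a + (D - 1)
  obtain ⟨k, hk⟩ : ∃ k, w * (w + 1) = k + k := by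
    obtain ⟨h, _, hw | hw⟩ := exists_half w
    · exact ⟨h * (w + 1), by rw [hw]; ring⟩
    · exact ⟨(2 * h + 1) * (h + 1), by rw [hw]; ring⟩
  have : Struc.mkrat a D = k + (a + a) := by
    simp only [Struc.mkrat, val_lam, eval_lam, PTm.eval_app, eval_cst, PTm.eval_add, PTm.eval_mul,
      PTm.eval_var_z, PTm.eval_var_s, eval_sub, PTm.eval_one]
    rw [hk]
    refine div_eq (le_of_eq (by ring)) ?_
    simp only [nat_lt]; push_cast; linarith
  rw [this, hk]; ring

theorem ratVal_mkrat (a : M.C Ty.nat) {D : M.C Ty.nat} (hD : 0 < D) :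
    ratVal (Struc.mkrat a D) = (a : M.Q) / D := by
  rw [(isRat_mkrat a D).ratVal, Frac.coe_sub (by rwa [← add_one_le_iff', zero_add] at hD)]
  simp

variable {Γ : Ctx} (e : M.Env Γ)

@[simp] theorem sat_isRat (c a b d : Tm Γ Ty.nat) : (isRat c a b d).Sat e ↔
    Struc.ratA (c.eval e) = a.eval e ∧ Struc.ratB (c.eval e) = b.eval e ∧
      Struc.ratD (c.eval e) = d.eval e := by
  rw [← isRat_iff]
  simp [isRat, IsRat]

theorem ratLt_iff {c₁ k c₂ c₃ l p : M.C Ty.nat} (hp : 0 < p) :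
    ratVal c₁ + k / p < ratVal c₂ + ratVal c₃ + (l : M.Q) / p ↔
    (p * Struc.ratA c₁ * (Struc.ratD c₂ + 1) * (Struc.ratD c₃ + 1)) +
      (p * Struc.ratB c₂ * (Struc.ratD c₁ + 1) * (Struc.ratD c₃ + 1)) +
      (p * Struc.ratB c₃ * (Struc.ratD c₁ + 1) * (Struc.ratD c₂ + 1)) +
      (k * (Struc.ratD c₁ + 1) * (Struc.ratD c₂ + 1) * (Struc.ratD c₃ + 1)) <
    (p * Struc.ratB c₁ * (Struc.ratD c₂ + 1) * (Struc.ratD c₃ + 1)) +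
      (p * Struc.ratA c₂ * (Struc.ratD c₁ + 1) * (Struc.ratD c₃ + 1)) +
      (p * Struc.ratA c₃ * (Struc.ratD c₁ + 1) * (Struc.ratD c₂ + 1)) +
      (l * (Struc.ratD c₁ + 1) * (Struc.ratD c₂ + 1) * (Struc.ratD c₃ + 1)) := by
  refine Iff.trans ?_ Frac.coe_lt
  push_cast
  have h₁ := coe_nonneg (Struc.ratD c₁)
  have h₂ := coe_nonneg (Struc.ratD c₂)
  have h₃ := coe_nonneg (Struc.ratD c₃)
  rw [← Frac.coe_lt, Frac.coe_zero] at hp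
  unfold ratVal
  generalize (Struc.ratD c₁ : M.Q) = d₁ at *
  generalize (Struc.ratD c₂ : M.Q) = d₂ at *
  generalize (Struc.ratD c₃ : M.Q) = d₃ at *
  generalize (p : M.Q) = p at *
  have h₁ : 0 < d₁ + 1 := by linarith
  have h₂ : 0 < d₂ + 1 := by linarith
  have h₃ : 0 < d₃ + 1 := by linarith
  have hpos : 0 < p * ((d₁ + 1) * ((d₂ + 1) * (d₃ + 1))) := by positivity
  rw [← mul_lt_mul_iff_of_pos_right hpos, ← sub_pos, ← sub_pos (b := _ + _)]
  refine iff_of_eq (congrArg (0 < ·) ?_)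
  field_simp
  ring

@[simp] theorem sat_ratLt (c₁ k c₂ c₃ l p : Tm Γ Ty.nat) (hp : 0 < p.eval e) :
    (ratLt c₁ k c₂ c₃ l p).Sat e ↔ ratVal (c₁.eval e) + k.eval e / p.eval e <
      ratVal (c₂.eval e) + ratVal (c₃.eval e) + (l.eval e : M.Q) / p.eval e := by
  rw [ratLt_iff hp]
  simp [ratLt]

end

section
variable {M : Struc} [hM : M.IsModel]
open PTm

/-! ## Real numbers -/

/-- The rational number `1 / 2 ^ n`. -/
noncomputable def eps (n : M.C Ty.nat) : M.Q := 1 / (Struc.pow n : M.C Ty.nat)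

theorem coe_pow_pos (n : M.C Ty.nat) : (0 : M.Q) < (Struc.pow n : M.C Ty.nat) := by
  have := pow_pos' n
  rwa [← Frac.coe_lt, Frac.coe_zero] at this

theorem eps_pos (n : M.C Ty.nat) : 0 < eps n := one_div_pos.2 (coe_pow_pos n)

theorem eps_mul_pow (n : M.C Ty.nat) : eps n * (Struc.pow n : M.C Ty.nat) = 1 :=
  one_div_mul_cancel (coe_pow_pos n).ne'

theorem eps_add (m n : M.C Ty.nat) : eps (m + n) = eps m * eps n := by
  rw [eps, eps, eps, pow_add', Frac.coe_mul, one_div_mul_one_div]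

theorem eps_succ (n : M.C Ty.nat) : eps (n + 1) = eps n / 2 := by
  rw [eps, eps, pow_succ', Frac.coe_mul, coe_two, div_div, mul_comm]

theorem eps_le {m n : M.C Ty.nat} (h : m ≤ n) : eps n ≤ eps m :=
  one_div_le_one_div_of_le (coe_pow_pos m) (nat_le.1 (pow_le_pow h))

/-- The `n`-th rational number of a sequence of codes. -/
noncomputable def rv (x : M.C ty1) (n : M.C Ty.nat) : M.Q := ratVal (x n)

def IsReal (x : M.C ty1) : Prop :=
  ∀ n i, rv x n < rv x (n + i) + eps n ∧ rv x (n + i) < rv x n + eps n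

def RealLt (x y : M.C ty1) : Prop := ∃ n, rv x n + 2 * eps n < rv y n

def RealEq (x y : M.C ty1) : Prop := ∀ n, rv y n ≤ rv x n + 2 * eps n ∧ rv x n ≤ rv y n + 2 * eps n

def RealLtAdd (x y z : M.C ty1) : Prop := ∃ n, rv x n + 2 * eps n < rv y (n + 1) + rv z (n + 1)

def InUnit (x : M.C ty1) : Prop :=
  IsReal x ∧ ∀ n, 0 ≤ rv x n + 2 * eps n ∧ rv x n ≤ 1 + 2 * eps n

def InInterval (x y r : M.C ty1) : Prop := RealLtAdd y x r ∧ RealLtAdd x y r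

def IsPosRealFun (Ψ : M.C (ty1 ⇒ ty1)) : Prop :=
  (∀ x, IsReal x → IsReal (Ψ x) ∧ ∃ n, 2 * eps n < rv (Ψ x) n) ∧
  ∀ x y, IsReal x → IsReal y → RealEq x y → RealEq (Ψ x) (Ψ y)

section Sat
variable {Γ : Ctx} (e : M.Env Γ)

theorem sat_ratLt_pow (c₁ k c₂ c₃ l n : Tm Γ Ty.nat) : (ratLt c₁ k c₂ c₃ l (twoPow n)).Sat e ↔
    ratVal (c₁.eval e) + k.eval e * eps (n.eval e) <
      ratVal (c₂.eval e) + ratVal (c₃.eval e) + (l.eval e : M.Q) * eps (n.eval e) := by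
  rw [sat_ratLt e _ _ _ _ _ _ (by rw [eval_twoPow]; exact pow_pos' _)]
  simp only [eval_twoPow, eps, mul_one_div]

theorem eval_num_two : (Tm.num 2 : Tm Γ _).eval e = 2 :=
  one_add_one_eq_two

theorem ratVal_ratOne : ratVal ((ratOne : Tm Γ _).eval e) = 1 := ratVal_five

@[simp] theorem sat_isReal (x : Tm Γ ty1) : (isReal x).Sat e ↔ IsReal (x.eval e) := by
  simp [isReal, IsReal, sat_ratLt_pow, ratZero, rv]

@[simp] theorem sat_realLt (x y : Tm Γ ty1) :
    (realLt x y).Sat e ↔ RealLt (x.eval e) (y.eval e) := by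
  simp [realLt, RealLt, sat_ratLt_pow, ratZero, rv, eval_num_two]

@[simp] theorem sat_realEq (x y : Tm Γ ty1) :
    (realEq x y).Sat e ↔ RealEq (x.eval e) (y.eval e) := by
  simp [realEq, RealEq, sat_ratLt_pow, ratZero, rv, eval_num_two]

@[simp] theorem sat_realLtAdd (x y z : Tm Γ ty1) :
    (realLtAdd x y z).Sat e ↔ RealLtAdd (x.eval e) (y.eval e) (z.eval e) := by
  simp [realLtAdd, RealLtAdd, sat_ratLt_pow, rv, eval_num_two]

@[simp] theorem sat_inInterval (x y z : Tm Γ ty1) :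
    (inInterval x y z).Sat e ↔ InInterval (x.eval e) (y.eval e) (z.eval e) := by
  simp [inInterval, InInterval]

@[simp] theorem rv_const (c : Tm Γ Ty.nat) (n : M.C Ty.nat) :
    rv ((realConst c).eval e) n = ratVal (c.eval e) := by
  simp [rv, realConst]

@[simp] theorem sat_inUnitInterval (x : Tm Γ ty1) :
    (inUnitInterval x).Sat e ↔ InUnit (x.eval e) := by
  simp [inUnitInterval, InUnit, RealLt, ratZero, ratVal_ratOne, forall_and]

@[simp] theorem sat_isPosRealFun (Ψ : Tm Γ (ty1 ⇒ ty1)) :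
    (isPosRealFun Ψ).Sat e ↔ IsPosRealFun (Ψ.eval e) := by
  simp [isPosRealFun, IsPosRealFun, RealLt, ratZero]

end Sat

theorem models_HBU : M.Models HBU ↔ ∀ Ψ : M.C (ty1 ⇒ ty1), IsPosRealFun Ψ →
    ∃ k, ∃ Y : M.C (Ty.nat ⇒ ty1), (∀ i < k, InUnit (Y i)) ∧
      ∀ x, InUnit x → ∃ i < k, InInterval x (Y i) (Ψ (Y i)) := by
  simp [HBU, Struc.Models]

theorem IsReal.lt {x : M.C ty1} (h : IsReal x) {n m : M.C Ty.nat} (hn : n ≤ m) :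
    rv x n < rv x m + eps n ∧ rv x m < rv x n + eps n := by
  obtain ⟨k, rfl⟩ := exists_add_of_le hn
  exact h n k

theorem lt_ratVal_iff {k c p : M.C Ty.nat} (hp : 0 < p) : (k : M.Q) / p < ratVal c ↔
    k * (Struc.ratD c + 1) + p * Struc.ratB c < p * Struc.ratA c := by
  refine Iff.trans ?_ Frac.coe_lt
  rw [← Frac.coe_lt, Frac.coe_zero] at hp
  have h : (0 : M.Q) < Struc.ratD c + 1 := by linarith [coe_nonneg (Struc.ratD c)]
  push_cast
  rw [ratVal, div_lt_div_iff₀ hp h]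
  constructor <;> intro <;> linarith

theorem exists_nat_floor {q : M.Q} (hq : 0 ≤ q) :
    ∃ n : M.C Ty.nat, (n : M.Q) ≤ q ∧ q < n + 1 := by
  induction q using Frac.ind
  rename_i q
  rw [Frac.zero_def, Frac.mk_le_mk] at hq
  simp only [zero_mul, mul_one, zero_add, add_zero] at hq
  refine ⟨Struc.div (q.a - q.b) q.d, ?_, ?_⟩
  · have := div_mul_le (q.a - q.b) q.d
    rw [Frac.of, Frac.mk_le_mk]
    simp only [zero_mul, mul_one, add_zero]
    exact (add_le_add_left this q.b).trans_eq (tsub_add_cancel_of_le hq)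
  · have := lt_div_add_one_mul (q.a - q.b) q.pos
    rw [← Frac.coe_one, ← Frac.coe_add, Frac.of, Frac.mk_lt_mk]
    simp only [zero_mul, mul_one, add_zero]
    exact (tsub_add_cancel_of_le hq).symm.trans_lt (add_lt_add_left this q.b)

/-! ## Binary expansions -/

/-- The real number with binary expansion `f`. -/
noncomputable def Struc.expand : M.C (ty1 ⇒ ty1) :=
  (lam (lam (♯Struc.mkrat (♯Struc.seg v1 v0 - ♯Struc.pow v0) (♯Struc.pow v0)))).val

/-- The code has a leading digit `1` worth `2 ^ n`, which accounts for the subtracted `1`. -/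
theorem rv_expand (f : M.C ty1) (n : M.C Ty.nat) :
    rv (Struc.expand f) n = Struc.seg f n * eps n - 1 := by
  have : rv (Struc.expand f) n =
      ratVal (Struc.mkrat (Struc.seg f n - Struc.pow n) (Struc.pow n)) := by
    simp [rv, Struc.expand]
  rw [this, ratVal_mkrat _ (pow_pos' n), Frac.coe_sub (seg_bounds f n).1, sub_div,
    div_self (coe_pow_pos n).ne', eps, mul_one_div]

theorem rv_expand_le (f : M.C ty1) {n m : M.C Ty.nat} (h : n ≤ m) :
    rv (Struc.expand f) n ≤ rv (Struc.expand f) m ∧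
      rv (Struc.expand f) m < rv (Struc.expand f) n + eps n := by
  obtain ⟨k, rfl⟩ := exists_add_of_le h
  have h₁ := div_mul_le (Struc.seg f (n + k)) (Struc.pow k)
  have h₂ := lt_div_add_one_mul (Struc.seg f (n + k)) (pow_pos' k)
  rw [seg_div] at h₁ h₂
  rw [← Frac.coe_le] at h₁
  rw [← Frac.coe_lt] at h₂
  push_cast at h₁ h₂
  rw [rv_expand, rv_expand, eps_add]
  have hk := eps_mul_pow k
  have hn := mul_pos (eps_pos n) (eps_pos k)
  have h₁ := mul_le_mul_of_nonneg_right h₁ hn.le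
  have h₂ := mul_lt_mul_of_pos_right h₂ hn
  have e₁ : ∀ a : M.Q, a * (Struc.pow k : M.C Ty.nat) * (eps n * eps k) = a * eps n := fun a => by
    linear_combination a * eps n * hk
  rw [e₁] at h₁ h₂
  constructor <;> linarith

theorem isReal_expand (f : M.C ty1) : IsReal (Struc.expand f) := fun n i => by
  have := rv_expand_le f (le_self_add : n ≤ n + i)
  have := eps_pos n
  constructor <;> linarith

theorem inUnit_expand (f : M.C ty1) : InUnit (Struc.expand f) := by
  refine ⟨isReal_expand f, fun n => ?_⟩
  have h := rv_expand_le f (Struc.zero_le' n)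
  have h₀ : eps (0 : M.C Ty.nat) = 1 := by simp [eps]
  rw [rv_expand f 0, seg_zero, h₀, Frac.coe_one] at h
  have := eps_pos n
  constructor <;> linarith

/-- Elements of the unit interval have approximate binary expansions. -/
theorem InUnit.exists_expand {x : M.C ty1} (hx : InUnit x) (L : M.C Ty.nat) :
    ∃ f, IsBin f ∧ rv x L ≤ rv (Struc.expand f) L + 3 * eps L ∧
      rv (Struc.expand f) L ≤ rv x L + 3 * eps L := by
  have key : ∀ j : M.C Ty.nat, j < Struc.pow L → ∃ f, IsBin f ∧
      rv (Struc.expand f) L = j * eps L := by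
    intro j hj
    have hlog : Struc.log (Struc.pow L + j) = L := log_eq le_self_add (by
      rw [pow_succ', two_mul]; exact add_lt_add_right hj _)
    have hpos : 0 < Struc.pow L + j := (pow_pos' L).trans_le le_self_add
    refine ⟨Struc.dec (Struc.pow L + j), isBin_dec _, ?_⟩
    have := seg_dec hpos
    rw [hlog] at this
    rw [rv_expand, this, Frac.coe_add]
    linear_combination eps_mul_pow L
  have hε := eps_pos L
  have hεp := eps_mul_pow L
  obtain ⟨-, hx⟩ := hx
  obtain ⟨h₁, h₂⟩ := hx L
  -- The approximation may leave `[0, 1]` by `2 * eps L`. Outside, the nearest available value is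
  -- used, `0` or `1 - eps L`; the latter accounts for the constant `3`.
  rcases lt_or_ge (rv x L) 0 with h0 | h0
  · obtain ⟨f, hf, hv⟩ := key 0 (pow_pos' L)
    refine ⟨f, hf, ?_⟩
    rw [hv, Frac.coe_zero]
    constructor <;> linarith
  rcases lt_or_ge (rv x L) 1 with h1 | h1
  · obtain ⟨j, hj, hj'⟩ := exists_nat_floor (mul_nonneg h0 (coe_pow_pos L).le)
    have e₁ : rv x L * (Struc.pow L : M.C Ty.nat) * eps L = rv x L := by
      linear_combination rv x L * hεp
    obtain ⟨f, hf, hv⟩ := key j (by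
      rw [← Frac.coe_lt]
      exact hj.trans_lt (by simpa using mul_lt_mul_of_pos_right h1 (coe_pow_pos L)))
    refine ⟨f, hf, ?_⟩
    have := mul_le_mul_of_nonneg_right hj hε.le
    have := mul_lt_mul_of_pos_right hj' hε
    rw [hv]
    constructor <;> linarith
  · have hp := add_one_le_iff'.2 (pow_pos' L)
    rw [zero_add] at hp
    obtain ⟨f, hf, hv⟩ := key (Struc.pow L - 1) (by
      rw [← add_one_le_iff', tsub_add_cancel_of_le hp])
    refine ⟨f, hf, ?_⟩
    rw [hv, Frac.coe_sub hp, Frac.coe_one, sub_mul, mul_comm _ (eps L), hεp]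
    constructor <;> linarith

/-- Choice picks for each `f` an index at which `Ψ` at the real with expansion `f` is visibly
positive, so that the radius there exceeds `eps (G f)`. Expansions sharing `G f + 2` digits are well
within that distance, so a finite subcover of Cantor space yields one of the interval. -/
theorem HBU_of_HBUc (h : M.Models HBUc) : M.Models HBU := by
  rw [models_HBUc] at h
  rw [models_HBU]
  rintro Ψ ⟨hΨ, -⟩
  obtain ⟨G, hG⟩ : ∃ G : M.C ty2, ∀ f,
      2 * eps (G f) < rv (Ψ (Struc.expand f)) (G f) := by
    have key : ∀ f n, 2 * eps n < rv (Ψ (Struc.expand f)) n ↔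
        2 * (Struc.ratD (Ψ (Struc.expand f) n) + 1) +
          Struc.pow n * Struc.ratB (Ψ (Struc.expand f) n) <
        Struc.pow n * Struc.ratA (Ψ (Struc.expand f) n) := fun f n => by
      rw [← lt_ratVal_iff (pow_pos' n), coe_two, rv, eps, mul_one_div]
    obtain ⟨G, hG⟩ := choice_fun (M := M) (lam (lam (tlt
      ((1 + 1) * (♯Struc.ratD (♯Ψ (♯Struc.expand v1) v0) + 1) +
        ♯Struc.pow v0 * ♯Struc.ratB (♯Ψ (♯Struc.expand v1) v0))
      (♯Struc.pow v0 * ♯Struc.ratA (♯Ψ (♯Struc.expand v1) v0))))).val (fun f => by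
        obtain ⟨n, hn⟩ := (hΨ _ (isReal_expand f)).2
        exact ⟨n, by simpa [one_add_one_eq_two] using (key f n).1 hn⟩)
    exact ⟨G, fun f => (key f _).2 (by simpa [one_add_one_eq_two] using hG f)⟩
  obtain ⟨k, F, _, hcov⟩ := h (lam (♯G v0 + 1 + 1)).val
  obtain ⟨N, hN⟩ := exists_bound (lam (♯G (♯F v0))).val k
  simp only [val_lam, PTm.eval_app, eval_cst, PTm.eval_var_z, PTm.eval_add, PTm.eval_one] at hN hcov
  refine ⟨k, (lam (♯Struc.expand (♯F v0))).val, fun i _ => by simpa using inUnit_expand _,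
    fun x hx => ?_⟩
  -- Four places beyond all the `G (F i)` make `eps L` at most a sixteenth of the guaranteed radius.
  set L := N + 1 + 1 + 1 + 1
  obtain ⟨f, hf, h₁, h₂⟩ := hx.exists_expand L
  obtain ⟨i, hi, hag⟩ := hcov f hf
  refine ⟨i, hi, ?_⟩
  simp only [val_lam, PTm.eval_app, eval_cst, PTm.eval_var_z]
  set y := Struc.expand (F i)
  set γ := G (F i)
  have hLL : L ≤ L + 1 := le_self_add
  have hγ : γ + 1 + 1 + 1 + 1 ≤ L := by
    simpa only [L, add_le_add_iff_right] using hN i hi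
  have hγ' : γ + 1 + 1 ≤ L := by rw [add_assoc (γ + 1 + 1)] at hγ; exact le_self_add.trans hγ
  have hγ0 : γ ≤ L := by rw [add_assoc γ] at hγ'; exact le_self_add.trans hγ'
  have e₀ := eps_le hγ
  simp only [eps_succ] at e₀
  have e₁ : rv (Struc.expand f) (γ + 1 + 1) = rv y (γ + 1 + 1) := by
    rw [rv_expand, rv_expand, hag.seg]
  have b₁ := rv_expand_le f hγ'
  have b₂ := rv_expand_le (F i) hγ'
  have b₃ := rv_expand_le (F i) (hγ'.trans hLL)
  rw [e₁] at b₁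
  simp only [eps_succ (γ + 1), eps_succ γ] at b₁ b₂ b₃
  have c₁ := (hΨ y (isReal_expand _)).1.lt (hγ0.trans hLL)
  have c₂ : 2 * eps γ < rv (Ψ y) γ := hG (F i)
  have c₃ := hx.1.lt hLL
  have := eps_pos γ
  exact ⟨⟨L, by linarith⟩, ⟨L, by linarith⟩⟩

end

/-! ### From `HBU` to `WKL`: a real-valued radius from a tree without paths. -/

section
variable {M : Struc} [hM : M.IsModel]
open PTm

/-! ## From covers of the unit interval to paths through trees

The code `i` of a sequence of length `n` stands for the interval `[i, i + 1] / 2 ^ (n + 1)`. -/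

/-- `i` is the code of a sequence of length `n` in the tree. -/
def Alive (T : M.C ty1) (n i : M.C Ty.nat) : Prop :=
  Struc.pow n ≤ i ∧ i < Struc.pow (n + 1) ∧ T i = 1

/-- The intervals to both sides of `j / 2 ^ (n + 1)` do not belong to sequences in the tree. -/
def Good (T : M.C ty1) (n j : M.C Ty.nat) : Prop := ¬ Alive T n j ∧ ¬ Alive T n (j - 1)

/-- The interval with centre `u / 2 ^ N` and radius `w / 2 ^ N` is contained in an interval
avoiding the tree. -/
def Fits (T : M.C ty1) (N u w : M.C Ty.nat) : Prop :=
  ∃ n < N, ∃ j < u + 1 + 1, Good T n j ∧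
    j * Struc.pow (N - (n + 1)) + w ≤ u + Struc.pow (N - (n + 1)) ∧
    u + w ≤ (j + 1) * Struc.pow (N - (n + 1))

/-- `W N u` is the largest radius that fits. -/
def IsMargin (T : M.C ty1) (W : M.C (Ty.nat ⇒ Ty.nat ⇒ Ty.nat)) : Prop :=
  ∀ N u, (0 < W N u → Fits T N u (W N u)) ∧ ∀ w, Fits T N u w → w ≤ W N u

/-- The interval with centre `q` and radius `ρ` is contained in an interval avoiding the tree. -/
def Avoids (T : M.C ty1) (q ρ : M.Q) : Prop :=
  ∃ n j : M.C Ty.nat, Good T n j ∧ ((j : M.Q) - 1) * eps (n + 1) + ρ ≤ q ∧ q + ρ ≤ ((j : M.Q) + 1) * eps (n + 1)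

theorem Fits.mono {T : M.C ty1} {N u w w' : M.C Ty.nat} (h : Fits T N u w) (hw : w' ≤ w) :
    Fits T N u w' := by
  obtain ⟨n, hn, j, hj, hg, h₁, h₂⟩ := h
  exact ⟨n, hn, j, hj, hg, (add_le_add_right hw _).trans h₁, (add_le_add_right hw _).trans h₂⟩

theorem Fits.le {T : M.C ty1} {N u w : M.C Ty.nat} (h : Fits T N u w) : w ≤ Struc.pow N := by
  obtain ⟨n, _, j, _, _, h₁, h₂⟩ := h
  refine le_trans ?_ (pow_le_pow (tsub_le_self : N - (n + 1) ≤ N))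
  simp only [nat_le] at *
  push_cast at *
  linarith

/-- A radius that fits is at most `2 ^ N`, so the first `w` for which `w + 1` does not fit is found
by bounded search. It is the largest because smaller radii fit as well. -/
theorem exists_margin (T : M.C ty1) : ∃ W, IsMargin T W := by
  obtain ⟨P, hP⟩ : ∃ P : M.C (Ty.nat ⇒ Ty.nat ⇒ Ty.nat ⇒ Ty.nat), ∀ N u w,
      P N u w = 0 ↔ Fits T N u w := by
    refine ⟨(lam (lam (lam (tex v2 (tex (v2 + 1 + 1) (tand
      (tand
        (tnot (tand (tle (♯Struc.pow v1) v0) (tand (tlt v0 (♯Struc.pow (v1 + 1)))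
          (teq (♯T v0) 1))))
        (tnot (tand (tle (♯Struc.pow v1) (v0 - 1)) (tand (tlt (v0 - 1) (♯Struc.pow (v1 + 1)))
          (teq (♯T (v0 - 1)) 1)))))
      (tand
        (tle (v0 * ♯Struc.pow (v4 - (v1 + 1)) + v2) (v3 + ♯Struc.pow (v4 - (v1 + 1))))
        (tle (v3 + v2) ((v0 + 1) * ♯Struc.pow (v4 - (v1 + 1))))))))))).val, fun N u w => ?_⟩
    simp only [val_lam, eval_lam, eval_ex, eval_and, eval_not, eval_le, eval_lt, eval_eq,
      PTm.eval_app, eval_cst, PTm.eval_add, PTm.eval_mul, eval_sub, PTm.eval_one, PTm.eval_var_z,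
      PTm.eval_var_s, Fits, Good, Alive]
  refine ⟨(lam (lam (tmu (♯Struc.pow v1) (tnot (♯P v2 v1 (v0 + 1)))))).val, fun N u => ?_⟩
  set w := (lam (lam (tmu (♯Struc.pow v1) (tnot (♯P v2 v1 (v0 + 1)))))).val N u with hw
  have e : w = (tmu (♯Struc.pow v1) (tnot (♯P v2 v1 (v0 + 1)))).eval
    (Env.cons u (Env.cons N Env.nil)) := by simp [hw]
  have h₁ : ¬ Fits T N u (w + 1) := by
    have := eval_mu_zero (M := M) (e := Env.cons u (Env.cons N Env.nil)) (n := ♯Struc.pow v1)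
      (t := tnot (♯P v2 v1 (v0 + 1))) (m := Struc.pow N) (by
        simp only [eval_not, PTm.eval_app, eval_cst, PTm.eval_add, PTm.eval_one, PTm.eval_var_z,
          PTm.eval_var_s, hP]
        exact fun h => absurd (lt_add_one_iff'.2 le_rfl) (not_lt.2 h.le)) (by simp)
    rw [← e] at this
    simpa [hP] using this
  refine ⟨fun h0 => ?_, fun w' hw' => ?_⟩
  · obtain ⟨p, hp⟩ := exists_eq_add_one h0.ne'
    by_contra hf
    have := eval_mu_le (M := M) (e := Env.cons u (Env.cons N Env.nil)) (n := ♯Struc.pow v1)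
      (t := tnot (♯P v2 v1 (v0 + 1))) (m := p) (by simpa [hP, ← hp] using hf)
    rw [← e, hp] at this
    exact absurd (lt_add_one_iff'.2 le_rfl) (not_lt.2 this)
  · by_contra hlt
    exact h₁ (hw'.mono (add_one_le_iff'.2 (not_le.1 hlt)))

theorem pow_sub_mul_eps {n N : M.C Ty.nat} (h : n < N) :
    ((Struc.pow (N - (n + 1)) : M.C Ty.nat) : M.Q) * eps N = eps (n + 1) := by
  obtain ⟨k, rfl⟩ := exists_add_of_le (add_one_le_iff'.2 h)
  rw [add_tsub_cancel_left, eps_add (n + 1) k]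
  linear_combination eps (n + 1) * eps_mul_pow k

theorem Fits.exists_lt {T : M.C ty1} {N u w : M.C Ty.nat} (h : Fits T N u w) :
    ∃ n < N, ∃ j, Good T n j ∧ ((j : M.Q) - 1) * eps (n + 1) + (w : M.Q) * eps N ≤ (u : M.Q) * eps N ∧
      (u : M.Q) * eps N + (w : M.Q) * eps N ≤ ((j : M.Q) + 1) * eps (n + 1) := by
  obtain ⟨n, hn, j, _, hg, h₁, h₂⟩ := h
  refine ⟨n, hn, j, hg, ?_⟩
  rw [← pow_sub_mul_eps hn]
  rw [nat_le] at h₁ h₂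
  push_cast at h₁ h₂
  have h₁ := mul_le_mul_of_nonneg_right h₁ (eps_pos N).le
  have h₂ := mul_le_mul_of_nonneg_right h₂ (eps_pos N).le
  constructor <;> linarith

theorem Fits.avoids {T : M.C ty1} {N u w : M.C Ty.nat} (h : Fits T N u w) :
    Avoids T ((u : M.Q) * eps N) ((w : M.Q) * eps N) := by
  obtain ⟨n, _, j, h⟩ := h.exists_lt
  exact ⟨n, j, h⟩

/-- The bounds in `Fits` cost no more than one unit `eps N`: the bound on `j` follows from the
containment, and intervals of level at least `N` allow only radii up to `eps N`. -/
theorem IsMargin.le_of_avoids {T : M.C ty1} {W : M.C (Ty.nat ⇒ Ty.nat ⇒ Ty.nat)}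
    (hW : IsMargin T W) {N u : M.C Ty.nat} {ρ : M.Q} (h : Avoids T ((u : M.Q) * eps N) ρ) :
    ρ ≤ ((W N u : M.Q) + 1) * eps N := by
  obtain ⟨n, j, hg, h₁, h₂⟩ := h
  have hε := eps_pos N
  rcases le_or_gt ρ 0 with h0 | h0
  · have := mul_nonneg (add_nonneg (coe_nonneg (W N u)) zero_le_one) hε.le
    linarith
  rcases lt_or_ge n N with hn | hn
  · obtain ⟨w, hw, hw'⟩ := exists_nat_floor (mul_pos h0 (coe_pow_pos N)).le
    have e₁ : ρ * (Struc.pow N : M.C Ty.nat) * eps N = ρ := by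
      linear_combination ρ * eps_mul_pow N
    have hw₂ := mul_le_mul_of_nonneg_right hw hε.le
    have hw₃ := mul_lt_mul_of_pos_right hw' hε
    rw [e₁] at hw₂ hw₃
    rw [← pow_sub_mul_eps hn] at h₁ h₂
    have k₁ : j * Struc.pow (N - (n + 1)) + w ≤ u + Struc.pow (N - (n + 1)) := by
      rw [nat_le]; push_cast
      refine le_of_mul_le_mul_right ?_ hε
      linarith
    have k₂ : u + w ≤ (j + 1) * Struc.pow (N - (n + 1)) := by
      rw [nat_le]; push_cast
      refine le_of_mul_le_mul_right ?_ hε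
      linarith
    have hj : j < u + 1 + 1 := by
      rw [lt_add_one_iff']
      refine le_of_mul_le_mul_right ?_ (pow_pos' (N - (n + 1)))
      refine (le_self_add.trans k₁).trans ?_
      have := pow_pos' (N - (n + 1))
      have h : u ≤ u * Struc.pow (N - (n + 1)) :=
        le_mul_of_one_le_right (Struc.zero_le' u) (by rwa [← add_one_le_iff', zero_add] at this)
      rw [add_mul, one_mul]
      exact add_le_add_left h _
    have := (hW N u).2 w ⟨n, hn, j, hj, hg, k₁, k₂⟩
    rw [nat_le] at this
    have := mul_le_mul_of_nonneg_right this hε.le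
    linarith
  · have h₃ := eps_le (hn.trans (le_self_add : n ≤ n + 1))
    have := mul_nonneg (coe_nonneg (W N u)) hε.le
    linarith

theorem Avoids.move {T : M.C ty1} {q q' ρ d : M.Q} (h : Avoids T q ρ) (h₁ : q ≤ q' + d)
    (h₂ : q' ≤ q + d) : Avoids T q' (ρ - d) := by
  obtain ⟨n, j, hg, h₃, h₄⟩ := h
  exact ⟨n, j, hg, by linarith, by linarith⟩

/-- The margin is Lipschitz with constant 1, up to a rounding error. This makes the radius a
function of real numbers. -/
theorem IsMargin.le_add {T : M.C ty1} {W : M.C (Ty.nat ⇒ Ty.nat ⇒ Ty.nat)}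
    (hW : IsMargin T W) {N u N' u' : M.C Ty.nat} {d : M.Q} (hd : 0 ≤ d)
    (h₁ : (u : M.Q) * eps N ≤ u' * eps N' + d)
    (h₂ : (u' : M.Q) * eps N' ≤ u * eps N + d) :
    (W N u : M.Q) * eps N ≤ W N' u' * eps N' + d + eps N' := by
  rcases (Struc.zero_le' (W N u)).eq_or_lt with h | h
  · rw [← h, Frac.coe_zero, zero_mul]
    have := mul_nonneg (coe_nonneg (W N' u')) (eps_pos N').le
    linarith [eps_pos N']
  · have := hW.le_of_avoids (((hW N u).1 h).avoids.move h₁ h₂)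
    linarith

/-! ### Every point is avoided -/

theorem Alive.down {T : M.C ty1} (hT : IsTree T) {n c c' : M.C Ty.nat} (h₁ : 2 * c ≤ c')
    (h₂ : c' ≤ 2 * c + 1) (h : Alive T (n + 1) c') : Alive T n c := by
  obtain ⟨b, rfl⟩ := exists_add_of_le h₁
  have hb : b ≤ 1 := by
    simp only [nat_le] at *; push_cast at *; linarith
  obtain ⟨h₃, h₄, h₅⟩ := h
  have h₆ : Struc.pow n ≤ c := by
    rw [pow_succ'] at h₃
    rw [← lt_add_one_iff']
    refine lt_of_mul_lt_mul_left (a := 2) ?_ (Struc.zero_le' 2)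
    simp only [nat_lt, nat_le] at *; push_cast at *; linarith
  refine ⟨h₆, ?_, hT _ _ ((pow_pos' n).trans_le h₆) hb h₅⟩
  rw [pow_succ' (n + 1)] at h₄
  exact lt_of_mul_lt_mul_left (le_self_add.trans_lt h₄) (Struc.zero_le' 2)

/-- The `c k` code a chain of nested dyadic intervals. If it met the tree at arbitrarily large
levels, it would meet it at every level by closure under initial segments, and its digits would form
a path. -/
theorem exists_not_alive {T : M.C ty1} (hT : IsTree T)
    (hno : ¬ ∃ f, IsBin f ∧ ∀ n, T (Struc.seg f n) = 1) (n : M.C Ty.nat) (c : M.C ty1)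
    (hc : ∀ k, 2 * c k ≤ c (k + 1) ∧ c (k + 1) ≤ 2 * c k + 1) :
    ∃ K, ∀ k, K ≤ k → ¬ Alive T (n + k) (c k) := by
  by_contra! hal
  have hal : ∀ k, Alive T (n + k) (c k) := by
    intro k
    obtain ⟨m, hm, h⟩ := hal k
    obtain ⟨l, rfl⟩ := exists_add_of_le hm
    refine Dec.induction (P := fun l => Alive T (n + (k + l)) (c (k + l)) → Alive T (n + k) (c k))
      ⟨(lam (timp
        (tand (tle (♯Struc.pow (♯n + (♯k + v0))) (♯c (♯k + v0)))
          (tand (tlt (♯c (♯k + v0)) (♯Struc.pow (♯n + (♯k + v0) + 1)))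
            (teq (♯T (♯c (♯k + v0))) 1)))
        (tand (tle (♯Struc.pow (♯n + ♯k)) (♯c ♯k)) (tand (tlt (♯c ♯k) (♯Struc.pow (♯n + ♯k + 1)))
            (teq (♯T (♯c ♯k)) 1))))).val, fun l => by simp [Alive]⟩
      (by simp) (fun l ih h => ih ?_) l h
    rw [← add_assoc, ← add_assoc] at h
    obtain ⟨h₁, h₂⟩ := hc (k + l)
    rw [← add_assoc k] at h
    exact Alive.down hT h₁ h₂ (by rwa [← add_assoc n k l] )
  have hlog : Struc.log (c 0) = n := by
    obtain ⟨h₁, h₂, -⟩ := hal 0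
    rw [add_zero] at h₁ h₂
    exact log_eq h₁ h₂
  have hpos : 0 < c 0 := by
    have := (hal 0).1
    exact (pow_pos' _).trans_le this
  -- The path begins with the `n` digits of `c 0` and continues with the choices of left or right
  -- half made along the chain.
  have hf : ∀ i, (lam (tite (tlt v0 ♯n) (♯Struc.dec (♯c 0) v0)
      (♯c (v0 - ♯n + 1) - (1 + 1) * ♯c (v0 - ♯n)))).val i =
      if i < n then Struc.dec (c 0) i else c (i - n + 1) - 2 * c (i - n) := fun i => by
    simp [one_add_one_eq_two]
  set f := (lam (tite (tlt v0 ♯n) (♯Struc.dec (♯c 0) v0)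
      (♯c (v0 - ♯n + 1) - (1 + 1) * ♯c (v0 - ♯n)))).val
  have hle : ∀ k, c (k + 1) - 2 * c k ≤ 1 := fun k => tsub_le_iff_left.2 (hc k).2
  have hbin : IsBin f := fun i => by
    rw [hf]; split_ifs
    · exact dec_le_one _ _
    · exact hle _
  have hseg : ∀ k, Struc.seg f (n + k) = c k := by
    intro k
    refine Dec.induction (P := fun k => Struc.seg f (n + k) = c k)
      ⟨(lam (teq (♯Struc.seg ♯f (♯n + v0)) (♯c v0))).val, by simp⟩ ?_ (fun k ih => ?_) k
    · rw [add_zero]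
      have := seg_dec hpos
      rw [hlog] at this
      conv_rhs => rw [← this]
      exact seg_congr fun i hi => by rw [hf, if_pos hi]
    · rw [← add_assoc, seg_succ, ih, hf, if_neg (not_lt.2 le_self_add), add_tsub_cancel_left,
        sgn_of_le_one (hle k), add_tsub_cancel_of_le (hc k).1]
  refine hno ⟨f, hbin, fun m => hT.seg (le_add_self : m ≤ n + m) ?_⟩
  rw [hseg]; exact (hal m).2.2

/-- The dyadic numbers `u N / 2 ^ N` converge with a modulus. -/
def IsApprox (u : M.C ty1) : Prop := ∀ N N', N ≤ N' →
  (u N : M.Q) * eps N ≤ (u N' : M.Q) * eps N' + 2 * eps N ∧ (u N' : M.Q) * eps N' ≤ (u N : M.Q) * eps N + 2 * eps N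

/-- The drift `2 * eps m` leaves a gap of `eps m`, and two further places make `3 * eps m'` smaller
than that. -/
theorem IsApprox.persist {u : M.C ty1} (hu : IsApprox u) {m m' : M.C Ty.nat} (h : m + 1 + 1 ≤ m')
    {a : M.Q} :
    (a + 3 * eps m ≤ (u m : M.Q) * eps m → a + 3 * eps m' ≤ (u m' : M.Q) * eps m') ∧
    ((u m : M.Q) * eps m + 3 * eps m ≤ a → (u m' : M.Q) * eps m' + 3 * eps m' ≤ a) := by
  have h₁ := eps_le h
  rw [eps_succ, eps_succ] at h₁
  rw [add_assoc] at h
  obtain ⟨h₂, h₃⟩ := hu m m' (le_self_add.trans h)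
  have := eps_pos m
  constructor <;> intro <;> linarith

theorem eps_mul_two (n : M.C Ty.nat) : eps n = 2 * eps (n + 1) := by rw [eps_succ]; ring

/-- Every point has a neighbourhood avoiding the tree. At a dyadic point, the chains of intervals
immediately to its right and left both leave the tree, after which the point is a good centre. A
point apart from all dyadic numbers lies inside one interval at each level; this chain leaves the
tree, and the midpoint of an interval outside the tree is a good centre. -/
theorem exists_good {T : M.C ty1} (hT : IsTree T)
    (hno : ¬ ∃ f, IsBin f ∧ ∀ n, T (Struc.seg f n) = 1) {u : M.C ty1} (hu : IsApprox u) :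
    ∃ m n j, Good T n j ∧ ((j : M.Q) - 1) * eps (n + 1) + 3 * eps m ≤ (u m : M.Q) * eps m ∧
      (u m : M.Q) * eps m + 3 * eps m ≤ ((j : M.Q) + 1) * eps (n + 1) := by
  by_cases hD : ∃ n j : M.C Ty.nat, ∀ m, (u m : M.Q) * eps m < (j : M.Q) * eps (n + 1) + 3 * eps m ∧
      (j : M.Q) * eps (n + 1) < (u m : M.Q) * eps m + 3 * eps m
  · obtain ⟨n, j, hj⟩ := hD
    obtain ⟨K₁, h₁⟩ := exists_not_alive hT hno n (lam (♯j * ♯Struc.pow v0)).val (fun k => by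
      have e : 2 * (j * Struc.pow k) = j * (2 * Struc.pow k) := by ring
      simp [pow_succ', e])
    obtain ⟨K₂, h₂⟩ : ∃ K, ∀ k, K ≤ k → ¬ Alive T (n + k) (j * Struc.pow k - 1) := by
      rcases (Struc.zero_le' j).eq_or_lt with h0 | h0
      · refine ⟨0, fun k _ h => ?_⟩
        rw [← h0, zero_mul, zero_tsub] at h
        exact absurd (pow_pos' (n + k)) (not_lt.2 h.1)
      · obtain ⟨K, hK⟩ := exists_not_alive hT hno n (lam (♯j * ♯Struc.pow v0 - 1)).val (fun k => by
          have h : ∀ k, 1 ≤ j * Struc.pow k := fun k => by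
            rw [← zero_add (1 : M.C Ty.nat), add_one_le_iff']
            exact mul_pos h0 (pow_pos' k)
          simp only [val_lam, eval_sub, PTm.eval_mul, PTm.eval_app, eval_cst, PTm.eval_var_z,
            PTm.eval_one]
          simp only [nat_le]
          push_cast
          rw [Frac.coe_sub (h k), Frac.coe_sub (h (k + 1)), pow_succ']
          push_cast
          constructor <;> linarith)
        exact ⟨K, by simpa using hK⟩
    set k := max K₁ K₂
    have hk₁ := h₁ k (le_max_left _ _)
    simp only [val_lam, PTm.eval_mul, PTm.eval_app, eval_cst, PTm.eval_var_z] at hk₁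
    -- With this index `m`, the half-length of the good interval is `8 * eps m`, enough for the
    -- error `3 * eps m` of the point and the required margin `3 * eps m`.
    refine ⟨n + k + 1 + 1 + 1 + 1, n + k, j * Struc.pow k, ⟨hk₁, h₂ k (le_max_right _ _)⟩, ?_⟩
    obtain ⟨h₃, h₄⟩ := hj (n + k + 1 + 1 + 1 + 1)
    have e₁ : (j : M.Q) * ((Struc.pow k : M.C Ty.nat) : M.Q) * eps (n + k + 1) = (j : M.Q) * eps (n + 1) := by
      rw [eps_succ (n + k), eps_succ n, eps_add]
      linear_combination (j : M.Q) * eps n / 2 * eps_mul_pow k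
    push_cast
    have e₂ : eps (n + k + 1) = 8 * eps (n + k + 1 + 1 + 1 + 1) := by
      rw [eps_mul_two, eps_mul_two (n + k + 1 + 1), eps_mul_two (n + k + 1 + 1 + 1)]; ring
    have := eps_pos (n + k + 1 + 1 + 1 + 1)
    rw [sub_mul, add_mul, e₁, e₂]
    constructor <;> linarith
  · push Not at hD
    have hdec : ∀ n j : M.C Ty.nat, (∃ m, (j : M.Q) * eps (n + 1) + 3 * eps m ≤ (u m : M.Q) * eps m) ∨
        ∃ m, (u m : M.Q) * eps m + 3 * eps m ≤ (j : M.Q) * eps (n + 1) := by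
      intro n j
      obtain ⟨m, hm⟩ := hD n j
      by_cases h : (u m : M.Q) * eps m < (j : M.Q) * eps (n + 1) + 3 * eps m
      · exact .inr ⟨m, hm h⟩
      · exact .inl ⟨m, not_lt.1 h⟩
    have merge : ∀ {a b : M.Q}, (∃ m, a + 3 * eps m ≤ (u m : M.Q) * eps m) →
        (∃ m, (u m : M.Q) * eps m + 3 * eps m ≤ b) →
        ∃ m, a + 3 * eps m ≤ (u m : M.Q) * eps m ∧ (u m : M.Q) * eps m + 3 * eps m ≤ b := by
      rintro a b ⟨m, hm⟩ ⟨m', hm'⟩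
      refine ⟨max m m' + 1 + 1, (hu.persist ?_).1 hm, (hu.persist ?_).2 hm'⟩
      · simp only [add_le_add_iff_right]; exact le_max_left _ _
      · simp only [add_le_add_iff_right]; exact le_max_right _ _
    have hcell : ∀ n, ∃ m h : M.C Ty.nat, (h : M.Q) * eps (n + 1) + 3 * eps m ≤ (u m : M.Q) * eps m ∧
        (u m : M.Q) * eps m + 3 * eps m ≤ ((h : M.Q) + 1) * eps (n + 1) := by
      intro n
      -- Rounding down at this precision leaves three candidate intervals, with left ends `k - 1`,
      -- `k` and `k + 1`. Comparing the point with `k` and `k + 1` selects one.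
      set m := n + 1 + 1 + 1
      have e : eps (n + 1) = 4 * eps m := by
        rw [eps_mul_two, eps_mul_two (n + 1 + 1)]; ring
      have hm := eps_pos m
      obtain ⟨k, hk, hk'⟩ := exists_nat_floor (mul_nonneg
        (mul_nonneg (coe_nonneg (u m)) hm.le) (coe_pow_pos (n + 1)).le)
      have e₁ : (u m : M.Q) * eps m * ((Struc.pow (n + 1) : M.C Ty.nat) : M.Q) * eps (n + 1) = (u m : M.Q) * eps m := by
        linear_combination (u m : M.Q) * eps m * eps_mul_pow (n + 1)
      have hk := mul_le_mul_of_nonneg_right hk (eps_pos (n + 1)).le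
      have hk' := mul_lt_mul_of_pos_right hk' (eps_pos (n + 1))
      rw [e₁] at hk hk'
      have lo : ∃ m, ((k : M.Q) - 1) * eps (n + 1) + 3 * eps m ≤ (u m : M.Q) * eps m :=
        ⟨m, by linarith⟩
      have hi : ∃ m, (u m : M.Q) * eps m + 3 * eps m ≤
          (((k + 1 : M.C Ty.nat) : M.Q) + 1) * eps (n + 1) :=
        ⟨m, by push_cast; linarith⟩
      rcases hdec n k with h₁ | h₁
      · rcases hdec n (k + 1) with h₂ | h₂
        · obtain ⟨m, hm⟩ := merge h₂ hi
          exact ⟨m, k + 1, hm⟩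
        · push_cast at h₂
          obtain ⟨m, hm⟩ := merge h₁ h₂
          exact ⟨m, k, hm⟩
      · rcases (Struc.zero_le' k).eq_or_lt with h0 | h0
        · obtain ⟨m, hm⟩ := h₁
          rw [← h0, Frac.coe_zero, zero_mul] at hm
          have := mul_nonneg (coe_nonneg (u m)) (eps_pos m).le
          have := eps_pos m
          linarith
        · obtain ⟨p, rfl⟩ := exists_eq_add_one h0.ne'
          push_cast at lo h₁
          rw [add_sub_cancel_right] at lo
          obtain ⟨m, hm⟩ := merge lo h₁
          exact ⟨m, p, hm⟩
    have hiff : ∀ n m h : M.C Ty.nat, ((h : M.Q) * eps (n + 1) + 3 * eps m ≤ (u m : M.Q) * eps m ∧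
        (u m : M.Q) * eps m + 3 * eps m ≤ ((h : M.Q) + 1) * eps (n + 1)) ↔
        h * Struc.pow m + (1 + 1 + 1) * Struc.pow (n + 1) ≤ u m * Struc.pow (n + 1) ∧
        u m * Struc.pow (n + 1) + (1 + 1 + 1) * Struc.pow (n + 1) ≤ (h + 1) * Struc.pow m := by
      intro n m h
      have hpos := mul_pos (eps_pos m) (eps_pos (n + 1))
      have e₁ : ∀ a : M.Q, a * ((Struc.pow m : M.C Ty.nat) : M.Q) * (eps m * eps (n + 1)) =
        a * eps (n + 1) := fun a => by linear_combination a * eps (n + 1) * eps_mul_pow m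
      have e₂ : ∀ a : M.Q, a * ((Struc.pow (n + 1) : M.C Ty.nat) : M.Q) * (eps m * eps (n + 1)) =
        a * eps m := fun a => by linear_combination a * eps m * eps_mul_pow (n + 1)
      have e₃ : (1 + 1 + 1 : M.Q) = 3 := by norm_num
      refine and_congr ?_ ?_ <;> rw [nat_le] <;>
        refine Iff.trans ?_ (mul_le_mul_iff_of_pos_right hpos) <;> push_cast
      · rw [add_mul _ _ (eps m * eps (n + 1)), e₁, e₂, e₂, e₃]
      · rw [add_mul _ _ (eps m * eps (n + 1)), e₂, e₂, e₁, e₃]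
    -- With denominators cleared the condition is quantifier-free. The precision `m` is chosen
    -- first, with `h` under a bounded quantifier, and then `h`.
    obtain ⟨H, hH⟩ : ∃ H : M.C ty1, ∀ n, ∃ m,
        (H n : M.Q) * eps (n + 1) + 3 * eps m ≤ (u m : M.Q) * eps m ∧
        (u m : M.Q) * eps m + 3 * eps m ≤ ((H n : M.Q) + 1) * eps (n + 1) := by
      simp only [hiff] at hcell ⊢
      obtain ⟨m, hm⟩ : ∃ m : M.C ty1, ∀ n, ∃ h < u (m n) * Struc.pow (n + 1) + 1,
          h * Struc.pow (m n) + (1 + 1 + 1) * Struc.pow (n + 1) ≤ u (m n) * Struc.pow (n + 1) ∧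
          u (m n) * Struc.pow (n + 1) + (1 + 1 + 1) * Struc.pow (n + 1) ≤
            (h + 1) * Struc.pow (m n) := by
        obtain ⟨m, hm⟩ := choice_nat (M := M) (lam (lam (tex (♯u v0 * ♯Struc.pow (v1 + 1) + 1) (tand
          (tle (v0 * ♯Struc.pow v1 + (1 + 1 + 1) * ♯Struc.pow (v2 + 1))
            (♯u v1 * ♯Struc.pow (v2 + 1)))
          (tle (♯u v1 * ♯Struc.pow (v2 + 1) + (1 + 1 + 1) * ♯Struc.pow (v2 + 1))
            ((v0 + 1) * ♯Struc.pow v1)))))).val (fun n => by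
              obtain ⟨m, h, h₁, h₂⟩ := hcell n
              refine ⟨m, ?_⟩
              simp only [val_lam, eval_lam, eval_ex, eval_and, eval_le, PTm.eval_app, eval_cst,
                PTm.eval_add, PTm.eval_mul, PTm.eval_one, PTm.eval_var_z, PTm.eval_var_s]
              refine ⟨h, ?_, h₁, h₂⟩
              have hp := add_one_le_iff'.2 (pow_pos' m)
              rw [zero_add] at hp
              rw [lt_add_one_iff']
              exact (le_mul_of_one_le_right (Struc.zero_le' h) hp).trans (le_self_add.trans h₁))
        refine ⟨m, ?_⟩
        simpa only [val_lam, eval_lam, eval_ex, eval_and, eval_le, PTm.eval_app, eval_cst,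
          PTm.eval_add, PTm.eval_mul, PTm.eval_one, PTm.eval_var_z, PTm.eval_var_s] using hm
      obtain ⟨H, hH⟩ := choice_nat (M := M) (lam (lam (tand
          (tle (v0 * ♯Struc.pow (♯m v1) + (1 + 1 + 1) * ♯Struc.pow (v1 + 1))
            (♯u (♯m v1) * ♯Struc.pow (v1 + 1)))
          (tle (♯u (♯m v1) * ♯Struc.pow (v1 + 1) + (1 + 1 + 1) * ♯Struc.pow (v1 + 1))
            ((v0 + 1) * ♯Struc.pow (♯m v1)))))).val (fun n => by
              obtain ⟨h, _, h₁, h₂⟩ := hm n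
              exact ⟨h, by simpa using ⟨h₁, h₂⟩⟩)
      refine ⟨H, fun n => ⟨m n, ?_⟩⟩
      simpa only [val_lam, eval_lam, eval_ex, eval_and, eval_le, PTm.eval_app, eval_cst,
          PTm.eval_add, PTm.eval_mul, PTm.eval_one, PTm.eval_var_z, PTm.eval_var_s] using hH n
    have hstep : ∀ k, 2 * H k ≤ H (k + 1) ∧ H (k + 1) ≤ 2 * H k + 1 := by
      intro k
      obtain ⟨m, h₁, h₂⟩ := hH k
      obtain ⟨m', h₃, h₄⟩ := hH (k + 1)
      have hε := eps_pos (k + 1 + 1)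
      rw [eps_mul_two (k + 1)] at h₁ h₂
      obtain ⟨l, h₅, h₆⟩ := merge ⟨m, h₁⟩ ⟨m', h₄⟩
      obtain ⟨l', h₇, h₈⟩ := merge ⟨m', h₃⟩ ⟨m, h₂⟩
      have := eps_pos l
      have := eps_pos l'
      constructor <;> rw [← lt_add_one_iff', ← Frac.coe_lt] <;> push_cast <;>
        refine lt_of_mul_lt_mul_right ?_ hε.le <;> linarith
    obtain ⟨n, hn⟩ := exists_not_alive hT hno 0 H hstep
    have hn := hn n le_rfl
    rw [zero_add] at hn
    obtain ⟨m, h₁, h₂⟩ := hH n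
    -- If an interval is outside the tree, so are its two halves, and these are the neighbours of
    -- its midpoint.
    refine ⟨m, n + 1, 2 * H n + 1, ⟨fun h => hn (h.down hT le_self_add le_rfl), fun h => hn ?_⟩, ?_⟩
    · rw [add_tsub_cancel_right] at h
      exact h.down hT le_rfl le_self_add
    · rw [eps_mul_two (n + 1)] at h₁ h₂
      push_cast
      constructor <;> linarith

end

section
variable {M : Struc} [hM : M.IsModel]
open PTm

/-! ### The radius function -/

/-- The integral part of `2 ^ N` times the positive part of the `N`-th term of `x`. -/
noncomputable def Struc.scale : M.C (ty1 ⇒ ty1) :=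
  (lam (lam (♯Struc.div (♯Struc.ratA (v1 ◦ v0) * ♯Struc.pow v0) (♯Struc.ratD (v1 ◦ v0) + 1)))).val

theorem scale_spec (x : M.C ty1) (N : M.C Ty.nat) :
    (Struc.scale x N : M.Q) * eps N ≤ max (rv x N) 0 ∧
      max (rv x N) 0 < Struc.scale x N * eps N + eps N := by
  set c := x N
  have hs : Struc.scale x N =
      Struc.div (Struc.ratA c * Struc.pow N) (Struc.ratD c + 1) := by simp [Struc.scale, c]
  have hd : (0 : M.Q) < Struc.ratD c + 1 := by linarith [coe_nonneg (Struc.ratD c)]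
  have hmax : max (rv x N) 0 = (Struc.ratA c : M.Q) / (Struc.ratD c + 1) := by
    change max (ratVal c) 0 = _
    obtain ⟨u, -, ⟨-, h⟩ | ⟨-, h⟩⟩ := isRat_self c
    · rw [ratVal, h, Frac.coe_zero, sub_zero]
      exact max_eq_left (div_nonneg (coe_nonneg _) hd.le)
    · rw [ratVal, h, Frac.coe_zero, zero_div, zero_sub]
      exact max_eq_right (div_nonpos_of_nonpos_of_nonneg
        (neg_nonpos.2 (coe_nonneg _)) hd.le)
  have h₁ := div_mul_le (Struc.ratA c * Struc.pow N) (Struc.ratD c + 1)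
  have h₂ := lt_div_add_one_mul (Struc.ratA c * Struc.pow N)
    (add_pos_of_nonneg_of_pos (Struc.zero_le' (Struc.ratD c)) one_pos)
  rw [← hs] at h₁ h₂
  rw [← Frac.coe_le] at h₁
  rw [← Frac.coe_lt] at h₂
  push_cast at h₁ h₂
  have h₁ := mul_le_mul_of_nonneg_right h₁ (eps_pos N).le
  have h₂ := mul_lt_mul_of_pos_right h₂ (eps_pos N)
  have e : (Struc.ratA c : M.Q) * (Struc.pow N : M.C Ty.nat) * eps N = Struc.ratA c := by
    linear_combination (Struc.ratA c : M.Q) * eps_mul_pow N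
  rw [e] at h₁ h₂
  rw [hmax, le_div_iff₀ hd, div_lt_iff₀ hd]
  constructor <;> linarith

theorem scale_le {x y : M.C ty1} {N N' : M.C Ty.nat} {d : M.Q} (hd : 0 ≤ d)
    (h : rv x N ≤ rv y N' + d) :
    (Struc.scale x N : M.Q) * eps N ≤ Struc.scale y N' * eps N' + (d + eps N') := by
  have h₁ := (scale_spec x N).1
  have h₂ := (scale_spec y N').2
  have h₃ : max (rv x N) 0 ≤ max (rv y N') 0 + d :=
    max_le (h.trans (add_le_add_left (le_max_left _ _) d)) (add_nonneg (le_max_right _ _) hd)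
  linarith

theorem IsReal.isApprox {x : M.C ty1} (hx : IsReal x) : IsApprox (Struc.scale x) := by
  intro N N' h
  obtain ⟨h₁, h₂⟩ := hx.lt h
  have h₃ := scale_le (eps_pos N).le h₁.le
  have h₄ := scale_le (eps_pos N).le h₂.le
  have := eps_le h
  constructor <;> linarith

/-- The real number `x` has distance at least `radius x` from the tree; the radius is given by its
approximations. -/
noncomputable def Struc.radius (W : M.C (Ty.nat ⇒ Ty.nat ⇒ Ty.nat)) : M.C (ty1 ⇒ ty1) :=
  (lam (lam (♯Struc.mkrat (♯W (v0 + 1 + 1 + 1) (♯Struc.scale v1 (v0 + 1 + 1 + 1)))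
    (♯Struc.pow (v0 + 1 + 1 + 1 + 1))))).val

theorem rv_radius (W : M.C (Ty.nat ⇒ Ty.nat ⇒ Ty.nat)) (x : M.C ty1) (n : M.C Ty.nat) :
    rv (Struc.radius W x) n =
      (W (n + 1 + 1 + 1) (Struc.scale x (n + 1 + 1 + 1)) : M.Q) * eps (n + 1 + 1 + 1) / 2 := by
  have : rv (Struc.radius W x) n = ratVal (Struc.mkrat
      (W (n + 1 + 1 + 1) (Struc.scale x (n + 1 + 1 + 1))) (Struc.pow (n + 1 + 1 + 1 + 1))) := by
    simp [rv, Struc.radius]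
  rw [this, ratVal_mkrat _ (pow_pos' _), mul_div_assoc, ← eps_succ, eps, mul_one_div]

variable {T : M.C ty1} {W : M.C (Ty.nat ⇒ Ty.nat ⇒ Ty.nat)}

theorem IsMargin.scale_le (hW : IsMargin T W) {x y : M.C ty1} {N N' : M.C Ty.nat} {d : M.Q}
    (hd : 0 ≤ d) (h₁ : rv x N ≤ rv y N' + d) (h₂ : rv y N' ≤ rv x N + d) (hN : eps N ≤ d)
    (hN' : eps N' ≤ d) :
    (W N (Struc.scale x N) : M.Q) * eps N ≤ W N' (Struc.scale y N') * eps N' + 2 * d + eps N' := by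
  have h₃ := HOA.scale_le hd h₁
  have h₄ := HOA.scale_le hd h₂
  have := hW.le_add (d := 2 * d) (by linarith) (h₃.trans (by linarith)) (h₄.trans (by linarith))
  linarith

theorem eps_three (n : M.C Ty.nat) : eps n = 8 * eps (n + 1 + 1 + 1) := by
  rw [eps_mul_two n, eps_mul_two (n + 1), eps_mul_two (n + 1 + 1)]; ring

/-- Convergence and independence of the representation follow from the Lipschitz estimate; the shift
by three places absorbs the rounding. Positivity is `exists_good`. -/
theorem isPosRealFun_radius (hW : IsMargin T W) (hT : IsTree T)
    (hno : ¬ ∃ f, IsBin f ∧ ∀ n, T (Struc.seg f n) = 1) : IsPosRealFun (Struc.radius W) := by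
  refine ⟨fun x hx => ⟨fun n i => ?_, ?_⟩, fun x y hx hy hxy n => ?_⟩
  · rw [rv_radius, rv_radius]
    set N := n + 1 + 1 + 1
    set N' := n + i + 1 + 1 + 1
    have hN : N ≤ N' := by simp only [N, N', add_le_add_iff_right]; exact le_self_add
    have hε := eps_pos N
    have hε' := eps_le hN
    obtain ⟨h₁, h₂⟩ := hx.lt hN
    have h₃ := hW.scale_le hε.le h₁.le h₂.le le_rfl hε'
    have h₄ := hW.scale_le hε.le h₂.le h₁.le hε' le_rfl
    have := eps_three n
    constructor <;> linarith
  · obtain ⟨m, n, j, hg, h₁, h₂⟩ := exists_good hT hno hx.isApprox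
    refine ⟨m + 1 + 1 + 1, ?_⟩
    rw [rv_radius]
    set N := m + 1 + 1 + 1 + 1 + 1 + 1
    have hN : m ≤ N := by simp only [N, add_assoc]; exact le_self_add
    obtain ⟨h₃, h₄⟩ := hx.isApprox _ _ hN
    have hav : Avoids T ((Struc.scale x N : M.Q) * eps N) (eps m) :=
      ⟨n, j, hg, by linarith, by linarith⟩
    -- In units of `eps N`, the avoided radius `eps m` is 64, so the margin is at least 63. Half of
    -- it exceeds `2 * eps (m + 3)`, which is 16 units.
    have := hW.le_of_avoids hav
    have := eps_three m
    have := eps_three (m + 1 + 1 + 1)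
    have := eps_pos N
    linarith
  · rw [rv_radius, rv_radius]
    set N := n + 1 + 1 + 1
    obtain ⟨h₁, h₂⟩ := hxy N
    have hε := eps_pos N
    have h₃ := hW.scale_le (d := 2 * eps N) (by linarith) h₂ h₁ (by linarith) (by linarith)
    have h₄ := hW.scale_le (d := 2 * eps N) (by linarith) h₁ h₂ (by linarith) (by linarith)
    have := eps_three n
    constructor <;> linarith

/-- Take a sequence `s` in the tree longer than the levels of all good intervals around the finitely
many centres. The left end of the interval of `s` is covered, hence lies in one of these good
intervals, so an initial segment of `s` codes one of its two halves. But both halves are outside the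
tree. -/
theorem WKL_of_HBU (h : M.Models HBU) : M.Models WKL := by
  rw [models_HBU] at h
  rw [models_WKL]
  intro T hT hinf
  by_contra hno
  obtain ⟨W, hW⟩ := exists_margin T
  have hpos := isPosRealFun_radius hW hT hno
  obtain ⟨k, Y, hY, hcov⟩ := h _ hpos
  -- Positivity of the radius gives a margin above 32 units at some precision. The value 16
  -- suffices: the radius is half the margin, and the other half, at least 8 units, exceeds all
  -- rounding errors.
  obtain ⟨N, hN⟩ : ∃ N : M.C ty1, ∀ i < k, 16 ≤ (W (N i) (Struc.scale (Y i) (N i)) : M.Q) := by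
    have key : ∀ i N, 16 ≤ (W N (Struc.scale (Y i) N) : M.Q) ↔
        Struc.pow (1 + 1 + 1 + 1) ≤ W N (Struc.scale (Y i) N) := by
      intro i N
      have e : ((Struc.pow (1 + 1 + 1 + 1) : M.C Ty.nat) : M.Q) = 16 := by
        have : (1 + 1 + 1 + 1 : M.C Ty.nat) = 0 + 1 + 1 + 1 + 1 := by rw [zero_add]
        rw [this, pow_succ', pow_succ', pow_succ', pow_succ', pow_zero']
        push_cast; norm_num
      rw [nat_le, e]
    obtain ⟨N, hN⟩ := choice_nat (M := M) (lam (lam (timp (tlt v1 ♯k)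
      (tle (♯Struc.pow (1 + 1 + 1 + 1)) (♯W v0 (♯Struc.scale (♯Y v1) v0)))))).val (fun i => by
        by_cases hi : i < k
        · obtain ⟨n, hn⟩ := (hpos.1 _ (hY i hi).1).2
          rw [rv_radius] at hn
          refine ⟨n + 1 + 1 + 1, ?_⟩
          have : 16 ≤ (W (n + 1 + 1 + 1) (Struc.scale (Y i) (n + 1 + 1 + 1)) : M.Q) := by
            have hε := eps_pos (n + 1 + 1 + 1)
            have := eps_three n
            refine le_of_mul_le_mul_right ?_ hε
            linarith
          simpa using fun _ => (key i _).1 this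
        · exact ⟨0, by simp [hi]⟩)
    refine ⟨N, fun i hi => (key i _).2 ?_⟩
    have := hN i
    simp only [val_lam, eval_lam, eval_imp, eval_lt, eval_le, PTm.eval_app, eval_cst, PTm.eval_add,
      PTm.eval_one, PTm.eval_var_z, PTm.eval_var_s] at this
    exact this hi
  obtain ⟨B, hB⟩ := exists_bound N k
  obtain ⟨s, hs, hlog, hTs⟩ := hinf.exists_log B
  set L := Struc.log s
  have hεL := eps_pos (L + 1)
  have hs₁ : s < Struc.pow (L + 1) := lt_pow_log s
  set a : M.Q := (s : M.Q) * eps (L + 1)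
  have ha₀ : 0 ≤ a := mul_nonneg (coe_nonneg s) hεL.le
  have ha₁ : a ≤ 1 := by
    have := mul_lt_mul_of_pos_right (Frac.coe_lt.2 hs₁) hεL
    rw [mul_comm ((Struc.pow (L + 1) : M.C Ty.nat) : M.Q), eps_mul_pow] at this
    exact this.le
  set x : M.C ty1 := M.K Ty.nat Ty.nat (Struc.mkrat s (Struc.pow (L + 1)))
  have hx : ∀ n, rv x n = a := fun n => by
    simp only [rv, x, Struc.K_app, a]
    rw [ratVal_mkrat _ (pow_pos' (L + 1)), eps, mul_one_div]
  obtain ⟨i, hi, ⟨n₁, h₁⟩, ⟨n₂, h₂⟩⟩ := hcov x ⟨fun n i => by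
    have := eps_pos n
    simp only [hx]; constructor <;> linarith, fun n => by
    have := eps_pos n
    rw [hx]; constructor <;> linarith⟩
  rw [hx] at h₁ h₂
  have hy := (hY i hi).1
  have hr := (hpos.1 _ hy).1
  have hNi := hN i hi
  set y := Y i
  set n₀ := N i
  set r := Struc.radius W y
  set m := max n₀ (max (n₁ + 1) (n₂ + 1))
  have hm₀ : n₀ ≤ m := le_max_left _ _
  have hm₁ : n₁ + 1 ≤ m := (le_max_left _ _).trans (le_max_right _ _)
  have hm₂ : n₂ + 1 ≤ m := (le_max_right _ _).trans (le_max_right _ _)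
  have hlow : rv y m < a + rv r m := by
    have := (hy.lt (le_self_add.trans hm₁)).2
    have := (hr.lt hm₁).1
    have := eps_succ n₁
    have := eps_pos n₁
    linarith
  have hup : a < rv y m + rv r m := by
    have := (hy.lt hm₂).1
    have := (hr.lt hm₂).1
    have := eps_succ n₂
    have := eps_pos n₂
    linarith
  set u := Struc.scale y n₀
  set w := W n₀ u
  have hε := eps_pos n₀
  have hm₃ : n₀ ≤ m + 1 + 1 + 1 := by rw [add_assoc, add_assoc]; exact hm₀.trans le_self_add
  have hrm : rv r m ≤ (w * eps n₀ + 3 * eps n₀) / 2 := by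
    obtain ⟨h₃, h₄⟩ := hy.lt hm₃
    have := hW.scale_le hε.le h₄.le h₃.le (eps_le hm₃) le_rfl
    rw [rv_radius]
    linarith
  obtain ⟨h₃, h₄⟩ := hy.lt hm₀
  obtain ⟨h₅, h₆⟩ := scale_spec y n₀
  have hw : 16 * eps n₀ ≤ w * eps n₀ := mul_le_mul_of_nonneg_right hNi hε.le
  have hqa : u * eps n₀ < a + w * eps n₀ := by
    rcases le_total (rv y n₀) 0 with h0 | h0
    · rw [max_eq_right h0] at h₅; linarith
    · rw [max_eq_left h0] at h₅; linarith
  have haq : a < u * eps n₀ + w * eps n₀ := by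
    have := (le_max_left (rv y n₀) 0).trans_lt h₆
    linarith
  have hw0 : 0 < w := by
    rw [← Frac.coe_lt, Frac.coe_zero]; linarith
  obtain ⟨n, hn, j, hg, h₇, h₈⟩ := Fits.exists_lt ((hW n₀ u).1 hw0)
  have hnL : n ≤ L := hn.le.trans ((hB i hi).trans hlog)
  -- The ancestor of `s` at level `n` has an interval containing the covered point, which lies
  -- strictly between `j - 1` and `j + 1` in units of `eps (n + 1)`. So `c` is `j` or `j - 1`.
  set c := Struc.seg (Struc.dec s) n
  have hal : Alive T n c :=
    ⟨(seg_bounds _ n).1, (seg_bounds _ n).2, hT.seg_dec hs hnL hTs⟩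
  have hc : c = Struc.div s (Struc.pow (L - n)) := seg_dec_of_le hs hnL
  have hc₁ := div_mul_le s (Struc.pow (L - n))
  have hc₂ := lt_div_add_one_mul s (pow_pos' (L - n))
  have e := pow_sub_mul_eps (lt_add_one_iff'.2 hnL)
  rw [add_tsub_add_eq_tsub_right] at e
  rw [← hc, ← Frac.coe_le] at hc₁
  rw [← hc, ← Frac.coe_lt] at hc₂
  have hc₁ := mul_le_mul_of_nonneg_right hc₁ hεL.le
  have hc₂ := mul_lt_mul_of_pos_right hc₂ hεL
  push_cast at hc₁ hc₂
  rw [mul_assoc, e] at hc₁ hc₂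
  have hn₀ := eps_pos (n + 1)
  have hcj : c ≤ j := by
    rw [← lt_add_one_iff', ← Frac.coe_lt]; push_cast
    refine lt_of_mul_lt_mul_right ?_ hn₀.le
    linarith
  have hjc : j ≤ c + 1 := by
    rw [← lt_add_one_iff', ← Frac.coe_lt]; push_cast
    refine lt_of_mul_lt_mul_right ?_ hn₀.le
    linarith
  rcases hjc.eq_or_lt with h | h
  · refine hg.2 ?_
    rwa [h, add_tsub_cancel_right]
  · rw [lt_add_one_iff'] at h
    exact hg.1 (le_antisymm hcj h ▸ hal)

/-! ## The equivalences -/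

theorem models_of_provable {X : Sentence} (hACA : (RCA0omega ∪ ACA).Proves X)
    (h : M.Models existsTwo) : M.Models X :=
  hM.sound hACA fun _ => ACA_of_existsTwo h

theorem WKL_of_provable {X : Sentence} (hWKL : (RCA0omega ∪ {X}).Proves WKL)
    (h : M.Models X) : M.Models WKL :=
  hM.sound hWKL fun _ hψ => hψ ▸ h

end
end HOA

theorem mainTheorem1 (X : HOA.Sentence) (hX : X.IsL2)
    (hACA : (HOA.RCA0omega ∪ HOA.ACA).Proves X)
    (hWKL : (HOA.RCA0omega ∪ {X}).Proves HOA.WKL) :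
    HOA.RCA0omega.Proves (HOA.WKL.iff (HOA.existsTwo.or HOA.HBUc)) ∧
    HOA.RCA0omega.Proves ((HOA.existsTwo.or HOA.HBUc).iff (X.or HOA.HBU)) ∧
    HOA.RCA0omega.Proves ((X.or HOA.HBU).iff (HOA.FF.or HOA.HBUc)) := by
  have key : ∀ M : HOA.Struc, M.IsModel →
      (M.Models HOA.WKL ↔ M.Models HOA.existsTwo ∨ M.Models HOA.HBUc) ∧
      (M.Models HOA.WKL ↔ M.Models X ∨ M.Models HOA.HBU) ∧
      (M.Models HOA.WKL ↔ M.Models HOA.FF ∨ M.Models HOA.HBUc) := by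
    intro M hM
    have hX : M.Models X → M.Models HOA.WKL := HOA.WKL_of_provable hWKL
    have hE : M.Models HOA.existsTwo → M.Models X := HOA.models_of_provable hACA
    have hor (h : M.Models HOA.WKL) : M.Models HOA.existsTwo ∨ M.Models HOA.HBUc :=
      or_iff_not_imp_left.2 (HOA.HBUc_of_WKL h)
    exact ⟨⟨hor, Or.rec (fun h => hX (hE h)) HOA.WKL_of_HBUc⟩,
      ⟨fun h => (hor h).imp hE HOA.HBU_of_HBUc, Or.rec hX HOA.WKL_of_HBU⟩,
      ⟨fun h => (hor h).imp_left (HOA.FF_of_existsTwo h), Or.rec HOA.WKL_of_FF HOA.WKL_of_HBUc⟩⟩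
  refine ⟨HOA.RCA0omega.proves_of_models fun M hM => ?_,
    HOA.RCA0omega.proves_of_models fun M hM => ?_,
    HOA.RCA0omega.proves_of_models fun M hM => ?_⟩ <;>
  obtain ⟨h₁, h₂, h₃⟩ := key M hM <;>
  simp only [HOA.Struc.models_iff, HOA.Struc.models_or]
  · exact h₁
  · exact h₁.symm.trans h₂
  · exact h₂.symm.trans h₃
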